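/- Let $\mathbb K=\mathbb R$ or $\mathbb C$, $d\in\mathbb N$, $S^1=\mathbb R/\mathbb Z$, and let $\omega=(\omega_{ij})$ be a real antisymmetric invertible $d\times d$ matrix with inverse $(\omega^{ij})$. The Connes space ${\rm CO}_{\infty-}$ is the space of sequences $F=\sum_{n\ge0}F^n$, where $F^n:(S^1)^n\to(\mathbb K^d)^{\otimes n}$ is smooth and symmetric (under simultaneous permutation of the variables and of the tensor factors), such that for all $k\in\mathbb N$ and $C>0$ $$\|F\|_{k,C}=\sum_n C^n\sum_{0\le a_1,\dots,a_n\le k}\Big\|\frac{\partial^{a_1+\cdots+a_n}F^n}{\partial s_1^{a_1}\cdots\partial s_n^{a_n}}\Big\|_\infty<\infty .$$ The Wick product is ${:F.G:}=\sum_{n,m}F^n\widehat\otimes G^m$, where $\widehat\otimes$ is the symmetrized tensor product $$(F^n\widehat\otimes G^m)(s)=\frac1{(n+m)!}\sum_{\sigma\in\mathfrak S_{n+m}}F^n(s_{\sigma(1)},\dots,s_{\sigma(n)})\otimes G^m(s_{\sigma(n+1)},\dots,s_{\sigma(n+m)})$$ (the tensor factors being permuted together with the variables). For $h:S^1\to\mathbb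 R^d$, the annihilation operator is $$a_hF=\sum_{n\ge1}\sum_{i=1}^n\int_{S^1}\Big[\langle F^n(\dots,\bar s_i,\dots),h(\bar s_i)\rangle+\Big\langle\frac{\partial}{\partial\bar s_i}F^n(\dots,\bar s_i,\dots),\dot h(\bar s_i)\Big\rangle\Big]d\bar s_i ,$$ where $\langle\cdot,\cdot\rangle$ is the $\mathbb K$-bilinear pairing in the $i$-th tensor factor. Let $e_1,\dots,e_d$ be the canonical basis of $\mathbb R^d$ and, for $1\le i\le d$ and $k\in\mathbb Z$, let $$\gamma_{i,0}=e_i,\qquad \gamma_{i,k}(s)=\frac{\sqrt2\cos(2\pi ks)}{\sqrt{4\pi^2k^2+1}}\,e_i\ (k>0),\qquad \gamma_{i,k}(s)=\frac{\sqrt2\sin(2\pi ks)}{\sqrt{4\pi^2k^2+1}}\,e_i\ (k<0),$$ an orthonormal basis of the Hilbert space $\mathcal H(S^1,\mathbb R^d)$ with norm $\|\gamma\|^2=\int_0^1|\gamma|^2ds+\int_0^1|\dot\gamma|^2ds$. Put $$\{F,G\}=\sum_{k\in\mathbb Z}\sum_{i,j=1}^d(4\pi^2k^2+1)\,\omega^{ij}\,{:a_{\gamma_{i,k}}F.\,a_{\gamma_{j,k}}G:}\,,$$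 $$P^r(F,G)=\sum_{k_1,\dots,k_r\in\mathbb Z}\ \sum_{\substack{1\le i_1,\dots,i_r\le d\\1\le j_1,\dots,j_r\le d}}\ \prod_{l=1}^r(4\pi^2k_l^2+1)\,\omega^{i_lj_l}\ {:a_{\gamma_{i_1,k_1}}\cdots a_{\gamma_{i_r,k_r}}F.\,a_{\gamma_{j_1,k_1}}\cdots a_{\gamma_{j_r,k_r}}G:}\qquad(r\ge0).$$ Theorem. For all $F,G\in{\rm CO}_{\infty-}$ the series defining $\{F,G\}$ and $P^r(F,G)$, $r\ge 0$, converge unconditionally in ${\rm CO}_{\infty-}$, i.e. for all the norms $\|\cdot\|_{k,C}$, and the Moyal formula $$F\star_\hbar G={:F.G:}+\sum_{r\ge1}\frac{\hbar^r}{r!}P^r(F,G),$$ extended to formal series by $\big(\sum_a\hbar^aF_a\big)\star_\hbar\big(\sum_b\hbar^bG_b\big)=\sum_{r,a,b}\frac{\hbar^{r+a+b}}{r!}P^r(F_a,G_b)$, defines a deformation quantization of $\{\cdot,\cdot\}$ on ${\rm CO}_{\infty-}$. That is, $\star_\hbar$ is a $\mathbb K[[\hbar]]$-bilinear map from ${\rm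 CO}_{\infty-}[[\hbar]]\times{\rm CO}_{\infty-}[[\hbar]]$ to ${\rm CO}_{\infty-}[[\hbar]]$, given on ${\rm CO}_{\infty-}$ by $\sum_{r\ge0}\frac{\hbar^r}{r!}P^r$ with $\mathbb K$-bilinear maps $P^r:{\rm CO}_{\infty-}\times{\rm CO}_{\infty-}\to{\rm CO}_{\infty-}$, and 1. $P^0(F,G)={:F.G:}$; 2. $P^1(F,G)-P^1(G,F)=2\{F,G\}$; 3. for all $r>0$, $k\in\mathbb N$ and $C>0$ there are $K,k_1,C_1>0$ such that $\|P^r(F,G)\|_{k,C}\le K\|F\|_{k_1,C_1}\|G\|_{k_1,C_1}$ for all $F,G\in{\rm CO}_{\infty-}$; 4. $F_1\star_\hbar(F_2\star_\hbar F_3)=(F_1\star_\hbar F_2)\star_\hbar F_3$ for all $F_1,F_2,F_3\in{\rm CO}_{\infty-}$. -/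

import Mathlib

open scoped ENNReal Topology Nat
open Filter

noncomputable section

namespace Connes

/-! ### Mixed partial derivatives -/

/-- The partial derivative of a function of `n` real variables in its `l`-th variable. -/
def pderiv {E : Type*} [NormedAddCommGroup E] [NormedSpace ℝ E] {n : ℕ} (l : Fin n)
    (f : (Fin n → ℝ) → E) : (Fin n → ℝ) → E :=
  fun s => fderiv ℝ f s (Pi.single l 1)

/-- The mixed derivative `∂^{a_1 + ⋯ + a_n} f / ∂ s_1^{a_1} ⋯ ∂ s_n^{a_n}`. -/
def mixedDeriv {E : Type*} [NormedAddCommGroup E] [NormedSpace ℝ E] {n : ℕ} (a : Fin n → ℕ)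
    (f : (Fin n → ℝ) → E) : (Fin n → ℝ) → E :=
  (List.finRange n).foldr (fun l g => (pderiv l)^[a l] g) f

section Linearity

variable {E : Type*} [NormedAddCommGroup E] [NormedSpace ℝ E] {n : ℕ}

lemma pderiv_contDiff (l : Fin n) {f : (Fin n → ℝ) → E} (hf : ContDiff ℝ (⊤ : ℕ∞) f) :
    ContDiff ℝ (⊤ : ℕ∞) (pderiv l f) :=
  (hf.fderiv_right (m := (⊤ : ℕ∞)) (by simp)).clm_apply contDiff_const

lemma pderiv_add (l : Fin n) {f g : (Fin n → ℝ) → E} (hf : ContDiff ℝ (⊤ : ℕ∞) f)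
    (hg : ContDiff ℝ (⊤ : ℕ∞) g) : pderiv l (f + g) = pderiv l f + pderiv l g := by
  funext s
  simp only [pderiv, Pi.add_apply]
  rw [fderiv_add (hf.differentiable (by simp) s) (hg.differentiable (by simp) s)]
  rfl

lemma pderiv_smul {𝕂 : Type*} [RCLike 𝕂] [NormedSpace 𝕂 E]
    [SMulCommClass ℝ 𝕂 E] (c : 𝕂) (l : Fin n) {f : (Fin n → ℝ) → E} (hf : ContDiff ℝ (⊤ : ℕ∞) f) :
    pderiv l (c • f) = c • pderiv l f := by
  funext s
  simp only [pderiv, Pi.smul_apply]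
  rw [fderiv_const_smul (hf.differentiable (by simp) s)]
  rfl

lemma iter_contDiff (l : Fin n) (m : ℕ) {f : (Fin n → ℝ) → E} (hf : ContDiff ℝ (⊤ : ℕ∞) f) :
    ContDiff ℝ (⊤ : ℕ∞) ((pderiv l)^[m] f) := by
  induction m with
  | zero => simpa using hf
  | succ m ih => rw [Function.iterate_succ_apply']; exact pderiv_contDiff l ih

lemma iter_add (l : Fin n) (m : ℕ) {f g : (Fin n → ℝ) → E} (hf : ContDiff ℝ (⊤ : ℕ∞) f)
    (hg : ContDiff ℝ (⊤ : ℕ∞) g) :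
    (pderiv l)^[m] (f + g) = (pderiv l)^[m] f + (pderiv l)^[m] g := by
  induction m with
  | zero => rfl
  | succ m ih =>
    simp only [Function.iterate_succ_apply', ih]
    exact pderiv_add l (iter_contDiff l m hf) (iter_contDiff l m hg)

lemma iter_smul {𝕂 : Type*} [RCLike 𝕂] [NormedSpace 𝕂 E]
    [SMulCommClass ℝ 𝕂 E] (c : 𝕂) (l : Fin n) (m : ℕ) {f : (Fin n → ℝ) → E}
    (hf : ContDiff ℝ (⊤ : ℕ∞) f) : (pderiv l)^[m] (c • f) = c • (pderiv l)^[m] f := by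
  induction m with
  | zero => rfl
  | succ m ih =>
    simp only [Function.iterate_succ_apply', ih]
    exact pderiv_smul c l (iter_contDiff l m hf)

lemma foldr_contDiff (a : Fin n → ℕ) (L : List (Fin n)) {f : (Fin n → ℝ) → E}
    (hf : ContDiff ℝ (⊤ : ℕ∞) f) :
    ContDiff ℝ (⊤ : ℕ∞) (L.foldr (fun l g => (pderiv l)^[a l] g) f) := by
  induction L with
  | nil => simpa using hf
  | cons l L ih => exact iter_contDiff l _ ih

lemma mixedDeriv_add (a : Fin n → ℕ) {f g : (Fin n → ℝ) → E} (hf : ContDiff ℝ (⊤ : ℕ∞) f)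
    (hg : ContDiff ℝ (⊤ : ℕ∞) g) : mixedDeriv a (f + g) = mixedDeriv a f + mixedDeriv a g := by
  unfold mixedDeriv
  induction List.finRange n with
  | nil => rfl
  | cons l L ih =>
    simp only [List.foldr_cons, ih]
    exact iter_add l _ (foldr_contDiff a L hf) (foldr_contDiff a L hg)

lemma mixedDeriv_smul {𝕂 : Type*} [RCLike 𝕂] [NormedSpace 𝕂 E]
    [SMulCommClass ℝ 𝕂 E] (c : 𝕂) (a : Fin n → ℕ) {f : (Fin n → ℝ) → E}
    (hf : ContDiff ℝ (⊤ : ℕ∞) f) : mixedDeriv a (c • f) = c • mixedDeriv a f := by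
  unfold mixedDeriv
  induction List.finRange n with
  | nil => rfl
  | cons l L ih =>
    simp only [List.foldr_cons, ih]
    exact iter_smul c l _ (foldr_contDiff a L hf)

end Linearity

/-! ### The Connes space -/

/-- Sequences `F = ∑ F^n` of functions `F^n` of `n` real variables with values in the `n`-th
tensor power of `𝕂^d`. The coordinate of `F n s` on `e_{I 1} ⊗ ⋯ ⊗ e_{I n}` is `F n s I`, and the
tensor power carries its Euclidean norm. -/
abbrev Chaos (𝕂 : Type*) [RCLike 𝕂] (d : ℕ) : Type _ :=
  (n : ℕ) → (Fin n → ℝ) → EuclideanSpace 𝕂 (Fin n → Fin d)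

variable {𝕂 : Type*} [RCLike 𝕂] {d : ℕ}

/-- `‖f‖_k`: the sum of the supremum norms of all the mixed derivatives of order at most `k` in
each variable. -/
def supNorm (k : ℕ) {n : ℕ} (f : (Fin n → ℝ) → EuclideanSpace 𝕂 (Fin n → Fin d)) : ℝ≥0∞ :=
  ∑ a : Fin n → Fin (k + 1), ⨆ s, ‖mixedDeriv (fun l => (a l : ℕ)) f s‖ₑ

/-- `‖F‖_{k,C} = ∑ C^n ‖F^n‖_k`. -/
def coNorm (k : ℕ) (C : ℝ) (F : Chaos 𝕂 d) : ℝ≥0∞ :=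
  ∑' n, ENNReal.ofReal (C ^ n) * supNorm k (F n)

lemma coNorm_add_le (k : ℕ) (C : ℝ) {F G : Chaos 𝕂 d} (hF : ∀ n, ContDiff ℝ (⊤ : ℕ∞) (F n))
    (hG : ∀ n, ContDiff ℝ (⊤ : ℕ∞) (G n)) : coNorm k C (F + G) ≤ coNorm k C F + coNorm k C G := by
  unfold coNorm
  rw [← ENNReal.tsum_add]
  refine ENNReal.tsum_le_tsum fun n => ?_
  rw [← mul_add]
  refine mul_le_mul_right ?_ _
  unfold supNorm
  rw [← Finset.sum_add_distrib]
  refine Finset.sum_le_sum fun a _ => iSup_le fun s => ?_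
  rw [Pi.add_apply, mixedDeriv_add _ (hF n) (hG n), Pi.add_apply]
  exact (enorm_add_le _ _).trans (add_le_add
    (le_iSup (fun s => ‖mixedDeriv (fun l => (a l : ℕ)) (F n) s‖ₑ) s)
    (le_iSup (fun s => ‖mixedDeriv (fun l => (a l : ℕ)) (G n) s‖ₑ) s))

lemma coNorm_smul_le (k : ℕ) (C : ℝ) (c : 𝕂) {F : Chaos 𝕂 d} (hF : ∀ n, ContDiff ℝ (⊤ : ℕ∞) (F n)) :
    coNorm k C (c • F) ≤ ‖c‖ₑ * coNorm k C F := by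
  unfold coNorm
  rw [← ENNReal.tsum_mul_left]
  refine ENNReal.tsum_le_tsum fun n => ?_
  rw [mul_left_comm]
  refine mul_le_mul_right ?_ _
  unfold supNorm
  rw [Finset.mul_sum]
  refine Finset.sum_le_sum fun a _ => iSup_le fun s => ?_
  rw [Pi.smul_apply, mixedDeriv_smul c _ (hF n), Pi.smul_apply, enorm_smul]
  exact mul_le_mul_right
    (le_iSup (fun s => ‖mixedDeriv (fun l => (a l : ℕ)) (F n) s‖ₑ) s) _

variable (𝕂 d) in
/-- The Connes space `CO_{∞-}`: the `F = ∑ F^n` where each `F^n` is a smooth function on the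
`n`-th power of the circle `ℝ / ℤ`, symmetric (under simultaneous permutation of the variables
and of the tensor factors), and where `‖F‖_{k,C} < ∞` for all `k` and all `C > 0`. -/
def CO : Submodule 𝕂 (Chaos 𝕂 d) where
  carrier := {F | (∀ n, ContDiff ℝ (⊤ : ℕ∞) (F n)) ∧
    (∀ (n : ℕ) (l : Fin n), Function.Periodic (F n) (Pi.single l 1)) ∧
    (∀ (n : ℕ) (σ : Equiv.Perm (Fin n)) (s : Fin n → ℝ) (I : Fin n → Fin d),
      F n (s ∘ σ) (I ∘ σ) = F n s I) ∧
    ∀ (k : ℕ) (C : ℝ), 0 < C → coNorm k C F < ∞}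
  zero_mem' := by
    have h0 : ∀ n, ContDiff ℝ (⊤ : ℕ∞) ((0 : Chaos 𝕂 d) n) := fun n => contDiff_const
    refine ⟨h0, fun n l s => rfl, fun n σ s I => rfl, fun k C _ => ?_⟩
    have h := coNorm_smul_le k C (0 : 𝕂) h0
    rw [zero_smul, enorm_zero, zero_mul] at h
    exact h.trans_lt ENNReal.zero_lt_top
  add_mem' := by
    rintro F G ⟨hF1, hF2, hF3, hF4⟩ ⟨hG1, hG2, hG3, hG4⟩
    refine ⟨fun n => (hF1 n).add (hG1 n), fun n l s => ?_, fun n σ s I => ?_, fun k C hC => ?_⟩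
    · simp only [Pi.add_apply, hF2 n l s, hG2 n l s]
    · simp only [Pi.add_apply, PiLp.add_apply, hF3, hG3]
    · exact (coNorm_add_le k C hF1 hG1).trans_lt (ENNReal.add_lt_top.2 ⟨hF4 k C hC, hG4 k C hC⟩)
  smul_mem' := by
    rintro c F ⟨hF1, hF2, hF3, hF4⟩
    refine ⟨fun n => (hF1 n).const_smul c, fun n l s => ?_, fun n σ s I => ?_, fun k C hC => ?_⟩
    · simp only [Pi.smul_apply, hF2 n l s]
    · simp only [Pi.smul_apply, PiLp.smul_apply, hF3]
    · exact (coNorm_smul_le k C c hF1).trans_lt (ENNReal.mul_lt_top enorm_lt_top (hF4 k C hC))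

/-- The family `f` of elements of `CO_{∞-}` is (unconditionally) summable in `CO_{∞-}`, with sum
`F ∈ CO_{∞-}`: the finite partial sums converge to `F` for every norm `‖·‖_{k,C}`. -/
def HasSumCO {ι : Type*} (f : ι → Chaos 𝕂 d) (F : Chaos 𝕂 d) : Prop :=
  (∀ x, f x ∈ CO 𝕂 d) ∧ F ∈ CO 𝕂 d ∧
    ∀ (k : ℕ) (C : ℝ), 0 < C →
      Tendsto (fun S : Finset ι => coNorm k C (F - ∑ x ∈ S, f x)) atTop (𝓝 0)

/-! ### Wick product and annihilation operators -/

/-- The symmetric tensor product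
`(1 / N!) ∑_σ f (s_{σ 1}, …, s_{σ p}) ⊗ g (s_{σ (p + 1)}, …, s_{σ N})`, `N = p + q`,
the tensor factors being permuted with the variables. -/
def symTensor {p q N : ℕ} (h : p + q = N)
    (f : (Fin p → ℝ) → EuclideanSpace 𝕂 (Fin p → Fin d))
    (g : (Fin q → ℝ) → EuclideanSpace 𝕂 (Fin q → Fin d)) :
    (Fin N → ℝ) → EuclideanSpace 𝕂 (Fin N → Fin d) :=
  fun s => WithLp.toLp 2 fun I => (N ! : 𝕂)⁻¹ * ∑ σ : Equiv.Perm (Fin N),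
    f (fun l => s (σ (Fin.cast h (Fin.castAdd q l))))
        (fun l => I (σ (Fin.cast h (Fin.castAdd q l)))) *
      g (fun l => s (σ (Fin.cast h (Fin.natAdd p l))))
        (fun l => I (σ (Fin.cast h (Fin.natAdd p l))))

/-- The Wick product `:F.G:`. -/
def wick (F G : Chaos 𝕂 d) : Chaos 𝕂 d := fun N =>
  ∑ pq : Finset.HasAntidiagonal.antidiagonal N,
    symTensor (Finset.HasAntidiagonal.mem_antidiagonal.1 pq.2) (F pq.1.1) (G pq.1.2)

/-- The annihilation operator `a_h`: the sum over all the slots `i` of the pairing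
`∫ ⟨F^{n+1}(…, t, …), h t⟩ + ⟨∂_t F^{n+1}(…, t, …), h' t⟩ dt` over the circle, where `t` is
inserted in slot `i`. -/
def annih (h : ℝ → EuclideanSpace ℝ (Fin d)) (F : Chaos 𝕂 d) : Chaos 𝕂 d := fun n s =>
  WithLp.toLp 2 fun I => ∑ i : Fin (n + 1), ∫ t in (0 : ℝ)..1, ∑ j : Fin d,
    (F (n + 1) (i.insertNth t s) (i.insertNth j I) * ((h t j : ℝ) : 𝕂) +
      deriv (fun u : ℝ => F (n + 1) (i.insertNth u s) (i.insertNth j I)) t *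
        ((deriv h t j : ℝ) : 𝕂))

/-- The trigonometric functions, normalized for `∫ |γ|² + ∫ |γ'|²` on the circle. -/
def trig (k : ℤ) (t : ℝ) : ℝ :=
  (if k = 0 then 1
    else if 0 < k then √2 * Real.cos (2 * k * Real.pi * t)
    else √2 * Real.sin (2 * k * Real.pi * t)) / √(4 * Real.pi ^ 2 * (k : ℝ) ^ 2 + 1)

/-- The orthonormal basis `γ_{i,k}` of the Hilbert space of loops in `ℝ^d` with
`‖γ‖² = ∫ |γ|² + ∫ |γ'|²`. -/
def basisLoop (i : Fin d) (k : ℤ) (t : ℝ) : EuclideanSpace ℝ (Fin d) :=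
  EuclideanSpace.single i (trig k t)

/-- `a_{γ_{i_1,k_1}} ⋯ a_{γ_{i_r,k_r}} F`. -/
def iterAnnih {r : ℕ} (i : Fin r → Fin d) (k : Fin r → ℤ) (F : Chaos 𝕂 d) : Chaos 𝕂 d :=
  (List.finRange r).foldr (fun l G => annih (basisLoop (i l) (k l)) G) F

/-! ### The Poisson bracket and the Moyal product -/

/-- The contribution of the frequency `k` to the Poisson bracket. -/
def poissonTerm (ω : Matrix (Fin d) (Fin d) ℝ) (k : ℤ) (F G : Chaos 𝕂 d) : Chaos 𝕂 d :=
  ∑ i : Fin d, ∑ j : Fin d, (((4 * Real.pi ^ 2 * (k : ℝ) ^ 2 + 1) * ω⁻¹ i j : ℝ) : 𝕂) •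
    wick (annih (basisLoop i k) F) (annih (basisLoop j k) G)

/-- The Poisson bracket `{F, G}`, as a pointwise sum over the frequencies. -/
def poisson (ω : Matrix (Fin d) (Fin d) ℝ) (F G : Chaos 𝕂 d) : Chaos 𝕂 d :=
  fun n s => ∑' k : ℤ, poissonTerm ω k F G n s

/-- The contribution of the frequencies `k_1, …, k_r` to the `r`-th power of the bracket. -/
def moyalTerm (ω : Matrix (Fin d) (Fin d) ℝ) (r : ℕ) (k : Fin r → ℤ) (F G : Chaos 𝕂 d) :
    Chaos 𝕂 d :=
  ∑ i : Fin r → Fin d, ∑ j : Fin r → Fin d,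
    (((∏ l, (4 * Real.pi ^ 2 * (k l : ℝ) ^ 2 + 1)) * ∏ l, ω⁻¹ (i l) (j l) : ℝ) : 𝕂) •
      wick (iterAnnih i k F) (iterAnnih j k G)

/-- The `r`-th power `P^r(F, G)` of the Poisson bracket, as a pointwise sum over the
frequencies. -/
def moyalPow (ω : Matrix (Fin d) (Fin d) ℝ) (r : ℕ) (F G : Chaos 𝕂 d) : Chaos 𝕂 d :=
  fun n s => ∑' k : Fin r → ℤ, moyalTerm ω r k F G n s

/-! ### Formal series in `ħ`

A formal series `∑ ħ^m f_m` is the sequence of its coefficients. -/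

/-- The formal series with constant term `F` and no other term. -/
def const (F : Chaos 𝕂 d) : ℕ → Chaos 𝕂 d := Pi.single 0 F

/-- The action of `𝕂[[ħ]]` on formal series. -/
def hsmul (c : PowerSeries 𝕂) (f : ℕ → Chaos 𝕂 d) : ℕ → Chaos 𝕂 d := fun m =>
  ∑ ab ∈ Finset.HasAntidiagonal.antidiagonal m, PowerSeries.coeff ab.1 c • f ab.2

/-- The Moyal star-product
`(∑ ħ^a f_a) ⋆ (∑ ħ^b g_b) = ∑ ħ^{r+a+b} (1 / r!) P^r(f_a, g_b)`. -/
def moyalStar (ω : Matrix (Fin d) (Fin d) ℝ) (f g : ℕ → Chaos 𝕂 d) : ℕ → Chaos 𝕂 d := fun m =>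
  ∑ rq ∈ Finset.HasAntidiagonal.antidiagonal m, ∑ ab ∈ Finset.HasAntidiagonal.antidiagonal rq.2,
    (rq.1 ! : 𝕂)⁻¹ • moyalPow ω rq.1 (f ab.1) (g ab.2)

/-- `star` is a star-product on the formal series with coefficients in `CO_{∞-}`, with
`F ⋆ G = ∑ (ħ^r / r!) P^r(F, G)` on `CO_{∞-}`, which quantizes the bracket `br`. -/
structure IsDeformationQuantization (br : Chaos 𝕂 d → Chaos 𝕂 d → Chaos 𝕂 d)
    (P : ℕ → Chaos 𝕂 d → Chaos 𝕂 d → Chaos 𝕂 d)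
    (star : (ℕ → Chaos 𝕂 d) → (ℕ → Chaos 𝕂 d) → (ℕ → Chaos 𝕂 d)) : Prop where
  star_mem : ∀ f g, (∀ m, f m ∈ CO 𝕂 d) → (∀ m, g m ∈ CO 𝕂 d) → ∀ m, star f g m ∈ CO 𝕂 d
  star_add_left : ∀ f f' g, (∀ m, f m ∈ CO 𝕂 d) → (∀ m, f' m ∈ CO 𝕂 d) →
    (∀ m, g m ∈ CO 𝕂 d) → star (f + f') g = star f g + star f' g
  star_add_right : ∀ f g g', (∀ m, f m ∈ CO 𝕂 d) → (∀ m, g m ∈ CO 𝕂 d) →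
    (∀ m, g' m ∈ CO 𝕂 d) → star f (g + g') = star f g + star f g'
  star_hsmul_left : ∀ (c : PowerSeries 𝕂) f g, (∀ m, f m ∈ CO 𝕂 d) → (∀ m, g m ∈ CO 𝕂 d) →
    star (hsmul c f) g = hsmul c (star f g)
  star_hsmul_right : ∀ (c : PowerSeries 𝕂) f g, (∀ m, f m ∈ CO 𝕂 d) → (∀ m, g m ∈ CO 𝕂 d) →
    star f (hsmul c g) = hsmul c (star f g)
  star_const : ∀ F ∈ CO 𝕂 d, ∀ G ∈ CO 𝕂 d,
    star (const F) (const G) = fun r => (r ! : 𝕂)⁻¹ • P r F G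
  P_mem : ∀ r, ∀ F ∈ CO 𝕂 d, ∀ G ∈ CO 𝕂 d, P r F G ∈ CO 𝕂 d
  P_add_left : ∀ r, ∀ F ∈ CO 𝕂 d, ∀ F' ∈ CO 𝕂 d, ∀ G ∈ CO 𝕂 d,
    P r (F + F') G = P r F G + P r F' G
  P_add_right : ∀ r, ∀ F ∈ CO 𝕂 d, ∀ G ∈ CO 𝕂 d, ∀ G' ∈ CO 𝕂 d,
    P r F (G + G') = P r F G + P r F G'
  P_smul_left : ∀ r (c : 𝕂), ∀ F ∈ CO 𝕂 d, ∀ G ∈ CO 𝕂 d, P r (c • F) G = c • P r F G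
  P_smul_right : ∀ r (c : 𝕂), ∀ F ∈ CO 𝕂 d, ∀ G ∈ CO 𝕂 d, P r F (c • G) = c • P r F G
  P_zero : ∀ F ∈ CO 𝕂 d, ∀ G ∈ CO 𝕂 d, P 0 F G = wick F G
  P_one : ∀ F ∈ CO 𝕂 d, ∀ G ∈ CO 𝕂 d, P 1 F G - P 1 G F = (2 : 𝕂) • br F G
  P_bound : ∀ r, 0 < r → ∀ (k : ℕ) (C : ℝ), 0 < C →
    ∃ (K : ℝ) (k₁ : ℕ) (C₁ : ℝ), 0 < K ∧ 0 < k₁ ∧ 0 < C₁ ∧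
      ∀ F ∈ CO 𝕂 d, ∀ G ∈ CO 𝕂 d,
        coNorm k C (P r F G) ≤ ENNReal.ofReal K * coNorm k₁ C₁ F * coNorm k₁ C₁ G
  star_assoc : ∀ F₁ ∈ CO 𝕂 d, ∀ F₂ ∈ CO 𝕂 d, ∀ F₃ ∈ CO 𝕂 d,
    star (const F₁) (star (const F₂) (const F₃)) = star (star (const F₁) (const F₂)) (const F₃)

end Connes

end

noncomputable section

namespace Connes

/-! ### Commuting mixed partial derivatives and their supremum norms -/

section Calculus

variable {E : Type*} [NormedAddCommGroup E] [NormedSpace ℝ E] {n : ℕ}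

/-! Write `γ_κ` for `trig κ` and `w_κ = 4π²κ² + 1` for `weight κ`. Since `γ_κ - γ_κ'' = w_κ γ_κ`,
integrating by parts on the circle turns the H¹ pairing in the annihilation operator into `w_κ`
times the L² pairing, and symmetry makes all slots contribute equally. So annihilation by `γ_{j,κ}`
amounts to `(n + 1) w_κ` times a Fourier coefficient of `F^{n+1}` in its first variable
(`ann_apply`).

Convergence. Moving `1 - ∂²` onto `F` twice shows that this coefficient is `O(w_κ⁻²)`, at the price
of four derivatives; the factor `n + 1` is absorbed by doubling `C`. Hence annihilation costs
`w_κ⁻¹` in norm (`coNorm_ann_le`). The Wick product is submultiplicative for every norm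
(`coNorm_wick_le`), so each frequency of `P^r` contributes `w · w⁻¹ · w⁻¹ = w⁻¹`, which is summable
over ℤ. Peeling off the frequencies one at a time gives absolute convergence and continuity of `P^r`
(`tsum_coNorm_moyalTerm_le`). The norms control pointwise values, so sums are unique and identities
between the `P^r` can be checked termwise (`HasSumCO.unique`).

Algebra. Encode `F` by the function `n! F^n` on finite multisets of letters `(s, i)`. The Wick
product becomes the sum over all splittings of the multiset (`genFn_wick`), a commutative and
associative convolution. Annihilation becomes the insertion of one letter integrated against `γ_κ`.
So the annihilation operators commute by Fubini (`ann_comm`), are derivations of the Wick product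
(`ann_wick`), and by induction are derivations of every `P^r` (`ann_moyalPow`).

Associativity. Let `A_m` be the coefficient of `ħ^m` in either bracketing of three factors.
Multiplying `A_{m+1}` by `m + 1` differentiates the exponential series. By the recursion for `P^r`
and the derivation property, the result is the sum over frequencies of `A_m` with the two
annihilation operators of the bracket placed on the pairs of factors (1,2), (1,3) and (2,3). The
recursion is the same for both bracketings, and `A_0` agrees by associativity of the Wick product
(`assocRight_eq_assocLeft`); formally both sides are `exp ħ(D₁₂ + D₁₃ + D₂₃)`. Finally `P^1` is the
bracket itself, antisymmetric because `ω⁻¹` is antisymmetric and the Wick product commutative. -/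

lemma pderiv_comm (l l' : Fin n) {f : (Fin n → ℝ) → E} (hf : ContDiff ℝ (⊤ : ℕ∞) f) :
    pderiv l (pderiv l' f) = pderiv l' (pderiv l f) := by
  have key : ∀ (l l' : Fin n) (s : Fin n → ℝ), pderiv l (pderiv l' f) s =
      fderiv ℝ (fderiv ℝ f) s (Pi.single l 1) (Pi.single l' 1) := by
    intro l l' s
    have hd : DifferentiableAt ℝ (fderiv ℝ f) s :=
      ((hf.fderiv_right (m := (⊤ : ℕ∞)) (by simp)).differentiable (by simp)) s
    unfold pderiv
    rw [fderiv_clm_apply hd (differentiableAt_const _)]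
    simp
  funext s
  rw [key, key]
  have : IsSymmSndFDerivAt ℝ f s :=
    ContDiffAt.isSymmSndFDerivAt (n := (⊤ : ℕ∞)) hf.contDiffAt (by
      simp only [minSmoothness_of_isRCLikeNormedField]; exact WithTop.coe_le_coe.2 le_top)
  exact this _ _

lemma pderiv_iter_comm (l l' : Fin n) (m : ℕ) {f : (Fin n → ℝ) → E}
    (hf : ContDiff ℝ (⊤ : ℕ∞) f) :
    pderiv l ((pderiv l')^[m] f) = (pderiv l')^[m] (pderiv l f) := by
  induction m with
  | zero => rfl
  | succ m ih =>
    rw [Function.iterate_succ_apply', Function.iterate_succ_apply',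
      pderiv_comm _ _ (iter_contDiff l' m hf), ih]

lemma mixedDeriv_contDiff (a : Fin n → ℕ) {f : (Fin n → ℝ) → E}
    (hf : ContDiff ℝ (⊤ : ℕ∞) f) : ContDiff ℝ (⊤ : ℕ∞) (mixedDeriv a f) :=
  foldr_contDiff a _ hf

lemma mixedDeriv_zero (f : (Fin n → ℝ) → E) : mixedDeriv 0 f = f := by
  unfold mixedDeriv
  induction List.finRange n with
  | nil => rfl
  | cons l L ih => simp

lemma mixedDeriv_pderiv (a : Fin n → ℕ) (l : Fin n) {f : (Fin n → ℝ) → E}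
    (hf : ContDiff ℝ (⊤ : ℕ∞) f) : mixedDeriv a (pderiv l f) = pderiv l (mixedDeriv a f) := by
  unfold mixedDeriv
  induction List.finRange n with
  | nil => rfl
  | cons x L ih =>
    simp only [List.foldr_cons, ih]
    rw [pderiv_iter_comm _ _ _ (foldr_contDiff a L hf)]

/-- The extra derivative enters at the place of `l` in the composition and commutes past the
operators outside it. The index `l` occurs exactly once in `List.finRange n`, hence the auxiliary
statement on lists without duplicates, with one case for each side of `l ∈ L`. -/
lemma mixedDeriv_add_single (a : Fin n → ℕ) (l : Fin n) {f : (Fin n → ℝ) → E}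
    (hf : ContDiff ℝ (⊤ : ℕ∞) f) :
    mixedDeriv (a + Pi.single l 1) f = pderiv l (mixedDeriv a f) := by
  have key : ∀ L : List (Fin n), L.Nodup →
      (l ∉ L → L.foldr (fun x g => (pderiv x)^[(a + Pi.single l 1 : Fin n → ℕ) x] g) f =
        L.foldr (fun x g => (pderiv x)^[a x] g) f) ∧
      (l ∈ L → L.foldr (fun x g => (pderiv x)^[(a + Pi.single l 1 : Fin n → ℕ) x] g) f =
        pderiv l (L.foldr (fun x g => (pderiv x)^[a x] g) f)) := by
    intro L hL
    induction L with
    | nil => simp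
    | cons x L ih =>
      obtain ⟨hx, hL⟩ := List.nodup_cons.1 hL
      obtain ⟨ih1, ih2⟩ := ih hL
      constructor
      · intro h
        rw [List.mem_cons, not_or] at h
        simp only [List.foldr_cons]
        rw [ih1 h.2, Pi.add_apply, Pi.single_eq_of_ne (Ne.symm h.1), add_zero]
      · intro h
        simp only [List.foldr_cons]
        by_cases hxl : x = l
        · subst hxl
          rw [ih1 hx, Pi.add_apply, Pi.single_eq_same, Function.iterate_succ_apply']
        · have hl : l ∈ L := by
            rcases List.mem_cons.1 h with h | h
            · exact absurd h.symm hxl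
            · exact h
          rw [ih2 hl, Pi.add_apply, Pi.single_eq_of_ne hxl, add_zero,
            pderiv_iter_comm _ _ _ (foldr_contDiff a L hf)]
  exact (key _ (List.nodup_finRange n)).2 (List.mem_finRange l)

lemma multiIndex_induction {p : (Fin n → ℕ) → Prop} (h0 : p 0)
    (h1 : ∀ a l, p a → p (a + Pi.single l 1)) (a : Fin n → ℕ) : p a := by
  induction hN : ∑ l, a l generalizing a with
  | zero =>
    have : a = 0 := by
      funext l
      exact (Finset.sum_eq_zero_iff.1 hN) l (Finset.mem_univ _)
    rwa [this]
  | succ N ih =>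
    obtain ⟨l, -, hl⟩ : ∃ l ∈ Finset.univ, a l ≠ 0 := by
      by_contra! h
      rw [Finset.sum_eq_zero h] at hN
      omega
    have hle : Pi.single l 1 ≤ a := by
      intro l'
      by_cases h : l' = l
      · rw [h, Pi.single_eq_same]; exact Nat.one_le_iff_ne_zero.2 hl
      · rw [Pi.single_eq_of_ne h]; exact Nat.zero_le _
    have ha : a - Pi.single l 1 + Pi.single l 1 = a := tsub_add_cancel_of_le hle
    rw [← ha]
    refine h1 _ _ (ih _ ?_)
    have h2 : ∑ l', (a - Pi.single l 1 + Pi.single l 1 : Fin n → ℕ) l' = N + 1 := by rw [ha, hN]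
    simp only [Pi.add_apply, Finset.sum_add_distrib, Finset.sum_pi_single',
      Finset.mem_univ, if_true] at h2
    omega

/-- The supremum norm of the mixed derivative of order `a`. -/
def derivSup (a : Fin n → ℕ) (f : (Fin n → ℝ) → E) : ℝ≥0∞ := ⨆ s, ‖mixedDeriv a f s‖ₑ

lemma enorm_mixedDeriv_le (a : Fin n → ℕ) (f : (Fin n → ℝ) → E) (s : Fin n → ℝ) :
    ‖mixedDeriv a f s‖ₑ ≤ derivSup a f :=
  le_iSup (fun s => ‖mixedDeriv a f s‖ₑ) s

lemma enorm_le_derivSup (f : (Fin n → ℝ) → E) (s : Fin n → ℝ) : ‖f s‖ₑ ≤ derivSup 0 f := by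
  have := enorm_mixedDeriv_le 0 f s
  rwa [mixedDeriv_zero] at this

lemma derivSup_pderiv (a : Fin n → ℕ) (l : Fin n) {f : (Fin n → ℝ) → E}
    (hf : ContDiff ℝ (⊤ : ℕ∞) f) : derivSup a (pderiv l f) = derivSup (a + Pi.single l 1) f := by
  unfold derivSup
  rw [mixedDeriv_pderiv a l hf, mixedDeriv_add_single a l hf]

lemma enorm_pderiv_le (l : Fin n) {f : (Fin n → ℝ) → E} (hf : ContDiff ℝ (⊤ : ℕ∞) f)
    (s : Fin n → ℝ) : ‖pderiv l f s‖ₑ ≤ derivSup (Pi.single l 1) f := by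
  have := enorm_le_derivSup (pderiv l f) s
  rwa [derivSup_pderiv 0 l hf, zero_add] at this

/-- The `l`-th coordinate. -/
def coordCLM (l : Fin n) : (Fin n → ℝ) →L[ℝ] ℝ := ContinuousLinearMap.proj l

@[simp] lemma coordCLM_apply (l : Fin n) (v : Fin n → ℝ) : coordCLM l v = v l := rfl

lemma fderiv_eq_sum_pderiv (f : (Fin n → ℝ) → E) (s : Fin n → ℝ) :
    fderiv ℝ f s = ∑ l, (coordCLM l).smulRight
      (pderiv l f s) := by
  ext v
  have hv : v = ∑ l, v l • (Pi.single l (1 : ℝ) : Fin n → ℝ) := by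
    funext l
    simp [Finset.sum_apply, Pi.single_apply]
  conv_lhs => rw [hv, map_sum]
  simp [pderiv]

lemma norm_fderiv_le_sum_pderiv (f : (Fin n → ℝ) → E) (s : Fin n → ℝ) :
    ‖fderiv ℝ f s‖ ≤ ∑ l, ‖pderiv l f s‖ := by
  rw [fderiv_eq_sum_pderiv]
  refine (norm_sum_le _ _).trans (Finset.sum_le_sum fun l _ => ?_)
  rw [ContinuousLinearMap.norm_smulRight_apply]
  refine mul_le_of_le_one_left (norm_nonneg _) ?_
  refine ContinuousLinearMap.opNorm_le_bound _ zero_le_one fun v => ?_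
  rw [one_mul]
  exact norm_le_pi_norm v l

lemma hasFDerivAt_sum_pderiv {f : (Fin n → ℝ) → E} (hf : ContDiff ℝ (⊤ : ℕ∞) f)
    (s : Fin n → ℝ) : HasFDerivAt f (∑ l, (coordCLM l).smulRight (pderiv l f s)) s := by
  rw [← fderiv_eq_sum_pderiv]
  exact (hf.differentiable (by simp) s).hasFDerivAt

/-- A function with the partial derivatives `g l` which are again in the class `p` is smooth. -/
lemma contDiff_of_pderiv_class {p : ((Fin n → ℝ) → E) → Prop} (h0 : ∀ f, p f → Continuous f)
    (h1 : ∀ f, p f → ∃ g : Fin n → (Fin n → ℝ) → E, (∀ l, p (g l)) ∧ ∀ s, HasFDerivAt f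
      (∑ l, (coordCLM l).smulRight (g l s)) s)
    {f : (Fin n → ℝ) → E} (hf : p f) : ContDiff ℝ (⊤ : ℕ∞) f := by
  rw [contDiff_infty]
  intro m
  -- The induction passes from `f` to its partial derivatives, which is why the hypotheses concern a
  -- class of functions rather than `f` alone.
  induction m generalizing f with
  | zero => exact contDiff_zero.2 (h0 f hf)
  | succ m ih =>
    obtain ⟨g, hg, hd⟩ := h1 f hf
    push_cast
    rw [contDiff_succ_iff_fderiv]
    refine ⟨fun s => (hd s).differentiableAt, by simp, ?_⟩
    have : fderiv ℝ f = fun s => ∑ l, (coordCLM l).smulRight (g l s) :=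
      funext fun s => (hd s).fderiv
    rw [this]
    exact ContDiff.sum fun l _ => contDiff_const.smulRight (ih (hg l))

lemma pderiv_eq_of_hasFDerivAt {f : (Fin n → ℝ) → E} {g : Fin n → (Fin n → ℝ) → E}
    (h : ∀ s, HasFDerivAt f (∑ l, (coordCLM l).smulRight (g l s)) s) (l : Fin n) :
    pderiv l f = g l := by
  funext s
  unfold pderiv
  rw [(h s).fderiv]
  simp [Pi.single_apply]

end Calculus

/-! ### Termwise differentiation of series -/

lemma summable_of_enorm_le {ι E : Type*} [NormedAddCommGroup E] [CompleteSpace E]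
    {f : ι → E} {u : ι → ℝ≥0∞} (hu : ∑' x, u x ≠ ∞)
    (h : ∀ x, ‖f x‖ₑ ≤ u x) : Summable f := by
  refine Summable.of_norm_bounded (ENNReal.summable_toReal hu) fun x => ?_
  have := ENNReal.toReal_mono (ENNReal.ne_top_of_tsum_ne_top hu x) (h x)
  simpa using this

section Series

variable {E : Type*} [NormedAddCommGroup E] [NormedSpace ℝ E] {n : ℕ} {ι : Type*}

/-- A family of smooth functions all of whose derivatives are uniformly summable. -/
structure SmoothSummable (f : ι → (Fin n → ℝ) → E) : Prop where
  contDiff : ∀ x, ContDiff ℝ (⊤ : ℕ∞) (f x)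
  summable : ∀ a, ∑' x, derivSup a (f x) ≠ ∞

lemma SmoothSummable.pderiv {f : ι → (Fin n → ℝ) → E} (hf : SmoothSummable f) (l : Fin n) :
    SmoothSummable fun x => pderiv l (f x) where
  contDiff x := pderiv_contDiff l (hf.contDiff x)
  summable a := by
    simp only [derivSup_pderiv a l (hf.contDiff _)]
    exact hf.summable _

variable [CompleteSpace E]

lemma SmoothSummable.summable_apply {f : ι → (Fin n → ℝ) → E} (hf : SmoothSummable f)
    (s : Fin n → ℝ) : Summable fun x => f x s :=
  summable_of_enorm_le (hf.summable 0) fun x => enorm_le_derivSup (f x) s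

/-- The norm of the total derivative is at most the sum of the norms of the partial ones, so the
summable bounds on first partials dominate the series of derivatives uniformly in `s`. -/
lemma SmoothSummable.hasFDerivAt {f : ι → (Fin n → ℝ) → E} (hf : SmoothSummable f)
    (s : Fin n → ℝ) : HasFDerivAt (fun s => ∑' x, f x s)
      (∑ l, (coordCLM l).smulRight (∑' x, Connes.pderiv l (f x) s)) s := by
  have hu : Summable fun x => ∑ l, (derivSup (Pi.single l 1) (f x)).toReal :=
    summable_sum fun l _ => ENNReal.summable_toReal (hf.summable _)
  have h1 := hasFDerivAt_tsum (𝕜 := ℝ) (f := f) (f' := fun x s => fderiv ℝ (f x) s) hu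
    (fun x s => ((hf.contDiff x).differentiable (by simp) s).hasFDerivAt)
    (fun x s => (norm_fderiv_le_sum_pderiv _ _).trans (Finset.sum_le_sum fun l _ => by
      have := ENNReal.toReal_mono (ENNReal.ne_top_of_tsum_ne_top (hf.summable _) x)
        (enorm_pderiv_le l (hf.contDiff x) s)
      simpa using this)) (hf.summable_apply 0) s
  suffices heq : ∑ l, (coordCLM l).smulRight (∑' x, Connes.pderiv l (f x) s) =
      ∑' x, fderiv ℝ (f x) s by
    rw [heq]
    exact h1
  simp only [fderiv_eq_sum_pderiv]
  rw [Summable.tsum_finsetSum]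
  · refine Finset.sum_congr rfl fun l _ => ?_
    ext v
    have hs := (hf.pderiv l).summable_apply s
    rw [ContinuousLinearMap.smulRight_apply]
    have := (ContinuousLinearMap.smulRightL ℝ (Fin n → ℝ) E
      (coordCLM l)).map_tsum hs
    have h2 := congrArg (fun T => T v) this
    simpa using h2
  · intro l _
    exact (ContinuousLinearMap.smulRightL ℝ (Fin n → ℝ) E
      (coordCLM l)).summable
        ((hf.pderiv l).summable_apply s)

lemma SmoothSummable.contDiff_tsum {f : ι → (Fin n → ℝ) → E} (hf : SmoothSummable f) :
    ContDiff ℝ (⊤ : ℕ∞) fun s => ∑' x, f x s := by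
  refine contDiff_of_pderiv_class
    (p := fun F => ∃ f : ι → (Fin n → ℝ) → E, SmoothSummable f ∧ F = fun s => ∑' x, f x s)
    ?_ ?_ ⟨f, hf, rfl⟩
  · rintro F ⟨f, hf, rfl⟩
    exact continuous_iff_continuousAt.2 fun s => (hf.hasFDerivAt s).continuousAt
  · rintro F ⟨f, hf, rfl⟩
    exact ⟨fun l s => ∑' x, Connes.pderiv l (f x) s, fun l => ⟨_, hf.pderiv l, rfl⟩,
      hf.hasFDerivAt⟩

/-- Summability of the differentiated family is carried along with the formula, because the next
termwise differentiation needs it. -/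
lemma SmoothSummable.mixedDeriv {f : ι → (Fin n → ℝ) → E} (hf : SmoothSummable f)
    (a : Fin n → ℕ) : SmoothSummable (fun x => mixedDeriv a (f x)) ∧
      mixedDeriv a (fun s => ∑' x, f x s) = fun s => ∑' x, mixedDeriv a (f x) s := by
  induction a using multiIndex_induction with
  | h0 => simpa only [mixedDeriv_zero, and_true] using hf
  | h1 a l ih =>
    simp only [mixedDeriv_add_single a l hf.contDiff_tsum,
      mixedDeriv_add_single a l (hf.contDiff _)]
    refine ⟨ih.1.pderiv l, ?_⟩
    rw [ih.2]
    exact pderiv_eq_of_hasFDerivAt ih.1.hasFDerivAt l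

lemma SmoothSummable.derivSup_tsum_le {f : ι → (Fin n → ℝ) → E} (hf : SmoothSummable f)
    (a : Fin n → ℕ) : derivSup a (fun s => ∑' x, f x s) ≤ ∑' x, derivSup a (f x) := by
  refine iSup_le fun s => ?_
  rw [(hf.mixedDeriv a).2]
  exact enorm_tsum_le_tsum_enorm.trans
    (ENNReal.tsum_le_tsum fun x => enorm_mixedDeriv_le a (f x) s)

end Series

/-! ### Integration of one variable and differentiation under the integral -/

section Slot

variable {E E' : Type*} [NormedAddCommGroup E] [NormedSpace ℝ E] [NormedAddCommGroup E']
  [NormedSpace ℝ E'] {n : ℕ}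

/-- A smooth function with bounded derivatives. -/
structure BoundedSmooth (f : (Fin n → ℝ) → E) : Prop where
  contDiff : ContDiff ℝ (⊤ : ℕ∞) f
  bounded : ∀ a, derivSup a f ≠ ∞

lemma BoundedSmooth.pderiv {f : (Fin n → ℝ) → E} (hf : BoundedSmooth f) (l : Fin n) :
    BoundedSmooth (pderiv l f) where
  contDiff := pderiv_contDiff l hf.contDiff
  bounded a := by
    rw [derivSup_pderiv a l hf.contDiff]
    exact hf.bounded _

lemma continuous_cons (s : Fin n → ℝ) : Continuous fun t : ℝ => (Fin.cons t s : Fin (n + 1) → ℝ) :=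
  Continuous.finCons continuous_id continuous_const

lemma hasFDerivAt_comp_cons {F : (Fin (n + 1) → ℝ) → E} (hF : ContDiff ℝ (⊤ : ℕ∞) F) (t : ℝ)
    (s : Fin n → ℝ) : HasFDerivAt (fun s => F (Fin.cons t s : Fin (n + 1) → ℝ))
      (∑ l, (coordCLM l).smulRight (pderiv (Fin.succ l) F (Fin.cons t s : Fin (n + 1) → ℝ))) s := by
  have hc : HasFDerivAt (fun s => (Fin.cons t s : Fin (n + 1) → ℝ))
      (ContinuousLinearMap.pi (Fin.cons 0 (fun l => coordCLM l) : Fin (n + 1) → _)) s := by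
    refine hasFDerivAt_pi.2 (Fin.cases ?_ fun l => ?_)
    · exact hasFDerivAt_const t s
    · exact (coordCLM l).hasFDerivAt
  have h := (hasFDerivAt_sum_pderiv hF (Fin.cons t s : Fin (n + 1) → ℝ)).comp s hc
  suffices heq : (∑ l, (coordCLM l).smulRight
      (Connes.pderiv (Fin.succ l) F (Fin.cons t s : Fin (n + 1) → ℝ))) =
      (∑ l, (coordCLM l).smulRight (Connes.pderiv l F (Fin.cons t s : Fin (n + 1) → ℝ))).comp
      (ContinuousLinearMap.pi (Fin.cons 0 (fun l => coordCLM l) : Fin (n + 1) → _)) by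
    rw [heq]
    exact h
  ext v
  simp [Fin.sum_univ_succ]

lemma hasDerivAt_comp_cons {F : (Fin (n + 1) → ℝ) → E} (hF : ContDiff ℝ (⊤ : ℕ∞) F) (t : ℝ)
    (s : Fin n → ℝ) : HasDerivAt (fun t => F (Fin.cons t s : Fin (n + 1) → ℝ))
      (pderiv 0 F (Fin.cons t s : Fin (n + 1) → ℝ)) t := by
  have hc : HasDerivAt (fun t => (Fin.cons t s : Fin (n + 1) → ℝ)) (Pi.single 0 1) t := by
    refine hasDerivAt_pi.2 (Fin.cases ?_ fun l => ?_)
    · exact hasDerivAt_id t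
    · simpa [Fin.succ_ne_zero] using hasDerivAt_const t (s l)
  exact ((hF.differentiable (by simp) _).hasFDerivAt).comp_hasDerivAt t hc

/-- The function `F`, contracted with `P`, is integrated against `γ` in its first variable. -/
def slotInt (γ : ℝ → ℝ) (P : E →L[ℝ] E') (F : (Fin (n + 1) → ℝ) → E) : (Fin n → ℝ) → E' :=
  fun s => ∫ t in (0 : ℝ)..1, γ t • P (F (Fin.cons t s : Fin (n + 1) → ℝ))

lemma continuous_slot {γ : ℝ → ℝ} (hγ : Continuous γ) (P : E →L[ℝ] E')
    {F : (Fin (n + 1) → ℝ) → E} (hF : Continuous F) (s : Fin n → ℝ) :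
    Continuous fun t => γ t • P (F (Fin.cons t s : Fin (n + 1) → ℝ)) :=
  hγ.smul (P.continuous.comp (hF.comp (continuous_cons s)))

lemma BoundedSmooth.hasFDerivAt_slotInt [CompleteSpace E'] {γ : ℝ → ℝ} (hγ : Continuous γ) {B : ℝ}
    (hB : ∀ t, |γ t| ≤ B) (P : E →L[ℝ] E') {F : (Fin (n + 1) → ℝ) → E} (hF : BoundedSmooth F)
    (s : Fin n → ℝ) : HasFDerivAt (slotInt γ P F)
      (∑ l, (coordCLM l).smulRight (slotInt γ P (Connes.pderiv (Fin.succ l) F) s)) s := by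
  have hc : ∀ l t, ‖Connes.pderiv l F t‖ ≤ (derivSup (Pi.single l 1) F).toReal := fun l t => by
    simpa using ENNReal.toReal_mono (hF.bounded _) (enorm_pderiv_le l hF.contDiff t)
  have hint : ∀ (l : Fin n), IntervalIntegrable (fun t => γ t • P (Connes.pderiv (Fin.succ l) F
      (Fin.cons t s : Fin (n + 1) → ℝ))) MeasureTheory.volume 0 1 := fun l =>
    (continuous_slot hγ P (hF.pderiv _).contDiff.continuous s).intervalIntegrable _ _
  have hsum : Continuous fun t => ∑ l : Fin n, (coordCLM l).smulRight
      (γ t • P (Connes.pderiv (Fin.succ l) F (Fin.cons t s : Fin (n + 1) → ℝ))) :=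
    continuous_finsetSum _ fun l _ => ((ContinuousLinearMap.smulRightL ℝ (Fin n → ℝ) E'
      (coordCLM l)).continuous.comp (continuous_slot hγ P (hF.pderiv _).contDiff.continuous s))
  have h := intervalIntegral.hasFDerivAt_integral_of_dominated_of_fderiv_le (𝕜 := ℝ)
    (μ := MeasureTheory.volume) (a := 0) (b := 1) (s := Set.univ) (x₀ := s)
    (F := fun s t => γ t • P (F (Fin.cons t s : Fin (n + 1) → ℝ)))
    (F' := fun s t => ∑ l, (coordCLM l).smulRight
      (γ t • P (Connes.pderiv (Fin.succ l) F (Fin.cons t s : Fin (n + 1) → ℝ))))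
    -- A constant dominates: `γ` is bounded by `B`, and the first derivatives of `F` are bounded on
    -- the whole space.
    (bound := fun _ => ∑ l : Fin n, B * (‖P‖ * (derivSup (Pi.single (Fin.succ l) 1) F).toReal))
    Filter.univ_mem
    (Filter.Eventually.of_forall fun s =>
      (continuous_slot hγ P hF.contDiff.continuous s).aestronglyMeasurable)
    ((continuous_slot hγ P hF.contDiff.continuous s).intervalIntegrable _ _)
    hsum.aestronglyMeasurable
    (Filter.Eventually.of_forall fun t _ s _ => ?_)
    (continuous_const.intervalIntegrable _ _)
    (Filter.Eventually.of_forall fun t _ s _ => ?_)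
  · suffices heq : (∑ l, (coordCLM l).smulRight (slotInt γ P (Connes.pderiv (Fin.succ l) F) s)) =
        ∫ t in (0 : ℝ)..1, ∑ l, (coordCLM l).smulRight
          (γ t • P (Connes.pderiv (Fin.succ l) F (Fin.cons t s : Fin (n + 1) → ℝ))) by
      rw [heq]
      exact h
    rw [intervalIntegral.integral_finsetSum]
    · refine Finset.sum_congr rfl fun l _ => ?_
      exact ((ContinuousLinearMap.smulRightL ℝ (Fin n → ℝ) E'
        (coordCLM l)).intervalIntegral_comp_comm (hint l)).symm
    · intro l _
      exact Continuous.intervalIntegrable ((ContinuousLinearMap.smulRightL ℝ (Fin n → ℝ) E'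
        (coordCLM l)).continuous.comp
          (continuous_slot hγ P (hF.pderiv _).contDiff.continuous s)) _ _
  · refine (norm_sum_le _ _).trans (Finset.sum_le_sum fun l _ => ?_)
    rw [ContinuousLinearMap.norm_smulRight_apply, norm_smul]
    have h1 : ‖coordCLM l‖ ≤ 1 := ContinuousLinearMap.opNorm_le_bound _ zero_le_one fun v => by
      rw [one_mul]
      exact norm_le_pi_norm v l
    refine (mul_le_of_le_one_left (by positivity) h1).trans ?_
    refine mul_le_mul (hB t) ?_ (norm_nonneg _) ((abs_nonneg _).trans (hB t))
    exact (P.le_opNorm _).trans (mul_le_mul_of_nonneg_left (hc _ _) (norm_nonneg _))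
  · have h1 := (P.hasFDerivAt.comp s (hasFDerivAt_comp_cons hF.contDiff t s)).const_smul (γ t)
    suffices heq : (∑ l, (coordCLM l).smulRight
        (γ t • P (Connes.pderiv (Fin.succ l) F (Fin.cons t s : Fin (n + 1) → ℝ)))) =
        γ t • P.comp (∑ l, (coordCLM l).smulRight
          (Connes.pderiv (Fin.succ l) F (Fin.cons t s : Fin (n + 1) → ℝ))) by
      rw [heq]
      exact h1
    ext v
    simp [Finset.smul_sum, smul_comm (γ t)]

lemma BoundedSmooth.contDiff_slotInt [CompleteSpace E'] {γ : ℝ → ℝ} (hγ : Continuous γ) {B : ℝ}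
    (hB : ∀ t, |γ t| ≤ B) (P : E →L[ℝ] E') {F : (Fin (n + 1) → ℝ) → E} (hF : BoundedSmooth F) :
    ContDiff ℝ (⊤ : ℕ∞) (slotInt γ P F) := by
  refine contDiff_of_pderiv_class
    (p := fun f => ∃ F : (Fin (n + 1) → ℝ) → E, BoundedSmooth F ∧ f = slotInt γ P F)
    ?_ ?_ ⟨F, hF, rfl⟩
  · rintro _ ⟨F, hF, rfl⟩
    exact continuous_iff_continuousAt.2 fun s => (hF.hasFDerivAt_slotInt hγ hB P s).continuousAt
  · rintro _ ⟨F, hF, rfl⟩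
    exact ⟨fun l => slotInt γ P (Connes.pderiv (Fin.succ l) F), fun l => ⟨_, hF.pderiv _, rfl⟩,
      hF.hasFDerivAt_slotInt hγ hB P⟩

/-- The integrated variable comes first, so differentiating in the remaining ones only prefixes the
multi-index with `0`. -/
lemma BoundedSmooth.mixedDeriv_slotInt [CompleteSpace E'] {γ : ℝ → ℝ} (hγ : Continuous γ) {B : ℝ}
    (hB : ∀ t, |γ t| ≤ B) (P : E →L[ℝ] E') {F : (Fin (n + 1) → ℝ) → E} (hF : BoundedSmooth F)
    (a : Fin n → ℕ) :
    BoundedSmooth (mixedDeriv (Fin.cons 0 a : Fin (n + 1) → ℕ) F) ∧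
      mixedDeriv a (slotInt γ P F) =
        slotInt γ P (mixedDeriv (Fin.cons 0 a : Fin (n + 1) → ℕ) F) := by
  induction a using multiIndex_induction with
  | h0 =>
    have : (Fin.cons 0 0 : Fin (n + 1) → ℕ) = 0 := by
      funext l
      cases l using Fin.cases <;> rfl
    rw [this, mixedDeriv_zero, mixedDeriv_zero]
    exact ⟨hF, rfl⟩
  | h1 a l ih =>
    have : (Fin.cons 0 (a + Pi.single l 1) : Fin (n + 1) → ℕ) =
        (Fin.cons 0 a : Fin (n + 1) → ℕ) + Pi.single l.succ 1 := by
      funext x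
      cases x using Fin.cases with
      | zero => simp [Fin.succ_ne_zero, eq_comm]
      | succ x => simp [Pi.single_apply]
    rw [this, mixedDeriv_add_single _ _ hF.contDiff,
      mixedDeriv_add_single _ _ (hF.contDiff_slotInt hγ hB P), ih.2]
    exact ⟨ih.1.pderiv _, pderiv_eq_of_hasFDerivAt (ih.1.hasFDerivAt_slotInt hγ hB P) l⟩

lemma enorm_slotInt_le {γ : ℝ → ℝ} {B : ℝ} (hB : ∀ t, |γ t| ≤ B) (P : E →L[ℝ] E')
    (F : (Fin (n + 1) → ℝ) → E) (hP : ∀ v, ‖P v‖ ≤ ‖v‖) (s : Fin n → ℝ) :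
    ‖slotInt γ P F s‖ₑ ≤ ENNReal.ofReal B * ⨆ s, ‖F s‖ₑ := by
  unfold slotInt
  rw [intervalIntegral.integral_of_le zero_le_one]
  refine (MeasureTheory.enorm_integral_le_lintegral_enorm _).trans ?_
  refine (MeasureTheory.lintegral_mono
    (g := fun _ => ENNReal.ofReal B * ⨆ s, ‖F s‖ₑ) fun t => ?_).trans ?_
  · rw [enorm_smul]
    refine mul_le_mul' ?_ ?_
    · rw [Real.enorm_eq_ofReal_abs]
      exact ENNReal.ofReal_le_ofReal (hB t)
    · exact (enorm_le_iff_norm_le.2 (hP _)).trans (le_iSup (fun s => ‖F s‖ₑ) _)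
  · simp

end Slot

/-! ### The trigonometric basis and integration by parts on the circle -/

section Trig

lemma continuous_trig (k : ℤ) : Continuous (trig k) := by
  unfold trig
  split_ifs <;> fun_prop

/-- The weight of the frequency `k`. -/
def weight (k : ℤ) : ℝ := 4 * Real.pi ^ 2 * (k : ℝ) ^ 2 + 1

lemma one_le_weight (k : ℤ) : 1 ≤ weight k := by
  unfold weight
  have : 0 ≤ 4 * Real.pi ^ 2 * (k : ℝ) ^ 2 := by positivity
  linarith

lemma weight_pos (k : ℤ) : 0 < weight k := zero_lt_one.trans_le (one_le_weight k)

lemma abs_trig_le (k : ℤ) (t : ℝ) : |trig k t| ≤ 2 := by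
  have h1 : 1 ≤ √(weight k) := Real.one_le_sqrt.2 (one_le_weight k)
  have h2 : √2 ≤ 2 := by
    rw [Real.sqrt_le_left (by norm_num)]
    norm_num
  have h3 : ∀ x : ℝ, |x| ≤ 1 → |√2 * x| ≤ 2 := fun x hx => by
    rw [abs_mul, abs_of_nonneg (Real.sqrt_nonneg _)]
    exact (mul_le_of_le_one_right (Real.sqrt_nonneg _) hx).trans h2
  unfold trig
  rw [abs_div, abs_of_nonneg (Real.sqrt_nonneg _)]
  refine (div_le_self (abs_nonneg _) h1).trans ?_
  split_ifs
  · norm_num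
  · exact h3 _ (Real.abs_cos_le_one _)
  · exact h3 _ (Real.abs_sin_le_one _)

lemma hasDerivAt_trig (k : ℤ) (t : ℝ) : HasDerivAt (trig k) (deriv (trig k) t) t := by
  refine DifferentiableAt.hasDerivAt ?_
  unfold trig
  split_ifs <;> fun_prop

lemma deriv_trig (k : ℤ) : deriv (trig k) = fun t => 2 * k * Real.pi * (if k = 0 then 0
    else if 0 < k then - (√2 * Real.sin (2 * k * Real.pi * t))
    else √2 * Real.cos (2 * k * Real.pi * t)) / √(4 * Real.pi ^ 2 * (k : ℝ) ^ 2 + 1) := by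
  funext t
  have hl : HasDerivAt (fun t : ℝ => 2 * k * Real.pi * t) (2 * k * Real.pi) t := by
    simpa using (hasDerivAt_id t).const_mul (2 * (k : ℝ) * Real.pi)
  refine HasDerivAt.deriv ?_
  unfold trig
  split_ifs with h0 h1
  · simpa using hasDerivAt_const t _
  · refine HasDerivAt.congr_deriv
      ((hl.cos.const_mul √2).div_const √(4 * Real.pi ^ 2 * (k : ℝ) ^ 2 + 1)) ?_
    ring
  · refine HasDerivAt.congr_deriv
      ((hl.sin.const_mul √2).div_const √(4 * Real.pi ^ 2 * (k : ℝ) ^ 2 + 1)) ?_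
    ring

lemma continuous_deriv_trig (k : ℤ) : Continuous (deriv (trig k)) := by
  rw [deriv_trig]
  split_ifs <;> fun_prop

lemma hasDerivAt_deriv_trig (k : ℤ) (t : ℝ) :
    HasDerivAt (deriv (trig k)) (-(4 * Real.pi ^ 2 * (k : ℝ) ^ 2 * trig k t)) t := by
  have hl : HasDerivAt (fun t : ℝ => 2 * k * Real.pi * t) (2 * k * Real.pi) t := by
    simpa using (hasDerivAt_id t).const_mul (2 * (k : ℝ) * Real.pi)
  rw [deriv_trig]
  unfold trig
  split_ifs with h0 h1
  · simpa [h0] using hasDerivAt_const t (0 : ℝ)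
  · refine HasDerivAt.congr_deriv
      ((((hl.sin.const_mul √2).neg).const_mul (2 * k * Real.pi)).div_const
      √(4 * Real.pi ^ 2 * (k : ℝ) ^ 2 + 1)) ?_
    ring
  · refine HasDerivAt.congr_deriv ((((hl.cos.const_mul √2)).const_mul (2 * k * Real.pi)).div_const
      √(4 * Real.pi ^ 2 * (k : ℝ) ^ 2 + 1)) ?_
    ring

lemma trig_one (k : ℤ) : trig k 1 = trig k 0 := by
  have hc : Real.cos (2 * k * Real.pi) = 1 := by
    rw [show 2 * (k : ℝ) * Real.pi = k * (2 * Real.pi) by ring]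
    exact Real.cos_int_mul_two_pi k
  have hs : Real.sin (2 * k * Real.pi) = 0 := by
    rw [show 2 * (k : ℝ) * Real.pi = (2 * k : ℤ) * Real.pi by push_cast; ring]
    exact Real.sin_int_mul_pi _
  simp [trig, hc, hs]

lemma deriv_trig_one (k : ℤ) : deriv (trig k) 1 = deriv (trig k) 0 := by
  have hc : Real.cos (2 * k * Real.pi) = 1 := by
    rw [show 2 * (k : ℝ) * Real.pi = k * (2 * Real.pi) by ring]
    exact Real.cos_int_mul_two_pi k
  have hs : Real.sin (2 * k * Real.pi) = 0 := by
    rw [show 2 * (k : ℝ) * Real.pi = (2 * k : ℤ) * Real.pi by push_cast; ring]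
    exact Real.sin_int_mul_pi _
  simp [deriv_trig, hc, hs]

variable {E : Type*} [NormedAddCommGroup E] [NormedSpace ℝ E] [CompleteSpace E]

/-- One integration by parts with `γ'' = -4π²k² γ`; the boundary terms cancel by periodicity. -/
lemma integral_deriv_trig_smul_deriv (k : ℤ) {u u' : ℝ → E} (hu : ∀ t, HasDerivAt u (u' t) t)
    (hu' : Continuous u') (h1 : u 1 = u 0) :
    ∫ t in (0 : ℝ)..1, deriv (trig k) t • u' t =
      (4 * Real.pi ^ 2 * (k : ℝ) ^ 2) • ∫ t in (0 : ℝ)..1, trig k t • u t := by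
  rw [intervalIntegral.integral_smul_deriv_eq_deriv_smul
    (fun t _ => hasDerivAt_deriv_trig k t) (fun t _ => hu t)
    (Continuous.intervalIntegrable (by have := continuous_trig k; fun_prop) _ _)
    (hu'.intervalIntegrable _ _), deriv_trig_one, h1, sub_self, zero_sub,
    ← intervalIntegral.integral_neg, ← intervalIntegral.integral_smul]
  simp [mul_smul]

lemma integral_trig_smul_deriv (k : ℤ) {u u' : ℝ → E} (hu : ∀ t, HasDerivAt u (u' t) t)
    (hu' : Continuous u') (h1 : u 1 = u 0) :
    ∫ t in (0 : ℝ)..1, trig k t • u' t = - ∫ t in (0 : ℝ)..1, deriv (trig k) t • u t := by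
  rw [intervalIntegral.integral_smul_deriv_eq_deriv_smul
    (fun t _ => hasDerivAt_trig k t) (fun t _ => hu t)
    ((continuous_deriv_trig k).intervalIntegrable _ _)
    (hu'.intervalIntegrable _ _), trig_one, h1, sub_self, zero_sub]

/-- This replaces the H¹ pairing in the annihilation operator by an L² pairing, at the cost of the
factor `weight k`. -/
lemma integral_trig_smul_add (k : ℤ) {u u' : ℝ → E} (hu : ∀ t, HasDerivAt u (u' t) t)
    (hu' : Continuous u') (h1 : u 1 = u 0) :
    ∫ t in (0 : ℝ)..1, (trig k t • u t + deriv (trig k) t • u' t) =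
      weight k • ∫ t in (0 : ℝ)..1, trig k t • u t := by
  have hc : Continuous u := continuous_iff_continuousAt.2 fun t => (hu t).continuousAt
  rw [intervalIntegral.integral_add
    (f := fun t => trig k t • u t) (g := fun t => deriv (trig k) t • u' t)
    (((continuous_trig k).smul hc).intervalIntegrable _ _)
    (((continuous_deriv_trig k).smul hu').intervalIntegrable _ _),
    integral_deriv_trig_smul_deriv k hu hu' h1, weight, add_smul, one_smul, add_comm]

/-- The operator `1 - ∂²` multiplies `trig k` by `weight k` and is symmetric on periodic functions.
Each use exchanges a power of the weight for two derivatives of `u`, which is the source of all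
decay in the frequency. -/
lemma weight_smul_integral_trig (k : ℤ) {u u' u'' : ℝ → E} (hu : ∀ t, HasDerivAt u (u' t) t)
    (hu' : ∀ t, HasDerivAt u' (u'' t) t) (hu'' : Continuous u'') (h1 : u 1 = u 0)
    (h1' : u' 1 = u' 0) : weight k • ∫ t in (0 : ℝ)..1, trig k t • u t =
      ∫ t in (0 : ℝ)..1, trig k t • (u t - u'' t) := by
  have hc : Continuous u := continuous_iff_continuousAt.2 fun t => (hu t).continuousAt
  have hc' : Continuous u' := continuous_iff_continuousAt.2 fun t => (hu' t).continuousAt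
  simp only [smul_sub]
  rw [intervalIntegral.integral_sub
    (f := fun t => trig k t • u t) (g := fun t => trig k t • u'' t)
    (((continuous_trig k).smul hc).intervalIntegrable _ _)
    (((continuous_trig k).smul hu'').intervalIntegrable _ _),
    integral_trig_smul_deriv k hu' hu'' h1', integral_deriv_trig_smul_deriv k hu hc' h1,
    weight, add_smul, one_smul, sub_neg_eq_add, add_comm]

end Trig

/-! ### Norms, absolute summability and bounded operators on the Connes space -/

section Space

variable {𝕂 : Type*} [RCLike 𝕂] {d : ℕ} {ι κ : Type*}

lemma supNorm_eq_sum (k : ℕ) {n : ℕ} (f : (Fin n → ℝ) → EuclideanSpace 𝕂 (Fin n → Fin d)) :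
    supNorm k f = ∑ a : Fin n → Fin (k + 1), derivSup (fun l => (a l : ℕ)) f := rfl

lemma derivSup_le_supNorm {k n : ℕ} (f : (Fin n → ℝ) → EuclideanSpace 𝕂 (Fin n → Fin d))
    {a : Fin n → ℕ} (ha : ∀ l, a l ≤ k) : derivSup a f ≤ supNorm k f := by
  obtain ⟨b, rfl⟩ : ∃ b : Fin n → Fin (k + 1), a = fun l => (b l : ℕ) :=
    ⟨fun l => ⟨a l, Nat.lt_succ_of_le (ha l)⟩, rfl⟩
  rw [supNorm_eq_sum]
  exact Finset.single_le_sum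
    (f := fun a : Fin n → Fin (k + 1) => derivSup (fun l => (a l : ℕ)) f)
    (fun _ _ => zero_le) (Finset.mem_univ b)

lemma mul_supNorm_le_coNorm (k : ℕ) (C : ℝ) (F : Chaos 𝕂 d) (n : ℕ) :
    ENNReal.ofReal (C ^ n) * supNorm k (F n) ≤ coNorm k C F :=
  ENNReal.le_tsum (f := fun n => ENNReal.ofReal (C ^ n) * supNorm k (F n)) n

lemma supNorm_ne_top {k : ℕ} {C : ℝ} (hC : 0 < C) {F : Chaos 𝕂 d} (hF : coNorm k C F ≠ ∞) (n : ℕ) :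
    supNorm k (F n) ≠ ∞ := by
  intro h
  have := mul_supNorm_le_coNorm k C F n
  rw [h, ENNReal.mul_top (by simpa using pow_pos hC n)] at this
  exact hF (top_le_iff.1 this)

/-- A single norm dominates all pointwise values; convergence in the norms therefore determines the
limit. -/
lemma enorm_apply_le_coNorm (F : Chaos 𝕂 d) (n : ℕ) (s : Fin n → ℝ) :
    ‖F n s‖ₑ ≤ coNorm 0 1 F := by
  refine (enorm_le_derivSup (F n) s).trans ?_
  refine (derivSup_le_supNorm (k := 0) (F n) (fun l => le_rfl)).trans ?_
  simpa using mul_supNorm_le_coNorm 0 1 F n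

lemma coNorm_lt_top {F : Chaos 𝕂 d} (hF : F ∈ CO 𝕂 d) (k : ℕ) {C : ℝ} (hC : 0 < C) :
    coNorm k C F < ∞ := hF.2.2.2 k C hC

lemma exists_le_multiIndex {n : ℕ} (a : Fin n → ℕ) : ∃ k, ∀ l, a l ≤ k :=
  ⟨∑ l, a l, fun l => Finset.single_le_sum (fun _ _ => Nat.zero_le _) (Finset.mem_univ l)⟩

lemma boundedSmooth_of_mem {F : Chaos 𝕂 d} (hF : F ∈ CO 𝕂 d) (n : ℕ) : BoundedSmooth (F n) where
  contDiff := hF.1 n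
  bounded a := by
    obtain ⟨k, hk⟩ := exists_le_multiIndex a
    exact ((derivSup_le_supNorm _ hk).trans_lt
      (supNorm_ne_top zero_lt_one (coNorm_lt_top hF k zero_lt_one).ne n).lt_top).ne

/-- The pointwise sum of a family of sequences of functions. -/
def tsumCO (f : ι → Chaos 𝕂 d) : Chaos 𝕂 d := fun n s => ∑' x, f x n s

/-- Absolute summability in `CO_{∞-}`. -/
structure AbsSumCO (f : ι → Chaos 𝕂 d) : Prop where
  mem : ∀ x, f x ∈ CO 𝕂 d
  summable : ∀ (k : ℕ) (C : ℝ), 0 < C → ∑' x, coNorm k C (f x) ≠ ∞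

lemma AbsSumCO.smoothSummable {f : ι → Chaos 𝕂 d} (hf : AbsSumCO f) (n : ℕ) :
    SmoothSummable fun x => f x n where
  contDiff x := (hf.mem x).1 n
  summable a := by
    obtain ⟨k, hk⟩ := exists_le_multiIndex a
    refine ne_top_of_le_ne_top (hf.summable k 1 zero_lt_one) (ENNReal.tsum_le_tsum fun x => ?_)
    refine (derivSup_le_supNorm _ hk).trans ?_
    simpa using mul_supNorm_le_coNorm k 1 (f x) n

lemma AbsSumCO.coNorm_tsum_le {f : ι → Chaos 𝕂 d} (hf : AbsSumCO f) (k : ℕ) (C : ℝ) :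
    coNorm k C (tsumCO f) ≤ ∑' x, coNorm k C (f x) := by
  unfold coNorm
  rw [ENNReal.tsum_comm]
  refine ENNReal.tsum_le_tsum fun n => ?_
  rw [ENNReal.tsum_mul_left]
  refine mul_le_mul_right ?_ _
  simp only [supNorm_eq_sum]
  rw [Summable.tsum_finsetSum fun _ _ => ENNReal.summable]
  exact Finset.sum_le_sum fun a _ => (hf.smoothSummable n).derivSup_tsum_le _

lemma tsum_apply_coord {α : Type*} [Fintype α] {f : ι → EuclideanSpace 𝕂 α} (hf : Summable f)
    (I : α) : (∑' x, f x) I = ∑' x, f x I :=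
  (EuclideanSpace.proj (𝕜 := 𝕂) I).map_tsum hf

lemma AbsSumCO.tsum_mem {f : ι → Chaos 𝕂 d} (hf : AbsSumCO f) : tsumCO f ∈ CO 𝕂 d := by
  refine ⟨fun n => (hf.smoothSummable n).contDiff_tsum, fun n l s => ?_, fun n σ s I => ?_,
    fun k C hC => (hf.coNorm_tsum_le k C).trans_lt (hf.summable k C hC).lt_top⟩
  · exact tsum_congr fun x => (hf.mem x).2.1 n l s
  · unfold tsumCO
    rw [tsum_apply_coord ((hf.smoothSummable n).summable_apply _),
      tsum_apply_coord ((hf.smoothSummable n).summable_apply _)]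
    exact tsum_congr fun x => (hf.mem x).2.2.1 n σ s I

lemma AbsSumCO.comp_injective {f : ι → Chaos 𝕂 d} (hf : AbsSumCO f) {e : κ → ι}
    (he : Function.Injective e) : AbsSumCO (f ∘ e) where
  mem _ := hf.mem _
  summable k C hC := ne_top_of_le_ne_top (hf.summable k C hC)
    (ENNReal.tsum_comp_le_tsum_of_injective he fun x => coNorm k C (f x))

/-- The remainder after a finite set of indices is the sum over its complement, and its norm is at
most a tail of a convergent series. -/
lemma AbsSumCO.hasSum {f : ι → Chaos 𝕂 d} (hf : AbsSumCO f) : HasSumCO f (tsumCO f) := by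
  refine ⟨hf.mem, hf.tsum_mem, fun k C hC => ?_⟩
  refine tendsto_of_tendsto_of_tendsto_of_le_of_le tendsto_const_nhds
    (ENNReal.tendsto_tsum_compl_atTop_zero (hf.summable k C hC)) (fun S => zero_le) fun S => ?_
  have hsub := hf.comp_injective (e := ((↑) : {x // x ∉ S} → ι)) Subtype.coe_injective
  have h : tsumCO f - ∑ x ∈ S, f x = tsumCO (f ∘ ((↑) : {x // x ∉ S} → ι)) := by
    rw [sub_eq_iff_eq_add']
    funext n s
    simp only [Pi.add_apply, Finset.sum_apply]
    exact (((hf.smoothSummable n).summable_apply s).sum_add_tsum_subtype_compl S).symm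
  simp only [h]
  exact hsub.coNorm_tsum_le k C

lemma HasSumCO.hasSum_apply {f : ι → Chaos 𝕂 d} {F : Chaos 𝕂 d} (h : HasSumCO f F) (n : ℕ)
    (s : Fin n → ℝ) : HasSum (fun x => f x n s) (F n s) := by
  have h1 := h.2.2 0 1 zero_lt_one
  refine tendsto_iff_edist_tendsto_0.2 ?_
  refine tendsto_of_tendsto_of_tendsto_of_le_of_le tendsto_const_nhds h1 (fun S => zero_le)
    fun S => ?_
  rw [edist_comm, edist_eq_enorm_sub]
  simpa [Finset.sum_apply] using enorm_apply_le_coNorm (F - ∑ x ∈ S, f x) n s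

lemma HasSumCO.tsum_eq {f : ι → Chaos 𝕂 d} {F : Chaos 𝕂 d} (h : HasSumCO f F) : tsumCO f = F := by
  funext n s
  exact (h.hasSum_apply n s).tsum_eq

/-- Any sum is the pointwise one. Identities between the `P^r` are obtained from this by matching
the terms of two series. -/
lemma HasSumCO.unique {f : ι → Chaos 𝕂 d} {F G : Chaos 𝕂 d} (h : HasSumCO f F)
    (h' : HasSumCO f G) : F = G := h.tsum_eq.symm.trans h'.tsum_eq

lemma HasSumCO.congr_terms {f g : ι → Chaos 𝕂 d} {F : Chaos 𝕂 d} (h : HasSumCO f F)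
    (hfg : ∀ x, g x = f x) : HasSumCO g F := by
  rwa [show g = f from funext hfg]

lemma HasSumCO.add {f g : ι → Chaos 𝕂 d} {F G : Chaos 𝕂 d} (hf : HasSumCO f F)
    (hg : HasSumCO g G) : HasSumCO (fun x => f x + g x) (F + G) := by
  refine ⟨fun x => add_mem (hf.1 x) (hg.1 x), add_mem hf.2.1 hg.2.1, fun k C hC => ?_⟩
  have h := (hf.2.2 k C hC).add (hg.2.2 k C hC)
  rw [add_zero] at h
  refine tendsto_of_tendsto_of_tendsto_of_le_of_le tendsto_const_nhds h (fun S => zero_le)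
    fun S => ?_
  have hF := sub_mem hf.2.1 (sum_mem fun x (_ : x ∈ S) => hf.1 x)
  have hG := sub_mem hg.2.1 (sum_mem fun x (_ : x ∈ S) => hg.1 x)
  refine le_trans (le_of_eq ?_) (coNorm_add_le k C hF.1 hG.1)
  rw [Finset.sum_add_distrib]
  congr 1
  abel

/-- `T` is linear and bounded on `CO_{∞-}`. -/
structure IsBoundedLinear (T : Chaos 𝕂 d → Chaos 𝕂 d) : Prop where
  mem : ∀ F ∈ CO 𝕂 d, T F ∈ CO 𝕂 d
  add : ∀ F ∈ CO 𝕂 d, ∀ G ∈ CO 𝕂 d, T (F + G) = T F + T G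
  smul : ∀ (c : 𝕂), ∀ F ∈ CO 𝕂 d, T (c • F) = c • T F
  bound : ∀ (k : ℕ) (C : ℝ), 0 < C → ∃ (K : ℝ≥0∞) (k₁ : ℕ) (C₁ : ℝ), K ≠ ∞ ∧ 0 < C₁ ∧
    ∀ F ∈ CO 𝕂 d, coNorm k C (T F) ≤ K * coNorm k₁ C₁ F

lemma IsBoundedLinear.zero {T : Chaos 𝕂 d → Chaos 𝕂 d} (hT : IsBoundedLinear T) : T 0 = 0 := by
  simpa using hT.smul 0 0 (zero_mem _)

lemma IsBoundedLinear.sub {T : Chaos 𝕂 d → Chaos 𝕂 d} (hT : IsBoundedLinear T) {F G : Chaos 𝕂 d}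
    (hF : F ∈ CO 𝕂 d) (hG : G ∈ CO 𝕂 d) : T (F - G) = T F - T G := by
  rw [sub_eq_add_neg, ← neg_one_smul 𝕂 G, hT.add F hF _ (Submodule.smul_mem _ _ hG),
    hT.smul _ G hG, neg_one_smul, sub_eq_add_neg]

lemma IsBoundedLinear.sum {T : Chaos 𝕂 d → Chaos 𝕂 d} (hT : IsBoundedLinear T)
    {f : ι → Chaos 𝕂 d} (S : Finset ι) (hf : ∀ x ∈ S, f x ∈ CO 𝕂 d) :
    T (∑ x ∈ S, f x) = ∑ x ∈ S, T (f x) := by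
  classical
  induction S using Finset.induction_on with
  | empty => simpa using hT.zero
  | insert x S hx ih =>
    rw [Finset.sum_insert hx, Finset.sum_insert hx,
      hT.add _ (hf x (Finset.mem_insert_self _ _)) _
        (sum_mem fun y hy => hf y (Finset.mem_insert_of_mem hy)),
      ih fun y hy => hf y (Finset.mem_insert_of_mem hy)]

lemma HasSumCO.map {f : ι → Chaos 𝕂 d} {F : Chaos 𝕂 d} (h : HasSumCO f F)
    {T : Chaos 𝕂 d → Chaos 𝕂 d} (hT : IsBoundedLinear T) : HasSumCO (fun x => T (f x)) (T F) := by
  refine ⟨fun x => hT.mem _ (h.1 x), hT.mem _ h.2.1, fun k C hC => ?_⟩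
  obtain ⟨K, k₁, C₁, hK, hC₁, hb⟩ := hT.bound k C hC
  have h0 := ENNReal.Tendsto.const_mul (a := K) (h.2.2 k₁ C₁ hC₁) (Or.inr hK)
  rw [mul_zero] at h0
  refine tendsto_of_tendsto_of_tendsto_of_le_of_le tendsto_const_nhds h0 (fun S => zero_le)
    fun S => ?_
  have hS : ∑ x ∈ S, f x ∈ CO 𝕂 d := sum_mem fun x _ => h.1 x
  simp only
  rw [← hT.sum S fun x _ => h.1 x, ← hT.sub h.2.1 hS]
  exact hb _ (sub_mem h.2.1 hS)

lemma isBoundedLinear_smul (c : 𝕂) : IsBoundedLinear (𝕂 := 𝕂) (d := d) fun F => c • F where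
  mem _ hF := Submodule.smul_mem _ _ hF
  add _ _ _ _ := smul_add _ _ _
  smul _ _ _ := smul_comm _ _ _
  bound k C hC := ⟨‖c‖ₑ, k, C, enorm_ne_top, hC, fun _ hF => coNorm_smul_le k C c hF.1⟩

lemma coNorm_zero (k : ℕ) (C : ℝ) : coNorm k C (0 : Chaos 𝕂 d) = 0 := by
  have h := coNorm_smul_le k C (0 : 𝕂) (F := (0 : Chaos 𝕂 d)) (zero_mem (CO 𝕂 d)).1
  rw [zero_smul, enorm_zero, zero_mul] at h
  exact le_antisymm h zero_le

lemma coNorm_sum_le (k : ℕ) (C : ℝ) (S : Finset ι) {f : ι → Chaos 𝕂 d}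
    (hf : ∀ x ∈ S, f x ∈ CO 𝕂 d) : coNorm k C (∑ x ∈ S, f x) ≤ ∑ x ∈ S, coNorm k C (f x) := by
  classical
  induction S using Finset.induction_on with
  | empty => simp [coNorm_zero]
  | insert x S hx ih =>
    rw [Finset.sum_insert hx, Finset.sum_insert hx]
    refine (coNorm_add_le k C (hf x (Finset.mem_insert_self _ _)).1
      (sum_mem fun y hy => hf y (Finset.mem_insert_of_mem hy)).1).trans ?_
    exact add_le_add le_rfl (ih fun y hy => hf y (Finset.mem_insert_of_mem hy))

lemma hasSumCO_zero : HasSumCO (fun _ : ι => (0 : Chaos 𝕂 d)) 0 :=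
  ⟨fun _ => zero_mem _, zero_mem _, fun k C _ => by simp [coNorm_zero]⟩

lemma HasSumCO.sum {S : Finset κ} {f : κ → ι → Chaos 𝕂 d} {F : κ → Chaos 𝕂 d}
    (h : ∀ y ∈ S, HasSumCO (f y) (F y)) :
    HasSumCO (fun x => ∑ y ∈ S, f y x) (∑ y ∈ S, F y) := by
  classical
  induction S using Finset.induction_on with
  | empty => simpa using hasSumCO_zero
  | insert y S hy ih =>
    simp only [Finset.sum_insert hy]
    exact (h y (Finset.mem_insert_self _ _)).add
      (ih fun z hz => h z (Finset.mem_insert_of_mem hz))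

/-- Fubini for absolutely summable families; it isolates one frequency in the multiple series for
`P^{r+1}`. -/
lemma AbsSumCO.prod {f : ι × κ → Chaos 𝕂 d} (hf : AbsSumCO f) :
    AbsSumCO (fun x => tsumCO fun y => f (x, y)) ∧
      tsumCO (fun x => tsumCO fun y => f (x, y)) = tsumCO f := by
  have hx : ∀ x, AbsSumCO fun y => f (x, y) := fun x =>
    hf.comp_injective (e := fun y => (x, y)) (Prod.mk_right_injective x)
  refine ⟨⟨fun x => (hx x).tsum_mem, fun k C hC => ?_⟩, ?_⟩
  · have h := hf.summable k C hC
    rw [ENNReal.tsum_prod'] at h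
    exact ne_top_of_le_ne_top h (ENNReal.tsum_le_tsum fun x => (hx x).coNorm_tsum_le k C)
  · funext n s
    exact (((hf.smoothSummable n).summable_apply s).tsum_prod).symm

end Space

/-! ### Subadditivity and homogeneity of `derivSup` -/

section DerivSup

variable {E : Type*} [NormedAddCommGroup E] [NormedSpace ℝ E] {n : ℕ} {ι : Type*}

lemma derivSup_zero (a : Fin n → ℕ) : derivSup a (0 : (Fin n → ℝ) → E) = 0 := by
  have h := mixedDeriv_smul (𝕂 := ℝ) 0 a (f := (0 : (Fin n → ℝ) → E)) contDiff_const
  rw [zero_smul, zero_smul] at h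
  simp [derivSup, h]

lemma derivSup_add_le (a : Fin n → ℕ) {f g : (Fin n → ℝ) → E} (hf : ContDiff ℝ (⊤ : ℕ∞) f)
    (hg : ContDiff ℝ (⊤ : ℕ∞) g) : derivSup a (f + g) ≤ derivSup a f + derivSup a g := by
  refine iSup_le fun s => ?_
  rw [mixedDeriv_add a hf hg, Pi.add_apply]
  exact (enorm_add_le _ _).trans (add_le_add (enorm_mixedDeriv_le a f s)
    (enorm_mixedDeriv_le a g s))

lemma derivSup_sum_le (a : Fin n → ℕ) (S : Finset ι) {f : ι → (Fin n → ℝ) → E}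
    (hf : ∀ x ∈ S, ContDiff ℝ (⊤ : ℕ∞) (f x)) :
    derivSup a (∑ x ∈ S, f x) ≤ ∑ x ∈ S, derivSup a (f x) := by
  classical
  induction S using Finset.induction_on with
  | empty => simp [derivSup_zero]
  | insert x S hx ih =>
    rw [Finset.sum_insert hx, Finset.sum_insert hx]
    have hS : ContDiff ℝ (⊤ : ℕ∞) (∑ x ∈ S, f x) := by
      have := ContDiff.sum (s := S) (f := f) fun y hy => hf y (Finset.mem_insert_of_mem hy)
      convert this using 1
      funext s
      simp
    refine (derivSup_add_le a (hf x (Finset.mem_insert_self _ _)) hS).trans ?_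
    exact add_le_add le_rfl (ih fun y hy => hf y (Finset.mem_insert_of_mem hy))

lemma derivSup_smul_le {𝕂 : Type*} [RCLike 𝕂] [NormedSpace 𝕂 E] [SMulCommClass ℝ 𝕂 E] (c : 𝕂)
    (a : Fin n → ℕ) {f : (Fin n → ℝ) → E} (hf : ContDiff ℝ (⊤ : ℕ∞) f) :
    derivSup a (c • f) ≤ ‖c‖ₑ * derivSup a f := by
  refine iSup_le fun s => ?_
  rw [mixedDeriv_smul c a hf, Pi.smul_apply, enorm_smul]
  exact mul_le_mul_right (enorm_mixedDeriv_le a f s) _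

end DerivSup

/-! ### Tensor products with distributed variables -/

section Tensor

variable {𝕂 : Type*} [RCLike 𝕂] {d : ℕ} {p q N : ℕ}

/-- A word indexed by a disjoint union is a pair of words, so the sum factors. This serves twice:
for tensor coordinates in the Euclidean norm, and for multi-indices in `supNorm`. -/
lemma sum_comp_mul_comp {X R : Type*} [Fintype X] [CommSemiring R] (e : Fin p ⊕ Fin q ≃ Fin N)
    (u : (Fin p → X) → R) (v : (Fin q → X) → R) :
    ∑ a : Fin N → X, u (fun l => a (e (Sum.inl l))) * v (fun l => a (e (Sum.inr l))) =
      (∑ a, u a) * ∑ b, v b := by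
  rw [Finset.sum_mul_sum, ← Finset.sum_product', Finset.univ_product_univ]
  exact Fintype.sum_equiv ((e.symm.arrowCongr (Equiv.refl X)).trans
    (Equiv.sumArrowEquivProdArrow _ _ _)) _ _ fun a => rfl

/-- The tensor product of vectors, with the factors distributed by `e`. -/
def vecTensor (e : Fin p ⊕ Fin q ≃ Fin N) (v : EuclideanSpace 𝕂 (Fin p → Fin d))
    (w : EuclideanSpace 𝕂 (Fin q → Fin d)) : EuclideanSpace 𝕂 (Fin N → Fin d) :=
  WithLp.toLp 2 fun I => v (fun l => I (e (Sum.inl l))) * w (fun l => I (e (Sum.inr l)))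

lemma norm_vecTensor (e : Fin p ⊕ Fin q ≃ Fin N) (v : EuclideanSpace 𝕂 (Fin p → Fin d))
    (w : EuclideanSpace 𝕂 (Fin q → Fin d)) : ‖vecTensor e v w‖ = ‖v‖ * ‖w‖ := by
  rw [EuclideanSpace.norm_eq, EuclideanSpace.norm_eq, EuclideanSpace.norm_eq,
    ← Real.sqrt_mul (Finset.sum_nonneg fun _ _ => sq_nonneg _)]
  congr 1
  rw [← sum_comp_mul_comp e]
  refine Finset.sum_congr rfl fun I _ => ?_
  simp [vecTensor, mul_pow]

lemma enorm_vecTensor (e : Fin p ⊕ Fin q ≃ Fin N) (v : EuclideanSpace 𝕂 (Fin p → Fin d))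
    (w : EuclideanSpace 𝕂 (Fin q → Fin d)) : ‖vecTensor e v w‖ₑ = ‖v‖ₑ * ‖w‖ₑ := by
  rw [← ofReal_norm, norm_vecTensor, ENNReal.ofReal_mul (norm_nonneg _), ofReal_norm, ofReal_norm]

/-- `vecTensor` as a continuous bilinear map. -/
def vecTensorL (e : Fin p ⊕ Fin q ≃ Fin N) : EuclideanSpace 𝕂 (Fin p → Fin d) →L[ℝ]
    EuclideanSpace 𝕂 (Fin q → Fin d) →L[ℝ] EuclideanSpace 𝕂 (Fin N → Fin d) :=
  LinearMap.mkContinuous₂ (LinearMap.mk₂ ℝ (vecTensor e)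
    (fun v v' w => by ext I; simp [vecTensor, add_mul])
    (fun c v w => by ext I; simp [vecTensor])
    (fun v w w' => by ext I; simp [vecTensor, mul_add])
    (fun c v w => by ext I; simp [vecTensor])) 1
    (fun v w => by simp [norm_vecTensor])

@[simp] lemma vecTensorL_apply (e : Fin p ⊕ Fin q ≃ Fin N)
    (v : EuclideanSpace 𝕂 (Fin p → Fin d)) (w : EuclideanSpace 𝕂 (Fin q → Fin d)) :
    vecTensorL e v w = vecTensor e v w := rfl

/-- The tensor product of functions, with the variables and the factors distributed by `e`. -/
def tensorFn (e : Fin p ⊕ Fin q ≃ Fin N) (f : (Fin p → ℝ) → EuclideanSpace 𝕂 (Fin p → Fin d))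
    (g : (Fin q → ℝ) → EuclideanSpace 𝕂 (Fin q → Fin d)) :
    (Fin N → ℝ) → EuclideanSpace 𝕂 (Fin N → Fin d) :=
  fun s => vecTensor e (f fun l => s (e (Sum.inl l))) (g fun l => s (e (Sum.inr l)))

/-- The selection of coordinates. -/
def selectL (α : Fin p → Fin N) : (Fin N → ℝ) →L[ℝ] (Fin p → ℝ) :=
  ContinuousLinearMap.pi fun l => coordCLM (α l)

lemma hasFDerivAt_tensorFn (e : Fin p ⊕ Fin q ≃ Fin N)
    {f : (Fin p → ℝ) → EuclideanSpace 𝕂 (Fin p → Fin d)}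
    {g : (Fin q → ℝ) → EuclideanSpace 𝕂 (Fin q → Fin d)} (hf : ContDiff ℝ (⊤ : ℕ∞) f)
    (hg : ContDiff ℝ (⊤ : ℕ∞) g) (s : Fin N → ℝ) :
    HasFDerivAt (tensorFn e f g)
      ((vecTensorL e).precompR (Fin N → ℝ) (f fun l => s (e (Sum.inl l)))
        ((fderiv ℝ g fun l => s (e (Sum.inr l))).comp (selectL fun l => e (Sum.inr l))) +
       (vecTensorL e).precompL (Fin N → ℝ)
        ((fderiv ℝ f fun l => s (e (Sum.inl l))).comp (selectL fun l => e (Sum.inl l)))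
        (g fun l => s (e (Sum.inr l)))) s := by
  have h1 : HasFDerivAt (fun s : Fin N → ℝ => f fun l => s (e (Sum.inl l)))
      ((fderiv ℝ f fun l => s (e (Sum.inl l))).comp (selectL fun l => e (Sum.inl l))) s :=
    (hf.differentiable (by simp) _).hasFDerivAt.comp s
      (selectL fun l => e (Sum.inl l)).hasFDerivAt
  have h2 : HasFDerivAt (fun s : Fin N → ℝ => g fun l => s (e (Sum.inr l)))
      ((fderiv ℝ g fun l => s (e (Sum.inr l))).comp (selectL fun l => e (Sum.inr l))) s :=
    (hg.differentiable (by simp) _).hasFDerivAt.comp s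
      (selectL fun l => e (Sum.inr l)).hasFDerivAt
  exact (vecTensorL e).hasFDerivAt_of_bilinear h1 h2

lemma contDiff_tensorFn (e : Fin p ⊕ Fin q ≃ Fin N)
    {f : (Fin p → ℝ) → EuclideanSpace 𝕂 (Fin p → Fin d)}
    {g : (Fin q → ℝ) → EuclideanSpace 𝕂 (Fin q → Fin d)} (hf : ContDiff ℝ (⊤ : ℕ∞) f)
    (hg : ContDiff ℝ (⊤ : ℕ∞) g) : ContDiff ℝ (⊤ : ℕ∞) (tensorFn e f g) := by
  have h1 : ContDiff ℝ (⊤ : ℕ∞) fun s : Fin N → ℝ => f fun l => s (e (Sum.inl l)) :=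
    hf.comp (selectL fun l => e (Sum.inl l)).contDiff
  have h2 : ContDiff ℝ (⊤ : ℕ∞) fun s : Fin N → ℝ => g fun l => s (e (Sum.inr l)) :=
    hg.comp (selectL fun l => e (Sum.inr l)).contDiff
  exact ((vecTensorL e).contDiff.comp h1).clm_apply h2

lemma single_comp_inl (e : Fin p ⊕ Fin q ≃ Fin N) {R : Type*} [Zero R] (x : Fin p ⊕ Fin q)
    (c : R) : (fun l => (Pi.single (e x) c : Fin N → R) (e (Sum.inl l))) =
      x.elim (fun i => Pi.single i c) (fun _ => 0) := by
  funext l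
  rcases x with i | j <;> simp [Pi.single_apply]

lemma single_comp_inr (e : Fin p ⊕ Fin q ≃ Fin N) {R : Type*} [Zero R] (x : Fin p ⊕ Fin q)
    (c : R) : (fun l => (Pi.single (e x) c : Fin N → R) (e (Sum.inr l))) =
      x.elim (fun _ => 0) (fun i => Pi.single i c) := by
  funext l
  rcases x with i | j <;> simp [Pi.single_apply]

lemma pderiv_tensorFn (e : Fin p ⊕ Fin q ≃ Fin N)
    {f : (Fin p → ℝ) → EuclideanSpace 𝕂 (Fin p → Fin d)}
    {g : (Fin q → ℝ) → EuclideanSpace 𝕂 (Fin q → Fin d)} (hf : ContDiff ℝ (⊤ : ℕ∞) f)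
    (hg : ContDiff ℝ (⊤ : ℕ∞) g) (x : Fin p ⊕ Fin q) : pderiv (e x) (tensorFn e f g) =
      x.elim (fun i => tensorFn e (pderiv i f) g) (fun j => tensorFn e f (pderiv j g)) := by
  funext s
  have h1 : selectL (fun l => e (Sum.inl l)) (Pi.single (e x) 1) = _ :=
    single_comp_inl e x (1 : ℝ)
  have h2 : selectL (fun l => e (Sum.inr l)) (Pi.single (e x) 1) = _ :=
    single_comp_inr e x (1 : ℝ)
  unfold pderiv
  rw [(hasFDerivAt_tensorFn e hf hg s).fderiv]
  change vecTensorL e (f fun l => s (e (Sum.inl l)))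
      ((fderiv ℝ g fun l => s (e (Sum.inr l)))
        (selectL (fun l => e (Sum.inr l)) (Pi.single (e x) 1))) +
    vecTensorL e ((fderiv ℝ f fun l => s (e (Sum.inl l)))
      (selectL (fun l => e (Sum.inl l)) (Pi.single (e x) 1))) (g fun l => s (e (Sum.inr l))) = _
  rw [h1, h2]
  rcases x with i | j
  · simp only [Sum.elim_inl, map_zero, zero_add, vecTensorL_apply]
    rfl
  · simp only [Sum.elim_inr, map_zero, add_zero, vecTensorL_apply, zero_apply]
    rfl

/-- Each variable belongs to exactly one factor, so no Leibniz sum appears. -/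
lemma mixedDeriv_tensorFn (e : Fin p ⊕ Fin q ≃ Fin N)
    {f : (Fin p → ℝ) → EuclideanSpace 𝕂 (Fin p → Fin d)}
    {g : (Fin q → ℝ) → EuclideanSpace 𝕂 (Fin q → Fin d)} (hf : ContDiff ℝ (⊤ : ℕ∞) f)
    (hg : ContDiff ℝ (⊤ : ℕ∞) g) (a : Fin N → ℕ) : mixedDeriv a (tensorFn e f g) =
      tensorFn e (mixedDeriv (fun l => a (e (Sum.inl l))) f)
        (mixedDeriv (fun l => a (e (Sum.inr l))) g) := by
  induction a using multiIndex_induction with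
  | h0 =>
    have h : ∀ m, (fun _ : Fin m => 0) = (0 : Fin m → ℕ) := fun _ => rfl
    simp only [Pi.zero_apply, h, mixedDeriv_zero]
  | h1 a l ih =>
    obtain ⟨x, rfl⟩ := e.surjective l
    rw [mixedDeriv_add_single a _ (contDiff_tensorFn e hf hg), ih,
      pderiv_tensorFn e (mixedDeriv_contDiff _ hf) (mixedDeriv_contDiff _ hg)]
    have h1 : (fun l => (a + Pi.single (e x) 1 : Fin N → ℕ) (e (Sum.inl l))) =
        (fun l => a (e (Sum.inl l))) + x.elim (fun i => Pi.single i 1) (fun _ => 0) := by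
      rw [← single_comp_inl e x 1]; rfl
    have h2 : (fun l => (a + Pi.single (e x) 1 : Fin N → ℕ) (e (Sum.inr l))) =
        (fun l => a (e (Sum.inr l))) + x.elim (fun _ => 0) (fun i => Pi.single i 1) := by
      rw [← single_comp_inr e x 1]; rfl
    rw [h1, h2]
    rcases x with i | j
    · simp only [Sum.elim_inl, add_zero, mixedDeriv_add_single _ _ hf]
    · simp only [Sum.elim_inr, add_zero, mixedDeriv_add_single _ _ hg]

lemma supNorm_tensorFn_le (e : Fin p ⊕ Fin q ≃ Fin N)
    {f : (Fin p → ℝ) → EuclideanSpace 𝕂 (Fin p → Fin d)}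
    {g : (Fin q → ℝ) → EuclideanSpace 𝕂 (Fin q → Fin d)} (hf : ContDiff ℝ (⊤ : ℕ∞) f)
    (hg : ContDiff ℝ (⊤ : ℕ∞) g) (k : ℕ) :
    supNorm k (tensorFn e f g) ≤ supNorm k f * supNorm k g := by
  simp only [supNorm_eq_sum]
  rw [← sum_comp_mul_comp e]
  refine Finset.sum_le_sum fun a _ => iSup_le fun s => ?_
  rw [mixedDeriv_tensorFn e hf hg, tensorFn, enorm_vecTensor]
  exact mul_le_mul' (enorm_mixedDeriv_le _ f _) (enorm_mixedDeriv_le _ g _)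

end Tensor

/-! ### The Wick product is submultiplicative -/

section Wick

variable {𝕂 : Type*} [RCLike 𝕂] {d : ℕ} {p q N : ℕ}

/-- The distribution of `p + q = N` slots given by a permutation. -/
def splitEquiv (h : p + q = N) (σ : Equiv.Perm (Fin N)) : Fin p ⊕ Fin q ≃ Fin N :=
  finSumFinEquiv.trans ((finCongr h).trans σ)

lemma symTensor_eq (h : p + q = N) (f : (Fin p → ℝ) → EuclideanSpace 𝕂 (Fin p → Fin d))
    (g : (Fin q → ℝ) → EuclideanSpace 𝕂 (Fin q → Fin d)) :
    symTensor h f g =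
      (N ! : 𝕂)⁻¹ • ∑ σ : Equiv.Perm (Fin N), tensorFn (splitEquiv h σ) f g := by
  funext s
  ext I
  simp only [symTensor, Pi.smul_apply, Finset.sum_apply, PiLp.smul_apply, smul_eq_mul,
    WithLp.ofLp_sum]
  rfl

lemma contDiff_finsetSum {ι E : Type*} [NormedAddCommGroup E] [NormedSpace ℝ E] {n : ℕ}
    {S : Finset ι} {f : ι → (Fin n → ℝ) → E} (hf : ∀ x ∈ S, ContDiff ℝ (⊤ : ℕ∞) (f x)) :
    ContDiff ℝ (⊤ : ℕ∞) (∑ x ∈ S, f x) := by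
  have h := ContDiff.sum hf
  rwa [show (fun s => ∑ x ∈ S, f x s) = ∑ x ∈ S, f x from funext fun s => by simp] at h

lemma contDiff_symTensor (h : p + q = N) {f : (Fin p → ℝ) → EuclideanSpace 𝕂 (Fin p → Fin d)}
    {g : (Fin q → ℝ) → EuclideanSpace 𝕂 (Fin q → Fin d)} (hf : ContDiff ℝ (⊤ : ℕ∞) f)
    (hg : ContDiff ℝ (⊤ : ℕ∞) g) : ContDiff ℝ (⊤ : ℕ∞) (symTensor h f g) := by
  have h1 : ContDiff ℝ (⊤ : ℕ∞) (∑ σ : Equiv.Perm (Fin N), tensorFn (splitEquiv h σ) f g) :=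
    contDiff_finsetSum fun σ _ => contDiff_tensorFn _ hf hg
  rw [symTensor_eq]
  exact h1.const_smul (N ! : 𝕂)⁻¹

lemma supNorm_sum_le {ι : Type*} (k : ℕ) (S : Finset ι)
    {f : ι → (Fin N → ℝ) → EuclideanSpace 𝕂 (Fin N → Fin d)}
    (hf : ∀ x ∈ S, ContDiff ℝ (⊤ : ℕ∞) (f x)) :
    supNorm k (∑ x ∈ S, f x) ≤ ∑ x ∈ S, supNorm k (f x) := by
  simp only [supNorm_eq_sum]
  rw [Finset.sum_comm]
  exact Finset.sum_le_sum fun a _ => derivSup_sum_le _ S hf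

lemma supNorm_smul_le (k : ℕ) (c : 𝕂) {f : (Fin N → ℝ) → EuclideanSpace 𝕂 (Fin N → Fin d)}
    (hf : ContDiff ℝ (⊤ : ℕ∞) f) : supNorm k (c • f) ≤ ‖c‖ₑ * supNorm k f := by
  simp only [supNorm_eq_sum, Finset.mul_sum]
  exact Finset.sum_le_sum fun a _ => derivSup_smul_le c _ hf

lemma enorm_inv_factorial_mul (N : ℕ) : ‖(N ! : 𝕂)⁻¹‖ₑ * (N ! : ℝ≥0∞) = 1 := by
  have h0 : (N ! : 𝕂) ≠ 0 := Nat.cast_ne_zero.2 (Nat.factorial_ne_zero N)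
  have h : (N ! : ℝ≥0∞) = ‖(N ! : 𝕂)‖ₑ := by
    rw [← ofReal_norm, RCLike.norm_natCast, ENNReal.ofReal_natCast]
  rw [h, ← enorm_mul, inv_mul_cancel₀ h0, enorm_one]

/-- The symmetrization is an average of `N !` tensor products, each bounded by the product of the
norms. -/
lemma supNorm_symTensor_le (h : p + q = N)
    {f : (Fin p → ℝ) → EuclideanSpace 𝕂 (Fin p → Fin d)}
    {g : (Fin q → ℝ) → EuclideanSpace 𝕂 (Fin q → Fin d)} (hf : ContDiff ℝ (⊤ : ℕ∞) f)
    (hg : ContDiff ℝ (⊤ : ℕ∞) g) (k : ℕ) :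
    supNorm k (symTensor h f g) ≤ supNorm k f * supNorm k g := by
  rw [symTensor_eq]
  refine (supNorm_smul_le k _ (contDiff_finsetSum fun σ _ => contDiff_tensorFn _ hf hg)).trans ?_
  have h1 := (supNorm_sum_le k Finset.univ (f := fun σ : Equiv.Perm (Fin N) =>
    tensorFn (splitEquiv h σ) f g) (fun σ _ => contDiff_tensorFn _ hf hg)).trans
    (Finset.sum_le_sum fun σ _ => supNorm_tensorFn_le (splitEquiv h σ) hf hg k)
  rw [Finset.sum_const, Finset.card_univ, Fintype.card_perm, Fintype.card_fin, nsmul_eq_mul] at h1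
  refine (mul_le_mul_right h1 _).trans ?_
  rw [← mul_assoc, enorm_inv_factorial_mul, one_mul]

lemma contDiff_wick {F G : Chaos 𝕂 d} (hF : ∀ n, ContDiff ℝ (⊤ : ℕ∞) (F n))
    (hG : ∀ n, ContDiff ℝ (⊤ : ℕ∞) (G n)) (N : ℕ) : ContDiff ℝ (⊤ : ℕ∞) (wick F G N) :=
  contDiff_finsetSum fun _ _ => contDiff_symTensor _ (hF _) (hG _)

lemma supNorm_wick_le {F G : Chaos 𝕂 d} (hF : ∀ n, ContDiff ℝ (⊤ : ℕ∞) (F n))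
    (hG : ∀ n, ContDiff ℝ (⊤ : ℕ∞) (G n)) (k N : ℕ) : supNorm k (wick F G N) ≤
      ∑ pq ∈ Finset.HasAntidiagonal.antidiagonal N, supNorm k (F pq.1) * supNorm k (G pq.2) := by
  refine (supNorm_sum_le k _ fun pq _ => contDiff_symTensor _ (hF _) (hG _)).trans ?_
  refine (Finset.sum_le_sum fun pq _ => supNorm_symTensor_le _ (hF _) (hG _) k).trans ?_
  exact (Finset.sum_coe_sort (Finset.HasAntidiagonal.antidiagonal N)
    fun pq : ℕ × ℕ => supNorm k (F pq.1) * supNorm k (G pq.2)).le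

lemma tsum_sum_antidiagonal (u v : ℕ → ℝ≥0∞) :
    ∑' N, ∑ pq ∈ Finset.HasAntidiagonal.antidiagonal N, u pq.1 * v pq.2 =
      (∑' p, u p) * ∑' q, v q := by
  have h : ∀ N, ∑ pq ∈ Finset.HasAntidiagonal.antidiagonal N, u pq.1 * v pq.2 =
      ∑' pq : Finset.HasAntidiagonal.antidiagonal N, u pq.1.1 * v pq.1.2 := fun N => by
    rw [tsum_fintype]
    exact (Finset.sum_coe_sort (Finset.HasAntidiagonal.antidiagonal N)
      fun pq : ℕ × ℕ => u pq.1 * v pq.2).symm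
  simp only [h]
  rw [show ∑' N, ∑' pq : Finset.HasAntidiagonal.antidiagonal N, u pq.1.1 * v pq.1.2 =
    ∑' x : (N : ℕ) × Finset.HasAntidiagonal.antidiagonal N, u x.2.1.1 * v x.2.1.2 from
      (ENNReal.tsum_sigma' fun x : (N : ℕ) × Finset.HasAntidiagonal.antidiagonal N =>
        u x.2.1.1 * v x.2.1.2).symm]
  refine ((Finset.HasAntidiagonal.sigmaAntidiagonalEquivProd (A := ℕ)).tsum_eq
    fun pq : ℕ × ℕ => u pq.1 * v pq.2).trans ?_
  rw [ENNReal.tsum_prod']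
  simp only [ENNReal.tsum_mul_left, ENNReal.tsum_mul_right]

/-- As `C^(p+q) = C^p C^q`, the bounds on the components add up to the Cauchy product of the two
series; neither `k` nor `C` deteriorates. -/
lemma coNorm_wick_le {F G : Chaos 𝕂 d} (hF : ∀ n, ContDiff ℝ (⊤ : ℕ∞) (F n))
    (hG : ∀ n, ContDiff ℝ (⊤ : ℕ∞) (G n)) (k : ℕ) {C : ℝ} (hC : 0 < C) :
    coNorm k C (wick F G) ≤ coNorm k C F * coNorm k C G := by
  unfold coNorm
  rw [← tsum_sum_antidiagonal]
  refine ENNReal.tsum_le_tsum fun N => ?_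
  refine (mul_le_mul_right (supNorm_wick_le hF hG k N) _).trans ?_
  rw [Finset.mul_sum]
  refine Finset.sum_le_sum fun pq hpq => le_of_eq ?_
  rw [← Finset.HasAntidiagonal.mem_antidiagonal.1 hpq, pow_add,
    ENNReal.ofReal_mul (pow_nonneg hC.le _)]
  ring

lemma tensorFn_periodic (e : Fin p ⊕ Fin q ≃ Fin N)
    {f : (Fin p → ℝ) → EuclideanSpace 𝕂 (Fin p → Fin d)}
    {g : (Fin q → ℝ) → EuclideanSpace 𝕂 (Fin q → Fin d)}
    (hf : ∀ l, Function.Periodic f (Pi.single l 1)) (hg : ∀ l, Function.Periodic g (Pi.single l 1))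
    (l : Fin N) : Function.Periodic (tensorFn e f g) (Pi.single l 1) := by
  intro s
  obtain ⟨x, rfl⟩ := e.surjective l
  have h1 : (fun l => (s + Pi.single (e x) 1 : Fin N → ℝ) (e (Sum.inl l))) =
      (fun l => s (e (Sum.inl l))) + x.elim (fun i => Pi.single i 1) (fun _ => 0) := by
    rw [← single_comp_inl e x (1 : ℝ)]; rfl
  have h2 : (fun l => (s + Pi.single (e x) 1 : Fin N → ℝ) (e (Sum.inr l))) =
      (fun l => s (e (Sum.inr l))) + x.elim (fun _ => 0) (fun i => Pi.single i 1) := by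
    rw [← single_comp_inr e x (1 : ℝ)]; rfl
  unfold tensorFn
  rw [h1, h2]
  rcases x with i | j
  · simp only [Sum.elim_inl, add_zero, hf i _]
  · simp only [Sum.elim_inr, add_zero, hg j _]

lemma symTensor_perm (h : p + q = N) (f : (Fin p → ℝ) → EuclideanSpace 𝕂 (Fin p → Fin d))
    (g : (Fin q → ℝ) → EuclideanSpace 𝕂 (Fin q → Fin d)) (τ : Equiv.Perm (Fin N))
    (s : Fin N → ℝ) (I : Fin N → Fin d) :
    symTensor h f g (s ∘ τ) (I ∘ τ) = symTensor h f g s I := by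
  simp only [symTensor]
  congr 1
  exact Fintype.sum_equiv (Equiv.mulLeft τ) _ _ fun σ => rfl

lemma wick_mem {F G : Chaos 𝕂 d} (hF : F ∈ CO 𝕂 d) (hG : G ∈ CO 𝕂 d) : wick F G ∈ CO 𝕂 d := by
  refine ⟨contDiff_wick hF.1 hG.1, fun N l s => ?_, fun N τ s I => ?_, fun k C hC =>
    (coNorm_wick_le hF.1 hG.1 k hC).trans_lt
      (ENNReal.mul_lt_top (coNorm_lt_top hF k hC) (coNorm_lt_top hG k hC))⟩
  · simp only [wick, Finset.sum_apply, symTensor_eq, Pi.smul_apply,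
      tensorFn_periodic _ (hF.2.1 _) (hG.2.1 _) l s]
  · simp only [wick, Finset.sum_apply, WithLp.ofLp_sum, symTensor_perm]

lemma wick_add_left (F F' G : Chaos 𝕂 d) : wick (F + F') G = wick F G + wick F' G := by
  funext N s
  ext I
  simp [wick, symTensor, add_mul, mul_add, Finset.sum_add_distrib, WithLp.ofLp_sum]

lemma wick_add_right (F G G' : Chaos 𝕂 d) : wick F (G + G') = wick F G + wick F G' := by
  funext N s
  ext I
  simp [wick, symTensor, mul_add, Finset.sum_add_distrib, WithLp.ofLp_sum]

lemma wick_smul_left (c : 𝕂) (F G : Chaos 𝕂 d) : wick (c • F) G = c • wick F G := by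
  funext N s
  ext I
  simp [wick, symTensor, WithLp.ofLp_sum, Finset.mul_sum, mul_assoc, mul_left_comm]

lemma wick_smul_right (c : 𝕂) (F G : Chaos 𝕂 d) : wick F (c • G) = c • wick F G := by
  funext N s
  ext I
  simp [wick, symTensor, WithLp.ofLp_sum, Finset.mul_sum, mul_left_comm]

end Wick

/-! ### Convolution of functions on finite multisets -/

section Convolution

variable {X R : Type*} [CommSemiring R]

/-- The product of exponential generating functions in many variables. -/
def conv (f g : Multiset X → R) (m : Multiset X) : R :=
  (m.antidiagonal.map fun ab => f ab.1 * g ab.2).sum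

lemma conv_zero (f g : Multiset X → R) : conv f g 0 = f 0 * g 0 := by simp [conv]

/-- A splitting of `x ::ₘ m` puts `x` on one side or the other, so adding a letter is a derivation
for `conv`. Commutativity, associativity and the Leibniz rule for annihilation all rest on this. -/
lemma conv_cons (f g : Multiset X → R) (x : X) (m : Multiset X) : conv f g (x ::ₘ m) =
    conv f (fun m => g (x ::ₘ m)) m + conv (fun m => f (x ::ₘ m)) g m := by
  simp [conv]

lemma conv_add_left (f f' g : Multiset X → R) (m : Multiset X) :
    conv (fun m => f m + f' m) g m = conv f g m + conv f' g m := by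
  simp [conv, add_mul, Multiset.sum_map_add]

lemma conv_add_right (f g g' : Multiset X → R) (m : Multiset X) :
    conv f (fun m => g m + g' m) m = conv f g m + conv f g' m := by
  simp [conv, mul_add, Multiset.sum_map_add]

lemma conv_comm (f g : Multiset X → R) (m : Multiset X) : conv f g m = conv g f m := by
  induction m using Multiset.induction_on generalizing f g with
  | empty => simp only [conv_zero, mul_comm]
  | cons x m ih => rw [conv_cons, conv_cons, ih, ih _ g, add_comm]

lemma conv_assoc (f g h : Multiset X → R) (m : Multiset X) :
    conv (conv f g) h m = conv f (conv g h) m := by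
  induction m using Multiset.induction_on generalizing f g h with
  | empty => simp only [conv_zero, mul_assoc]
  | cons x m ih =>
    rw [conv_cons, conv_cons]
    simp only [conv_cons, conv_add_left, conv_add_right, ih]
    ring

/-- The antidiagonal of a multiset counts splittings with multiplicity, hence it ranges over sets of
positions even when `w` repeats letters. -/
lemma conv_map {ι : Type*} [DecidableEq ι] (f g : Multiset X → R) (w : ι → X) (U : Finset ι) :
    conv f g (U.val.map w) =
      ∑ A ∈ U.powerset, f (A.val.map w) * g ((U \ A).val.map w) := by
  induction U using Finset.induction_on generalizing f g with
  | empty => simp [conv_zero]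
  | insert x U hx ih =>
    rw [Finset.sum_powerset_insert hx, Finset.insert_val_of_notMem hx, Multiset.map_cons,
      conv_cons, ih, ih]
    congr 1
    · refine Finset.sum_congr rfl fun A hA => ?_
      have hxA : x ∉ A := fun h => hx (Finset.mem_powerset.1 hA h)
      rw [Finset.insert_sdiff_of_notMem _ hxA, Finset.insert_val_of_notMem (by simp [hx]),
        Multiset.map_cons]
    · refine Finset.sum_congr rfl fun A hA => ?_
      have hxA : x ∉ A := fun h => hx (Finset.mem_powerset.1 hA h)
      rw [Finset.insert_val_of_notMem hxA, Multiset.map_cons, Finset.insert_sdiff_insert,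
        Finset.sdiff_insert_of_notMem hx]

end Convolution

/-! ### Generating functions turn Wick products into convolutions -/

section Generating

variable {𝕂 : Type*} [RCLike 𝕂] {d : ℕ}

/-- Equal multisets of letters mean fibres of equal size over each letter; bijections of the fibres
glue to a permutation. -/
lemma exists_perm_of_map_univ_eq {X : Type*} {n : ℕ} {w w' : Fin n → X}
    (h : (Finset.univ : Finset (Fin n)).val.map w = (Finset.univ : Finset (Fin n)).val.map w') :
    ∃ σ : Equiv.Perm (Fin n), w' ∘ σ = w := by
  classical
  have hc : ∀ x, Nonempty ({i // w i = x} ≃ {i // w' i = x}) := fun x => by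
    refine ⟨Fintype.equivOfCardEq ?_⟩
    have h1 := congrArg (Multiset.count x) h
    rw [Multiset.count_map, Multiset.count_map] at h1
    rw [Fintype.card_subtype, Fintype.card_subtype]
    simpa [Finset.card, Finset.filter, eq_comm] using h1
  exact ⟨Equiv.ofFiberEquiv fun x => (hc x).some,
    funext fun i => Equiv.ofFiberEquiv_map (fun x => (hc x).some) i⟩

/-- The value of `F^n` at a word of length `n` in the letters `(s, i)`. -/
def wordEval (F : Chaos 𝕂 d) (n : ℕ) (w : Fin n → ℝ × Fin d) : 𝕂 :=
  F n (fun l => (w l).1) (fun l => (w l).2)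

/-- The sequence `F` as an exponential generating function. -/
def genFn (F : Chaos 𝕂 d) (m : Multiset (ℝ × Fin d)) : 𝕂 :=
  (m.card ! : 𝕂) * wordEval F m.card fun l => m.toList.get (l.cast m.length_toList.symm)

/-- In `genFn` the letters are read in the arbitrary order chosen by `Multiset.toList`; the symmetry
of `F` makes this order irrelevant. -/
lemma genFn_map {F : Chaos 𝕂 d} (hF : F ∈ CO 𝕂 d) {n : ℕ} (w : Fin n → ℝ × Fin d) :
    genFn F ((Finset.univ : Finset (Fin n)).val.map w) = (n ! : 𝕂) * wordEval F n w := by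
  generalize hm : (Finset.univ : Finset (Fin n)).val.map w = m
  obtain rfl : n = m.card := by rw [← hm]; simp
  have h : (Finset.univ : Finset (Fin m.card)).val.map
      (fun l => m.toList.get (l.cast m.length_toList.symm)) = m := by
    rw [Fin.univ_val_map]
    conv_rhs => rw [← Multiset.coe_toList m]
    congr 1
    refine List.ext_getElem (by simp) fun i h1 h2 => by simp
  obtain ⟨σ, hσ⟩ := exists_perm_of_map_univ_eq (h.trans hm.symm)
  unfold genFn
  rw [← hσ]
  congr 1
  exact hF.2.2.1 _ σ (fun l => (w l).1) (fun l => (w l).2)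

lemma eq_of_genFn_eq {F G : Chaos 𝕂 d} (hF : F ∈ CO 𝕂 d) (hG : G ∈ CO 𝕂 d)
    (h : ∀ m, genFn F m = genFn G m) : F = G := by
  funext n s
  ext I
  have h1 := h ((Finset.univ : Finset (Fin n)).val.map fun l => (s l, I l))
  rw [genFn_map hF, genFn_map hG] at h1
  exact mul_left_cancel₀ (Nat.cast_ne_zero.2 (Nat.factorial_ne_zero n)) h1

lemma genFn_add (F G : Chaos 𝕂 d) (m : Multiset (ℝ × Fin d)) :
    genFn (F + G) m = genFn F m + genFn G m := by
  simp [genFn, wordEval, mul_add]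

/-- The positions of the first `p` slots under a permutation. -/
def leftSlots {N : ℕ} (p : ℕ) (σ : Equiv.Perm (Fin N)) : Finset (Fin N) :=
  Finset.univ.filter fun x => (σ.symm x : ℕ) < p

/-- Such a permutation amounts to an ordering of `A` and an ordering of its complement. Inverses of
permutations are numberings of `Fin N`, and the condition says that `A` is numbered first. -/
lemma card_filter_leftSlots {p q N : ℕ} (h : p + q = N) {A : Finset (Fin N)}
    (hA : A.card = p) :
    (Finset.univ.filter fun σ : Equiv.Perm (Fin N) => leftSlots p σ = A).card = p ! * q ! := by
  have h1 := Numbering.card_prefixed A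
  rw [hA, Fintype.card_fin, show N - p = q by omega] at h1
  rw [← h1]
  refine Finset.card_bij (fun σ _ => σ.symm.trans (finCongr (Fintype.card_fin N).symm)) ?_ ?_ ?_
  · intro σ hσ
    rw [Finset.mem_filter] at hσ
    rw [Numbering.mem_prefixed]
    intro x
    rw [← hσ.2, hσ.2, hA, ← hσ.2]
    simp [leftSlots]
  · intro σ _ τ _ hστ
    have h2 := congrArg (fun e => (Equiv.trans e (finCongr (Fintype.card_fin N))).symm) hστ
    ext x
    have h3 := congrArg (fun e : Fin N ≃ Fin N => (e x : ℕ)) h2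
    simpa using h3
  · intro f hf
    rw [Numbering.mem_prefixed] at hf
    refine ⟨(f.trans (finCongr (Fintype.card_fin N))).symm, ?_, ?_⟩
    · simp only [Finset.mem_filter, Finset.mem_univ, true_and]
      ext x
      simp [leftSlots, hf x, hA]
    · ext x
      simp

lemma leftSlots_eq_map {p q N : ℕ} (h : p + q = N) (σ : Equiv.Perm (Fin N)) :
    leftSlots p σ = Finset.univ.map
      ⟨fun l : Fin p => splitEquiv h σ (Sum.inl l),
        (splitEquiv h σ).injective.comp Sum.inl_injective⟩ ∧
    Finset.univ \ leftSlots p σ = Finset.univ.map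
      ⟨fun l : Fin q => splitEquiv h σ (Sum.inr l),
        (splitEquiv h σ).injective.comp Sum.inr_injective⟩ := by
  have hl : ∀ l : Fin p, ((σ.symm (splitEquiv h σ (Sum.inl l)) : Fin N) : ℕ) = l := fun l => by
    simp [splitEquiv]
  have hr : ∀ l : Fin q, ((σ.symm (splitEquiv h σ (Sum.inr l)) : Fin N) : ℕ) = p + l := fun l => by
    simp [splitEquiv]
  constructor
  · ext x
    obtain ⟨y, rfl⟩ := (splitEquiv h σ).surjective x
    rcases y with l | l
    · simp [leftSlots, hl]
    · simp [leftSlots, hr]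
  · ext x
    obtain ⟨y, rfl⟩ := (splitEquiv h σ).surjective x
    rcases y with l | l
    · simp [leftSlots, hl]
    · simp [leftSlots, hr]

lemma sum_leftSlots {p q N : ℕ} (h : p + q = N) (u : Finset (Fin N) → 𝕂) :
    ∑ σ : Equiv.Perm (Fin N), u (leftSlots p σ) =
      (p ! : 𝕂) * q ! * ∑ A ∈ Finset.powersetCard p Finset.univ, u A := by
  rw [← Finset.sum_fiberwise_of_maps_to (t := Finset.powersetCard p Finset.univ)
    (g := leftSlots p) (fun σ _ => by
      rw [Finset.mem_powersetCard, (leftSlots_eq_map h σ).1]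
      simp), Finset.mul_sum]
  refine Finset.sum_congr rfl fun A hA => ?_
  rw [Finset.sum_congr rfl (g := fun _ => u A) fun σ hσ => by rw [(Finset.mem_filter.1 hσ).2],
    Finset.sum_const, card_filter_leftSlots h (Finset.mem_powersetCard.1 hA).2, nsmul_eq_mul]
  push_cast
  ring

/-- Group the permutations by the image `A` of the first `p` slots. Each `A` arises `p ! q !` times,
and these are the factorials in the generating functions of `F` and `G`; the `N !` of the left side
cancels the normalization of the symmetrization. -/
lemma genFn_wick {F G : Chaos 𝕂 d} (hF : F ∈ CO 𝕂 d) (hG : G ∈ CO 𝕂 d)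
    (m : Multiset (ℝ × Fin d)) : genFn (wick F G) m = conv (genFn F) (genFn G) m := by
  obtain ⟨N, w, rfl⟩ : ∃ (N : ℕ) (w : Fin N → ℝ × Fin d),
      m = (Finset.univ : Finset (Fin N)).val.map w := by
    refine ⟨m.toList.length, m.toList.get, ?_⟩
    rw [Fin.univ_val_map, List.ofFn_get, Multiset.coe_toList]
  rw [genFn_map (wick_mem hF hG), conv_map]
  set u : Finset (Fin N) → 𝕂 := fun A =>
    genFn F (A.val.map w) * genFn G ((Finset.univ \ A).val.map w) with hu
  have hfac : ∀ n : ℕ, (n ! : 𝕂) ≠ 0 := fun n => Nat.cast_ne_zero.2 (Nat.factorial_ne_zero n)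
  have hterm : ∀ (p q : ℕ) (h : p + q = N),
      (N ! : 𝕂) * symTensor h (F p) (G q) (fun l => (w l).1) (fun l => (w l).2) =
        ∑ A ∈ Finset.powersetCard p Finset.univ, u A := by
    intro p q h
    have h1 : ∀ σ : Equiv.Perm (Fin N), u (leftSlots p σ) = (p ! : 𝕂) * q ! *
        (wordEval F p (fun l => w (splitEquiv h σ (Sum.inl l))) *
          wordEval G q (fun l => w (splitEquiv h σ (Sum.inr l)))) := by
      intro σ
      simp only [hu]
      rw [(leftSlots_eq_map h σ).2, (leftSlots_eq_map h σ).1, Finset.map_val, Finset.map_val,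
        Multiset.map_map, Multiset.map_map]
      have e1 := genFn_map hF (fun l => w (splitEquiv h σ (Sum.inl l)))
      have e2 := genFn_map hG (fun l => w (splitEquiv h σ (Sum.inr l)))
      calc _ = _ := congrArg₂ (· * ·) e1 e2
        _ = _ := by ring
    have h2 := sum_leftSlots h u
    simp only [h1] at h2
    rw [← Finset.mul_sum] at h2
    rw [← mul_left_cancel₀ (mul_ne_zero (hfac p) (hfac q)) h2]
    simp only [symTensor]
    rw [← mul_assoc, mul_inv_cancel₀ (hfac N), one_mul]
    rfl
  -- Subsets of size `p` match the component of bidegree `(p, N - p)` of the Wick product.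
  rw [Finset.sum_powerset, Finset.card_univ, Fintype.card_fin,
    ← Finset.Nat.sum_antidiagonal_eq_sum_range_succ_mk
      (fun pq : ℕ × ℕ => ∑ A ∈ Finset.powersetCard pq.1 Finset.univ, u A) N]
  simp only [wordEval, wick, Finset.sum_apply, WithLp.ofLp_sum]
  rw [Finset.mul_sum, ← Finset.sum_coe_sort (Finset.HasAntidiagonal.antidiagonal N)]
  exact Finset.sum_congr rfl fun pq _ => hterm _ _ _

lemma wick_comm {F G : Chaos 𝕂 d} (hF : F ∈ CO 𝕂 d) (hG : G ∈ CO 𝕂 d) :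
    wick F G = wick G F :=
  eq_of_genFn_eq (wick_mem hF hG) (wick_mem hG hF) fun m => by
    rw [genFn_wick hF hG, genFn_wick hG hF, conv_comm]

lemma wick_assoc {F G H : Chaos 𝕂 d} (hF : F ∈ CO 𝕂 d) (hG : G ∈ CO 𝕂 d) (hH : H ∈ CO 𝕂 d) :
    wick F (wick G H) = wick (wick F G) H :=
  eq_of_genFn_eq (wick_mem hF (wick_mem hG hH)) (wick_mem (wick_mem hF hG) hH) fun m => by
    rw [genFn_wick hF (wick_mem hG hH), genFn_wick (wick_mem hF hG) hH,
      show genFn (wick G H) = _ from funext (genFn_wick hG hH),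
      show genFn (wick F G) = _ from funext (genFn_wick hF hG), conv_assoc]

end Generating

/-! ### Contraction with a basis vector -/

section Contraction

variable {𝕂 : Type*} [RCLike 𝕂] {d n : ℕ}

/-- The contraction of the first tensor factor with the basis vector `e_j`. -/
def contract (j : Fin d) :
    EuclideanSpace 𝕂 (Fin (n + 1) → Fin d) →L[ℝ] EuclideanSpace 𝕂 (Fin n → Fin d) :=
  LinearMap.mkContinuous
    { toFun := fun v => WithLp.toLp 2 fun I => v (Fin.cons j I : Fin (n + 1) → Fin d)
      map_add' := fun v w => by ext I; simp
      map_smul' := fun c v => by ext I; simp } 1 fun v => by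
    rw [one_mul, EuclideanSpace.norm_eq, EuclideanSpace.norm_eq]
    refine Real.sqrt_le_sqrt ?_
    have hinj : Function.Injective fun I : Fin n → Fin d => (Fin.cons j I : Fin (n + 1) → Fin d) :=
      Fin.cons_right_injective (α := fun _ => Fin d) j
    have h := Finset.sum_le_sum_of_subset_of_nonneg
      (f := fun I : Fin (n + 1) → Fin d => ‖v I‖ ^ 2)
      (Finset.subset_univ (Finset.univ.map ⟨_, hinj⟩)) fun _ _ _ => sq_nonneg _
    rw [Finset.sum_map] at h
    exact h

lemma norm_contract_le (j : Fin d) (v : EuclideanSpace 𝕂 (Fin (n + 1) → Fin d)) :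
    ‖contract j v‖ ≤ ‖v‖ := by
  have h := (contract (𝕂 := 𝕂) (n := n) j).le_of_opNorm_le
    (LinearMap.mkContinuous_norm_le _ zero_le_one _) v
  rwa [one_mul] at h

/-- The coordinates of an element of the tensor power, as a real linear map. -/
def coordProj {α : Type*} [Fintype α] (I : α) : EuclideanSpace 𝕂 α →L[ℝ] 𝕂 :=
  (EuclideanSpace.proj (𝕜 := 𝕂) I).restrictScalars ℝ

lemma coordProj_apply {α : Type*} [Fintype α] (I : α) (v : EuclideanSpace 𝕂 α) :
    coordProj I v = v I := rfl

lemma slotInt_apply {γ : ℝ → ℝ} (hγ : Continuous γ) (j : Fin d)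
    {F : (Fin (n + 1) → ℝ) → EuclideanSpace 𝕂 (Fin (n + 1) → Fin d)} (hF : Continuous F)
    (s : Fin n → ℝ) (I : Fin n → Fin d) : slotInt γ (contract j) F s I =
      ∫ t in (0 : ℝ)..1, γ t • F (Fin.cons t s : Fin (n + 1) → ℝ)
        (Fin.cons j I : Fin (n + 1) → Fin d) := by
  rw [← coordProj_apply, slotInt, ← ContinuousLinearMap.intervalIntegral_comp_comm _
    ((continuous_slot hγ (contract j) hF s).intervalIntegrable _ _)]
  simp only [map_smul]
  rfl

end Contraction

/-! ### Periodicity and the operator `1 - ∂²` -/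

section Periodic

variable {E : Type*} [NormedAddCommGroup E] [NormedSpace ℝ E] {n : ℕ}

lemma pderiv_periodic (l : Fin n) {f : (Fin n → ℝ) → E} {v : Fin n → ℝ}
    (hf : Function.Periodic f v) : Function.Periodic (pderiv l f) v := by
  intro s
  unfold pderiv
  rw [← fderiv_comp_add_right, show (fun x => f (x + v)) = f from funext hf]

lemma cons_add_single_succ (t : ℝ) (s : Fin n → ℝ) (l : Fin n) :
    (Fin.cons t (s + Pi.single l 1) : Fin (n + 1) → ℝ) = Fin.cons t s + Pi.single l.succ 1 := by
  funext x
  cases x using Fin.cases with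
  | zero => simp [Fin.succ_ne_zero, eq_comm]
  | succ x => simp [Pi.single_apply]

lemma cons_one_eq (s : Fin n → ℝ) :
    (Fin.cons 1 s : Fin (n + 1) → ℝ) = (Fin.cons 0 s : Fin (n + 1) → ℝ) + Pi.single 0 1 := by
  funext x
  cases x using Fin.cases with
  | zero => simp
  | succ x => simp [Fin.succ_ne_zero]

/-- The operator `1 - ∂²` in the first variable. -/
def oneSubSq (F : (Fin (n + 1) → ℝ) → E) : (Fin (n + 1) → ℝ) → E :=
  F + (-1 : ℝ) • pderiv 0 (pderiv 0 F)

lemma oneSubSq_contDiff {F : (Fin (n + 1) → ℝ) → E} (hF : ContDiff ℝ (⊤ : ℕ∞) F) :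
    ContDiff ℝ (⊤ : ℕ∞) (oneSubSq F) :=
  hF.add ((pderiv_contDiff _ (pderiv_contDiff _ hF)).const_smul (-1 : ℝ))

lemma oneSubSq_periodic {F : (Fin (n + 1) → ℝ) → E} {v : Fin (n + 1) → ℝ}
    (hF : Function.Periodic F v) : Function.Periodic (oneSubSq F) v := by
  intro s
  simp only [oneSubSq, Pi.add_apply, Pi.smul_apply, hF s,
    pderiv_periodic 0 (pderiv_periodic 0 hF) s]

lemma derivSup_oneSubSq_le (j : ℕ) (a : Fin n → ℕ) {F : (Fin (n + 1) → ℝ) → E}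
    (hF : ContDiff ℝ (⊤ : ℕ∞) F) : derivSup (Fin.cons j a : Fin (n + 1) → ℕ) (oneSubSq F) ≤
      derivSup (Fin.cons j a : Fin (n + 1) → ℕ) F +
        derivSup (Fin.cons (j + 2) a : Fin (n + 1) → ℕ) F := by
  have h2 := pderiv_contDiff 0 (pderiv_contDiff 0 hF)
  refine (derivSup_add_le _ hF (h2.const_smul (-1 : ℝ))).trans (add_le_add le_rfl ?_)
  refine (derivSup_smul_le (-1 : ℝ) _ h2).trans ?_
  rw [enorm_neg, enorm_one, one_mul, derivSup_pderiv _ _ (pderiv_contDiff 0 hF),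
    derivSup_pderiv _ _ hF]
  refine le_of_eq (congrArg (fun b => derivSup b F) ?_)
  funext x
  cases x using Fin.cases with
  | zero => simp [add_assoc]
  | succ x => simp [Fin.succ_ne_zero]

/-- Periodicity in the integrated variable, for `F` and for its first derivative, removes the
boundary terms. -/
lemma weight_smul_slotInt {E' : Type*} [NormedAddCommGroup E'] [NormedSpace ℝ E']
    [CompleteSpace E'] (k : ℤ) (P : E →L[ℝ] E') {F : (Fin (n + 1) → ℝ) → E}
    (hF : ContDiff ℝ (⊤ : ℕ∞) F) (hp : Function.Periodic F (Pi.single 0 1)) :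
    weight k • slotInt (trig k) P F = slotInt (trig k) P (oneSubSq F) := by
  funext s
  have hF1 := pderiv_contDiff 0 hF
  have hF2 := pderiv_contDiff 0 hF1
  have h := weight_smul_integral_trig k
    (u := fun t => P (F (Fin.cons t s : Fin (n + 1) → ℝ)))
    (u' := fun t => P (pderiv 0 F (Fin.cons t s : Fin (n + 1) → ℝ)))
    (u'' := fun t => P (pderiv 0 (pderiv 0 F) (Fin.cons t s : Fin (n + 1) → ℝ)))
    (fun t => P.hasFDerivAt.comp_hasDerivAt t (hasDerivAt_comp_cons hF t s))
    (fun t => P.hasFDerivAt.comp_hasDerivAt t (hasDerivAt_comp_cons hF1 t s))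
    (P.continuous.comp (hF2.continuous.comp (continuous_cons s)))
    (by simp only [cons_one_eq, hp _])
    (by simp only [cons_one_eq, pderiv_periodic 0 hp _])
  refine h.trans ?_
  simp only [slotInt, oneSubSq, Pi.add_apply, Pi.neg_apply, map_add, map_neg, neg_smul, one_smul,
    sub_eq_add_neg]

end Periodic

/-! ### Decay of the Fourier coefficients in one variable -/

section AnnihilationBound

variable {𝕂 : Type*} [RCLike 𝕂] {d n : ℕ}

lemma derivSup_slotInt_le {E E' : Type*} [NormedAddCommGroup E] [NormedSpace ℝ E]
    [NormedAddCommGroup E'] [NormedSpace ℝ E'] [CompleteSpace E'] (k : ℤ) {P : E →L[ℝ] E'}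
    (hP : ∀ v, ‖P v‖ ≤ ‖v‖) {F : (Fin (n + 1) → ℝ) → E}
    (hF : BoundedSmooth F) (a : Fin n → ℕ) :
    derivSup a (slotInt (trig k) P F) ≤
      2 * derivSup (Fin.cons 0 a : Fin (n + 1) → ℕ) F := by
  refine iSup_le fun s => ?_
  rw [(hF.mixedDeriv_slotInt (continuous_trig k) (abs_trig_le k) P a).2]
  refine (enorm_slotInt_le (abs_trig_le k) P _ hP s).trans (le_of_eq ?_)
  rw [ENNReal.ofReal_ofNat]
  rfl

lemma BoundedSmooth.oneSubSq {E : Type*} [NormedAddCommGroup E] [NormedSpace ℝ E]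
    {F : (Fin (n + 1) → ℝ) → E} (hF : BoundedSmooth F) : BoundedSmooth (oneSubSq F) where
  contDiff := oneSubSq_contDiff hF.contDiff
  bounded a := by
    rw [← Fin.cons_self_tail a]
    exact ne_top_of_le_ne_top (ENNReal.add_ne_top.2 ⟨hF.bounded _, hF.bounded _⟩)
      (derivSup_oneSubSq_le _ _ hF.contDiff)

/-- Two powers of the weight are needed: one compensates the weight produced by annihilation, and
the other makes the sum over frequencies converge. The four terms come from expanding `(1 - ∂²)²`,
and the factor `2` bounds `|trig k|`. -/
lemma derivSup_slotInt_decay {E E' : Type*} [NormedAddCommGroup E] [NormedSpace ℝ E]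
    [NormedAddCommGroup E'] [NormedSpace ℝ E'] [CompleteSpace E'] (k : ℤ) {P : E →L[ℝ] E'}
    (hP : ∀ v, ‖P v‖ ≤ ‖v‖) {F : (Fin (n + 1) → ℝ) → E}
    (hF : BoundedSmooth F) (hp : Function.Periodic F (Pi.single 0 1)) (a : Fin n → ℕ) :
    derivSup a (slotInt (trig k) P F) ≤ ENNReal.ofReal ((weight k)⁻¹ * (weight k)⁻¹) *
      (2 * ((derivSup (Fin.cons 0 a : Fin (n + 1) → ℕ) F +
        derivSup (Fin.cons 2 a : Fin (n + 1) → ℕ) F) +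
        (derivSup (Fin.cons 2 a : Fin (n + 1) → ℕ) F +
        derivSup (Fin.cons 4 a : Fin (n + 1) → ℕ) F))) := by
  have h1 := weight_smul_slotInt k P hF.contDiff hp
  have h2 := weight_smul_slotInt k P hF.oneSubSq.contDiff (oneSubSq_periodic hp)
  rw [← h1] at h2
  have hw := (weight_pos k).ne'
  have h3 : slotInt (trig k) P F = ((weight k)⁻¹ * (weight k)⁻¹) •
      slotInt (trig k) P (oneSubSq (oneSubSq F)) := by
    rw [← h2, smul_smul, smul_smul, show (weight k)⁻¹ * (weight k)⁻¹ * weight k * weight k = 1 by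
      field_simp, one_smul]
  rw [h3]
  refine (derivSup_smul_le _ a (hF.oneSubSq.oneSubSq.contDiff_slotInt (continuous_trig k)
    (abs_trig_le k) P)).trans ?_
  rw [Real.enorm_eq_ofReal (mul_nonneg (inv_nonneg.2 (weight_pos k).le)
    (inv_nonneg.2 (weight_pos k).le))]
  refine mul_le_mul_right ?_ _
  refine (derivSup_slotInt_le k hP hF.oneSubSq.oneSubSq a).trans (mul_le_mul_right ?_ _)
  refine (derivSup_oneSubSq_le 0 a hF.oneSubSq.contDiff).trans (add_le_add ?_ ?_)
  · exact derivSup_oneSubSq_le 0 a hF.contDiff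
  · exact derivSup_oneSubSq_le 2 a hF.contDiff

/-- Prefixing an entry at most `4` maps multi-indices bounded by `k` injectively to multi-indices
bounded by `k + 4`. -/
lemma sum_derivSup_cons_le (k : ℕ) (f : (Fin (n + 1) → ℝ) → EuclideanSpace 𝕂 (Fin (n + 1) → Fin d))
    {j : ℕ} (hj : j ≤ 4) : ∑ a : Fin n → Fin (k + 1),
      derivSup (Fin.cons j (fun l => (a l : ℕ)) : Fin (n + 1) → ℕ) f ≤ supNorm (k + 4) f := by
  rw [supNorm_eq_sum]
  let b : (Fin n → Fin (k + 1)) → Fin (n + 1) → Fin (k + 4 + 1) := fun a =>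
    Fin.cons ⟨j, by omega⟩ fun l => (a l).castLE (by omega)
  have hb : Function.Injective b := by
    intro a a' h
    have h1 := (Fin.cons_right_injective (α := fun _ : Fin (n + 1) => Fin (k + 4 + 1)) _) h
    funext l
    exact Fin.castLE_injective _ (congrFun h1 l)
  have h := Finset.sum_le_sum_of_subset_of_nonneg
    (f := fun a : Fin (n + 1) → Fin (k + 4 + 1) => derivSup (fun l => (a l : ℕ)) f)
    (Finset.subset_univ (Finset.univ.map ⟨b, hb⟩)) fun _ _ _ => zero_le
  rw [Finset.sum_map] at h
  refine le_trans (le_of_eq (Finset.sum_congr rfl fun a _ => ?_)) h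
  refine congrArg (fun c => derivSup c f) ?_
  funext x
  cases x using Fin.cases <;> rfl

lemma supNorm_slotInt_le (κ : ℤ) (j : Fin d)
    {F : (Fin (n + 1) → ℝ) → EuclideanSpace 𝕂 (Fin (n + 1) → Fin d)}
    (hF : BoundedSmooth F) (hp : Function.Periodic F (Pi.single 0 1)) (k : ℕ) :
    supNorm k (slotInt (trig κ) (contract j) F) ≤
      ENNReal.ofReal ((weight κ)⁻¹ * (weight κ)⁻¹) * (8 * supNorm (k + 4) F) := by
  rw [supNorm_eq_sum]
  refine (Finset.sum_le_sum fun a _ =>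
    derivSup_slotInt_decay κ (norm_contract_le j) hF hp _).trans ?_
  rw [← Finset.mul_sum, ← Finset.mul_sum, Finset.sum_add_distrib, Finset.sum_add_distrib,
    Finset.sum_add_distrib]
  refine mul_le_mul_right ?_ _
  have h0 := sum_derivSup_cons_le k F (j := 0) (by norm_num)
  have h2 := sum_derivSup_cons_le k F (j := 2) (by norm_num)
  have h4 := sum_derivSup_cons_le k F (j := 4) (by norm_num)
  -- The constant `8` is the bound `2` on `|trig κ|` times the four derivative terms.
  refine (mul_le_mul_right (add_le_add (add_le_add h0 h2) (add_le_add h2 h4)) _).trans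
    (le_of_eq ?_)
  ring

end AnnihilationBound

/-! ### The annihilation operators of the basis loops -/

section Annihilation

variable {𝕂 : Type*} [RCLike 𝕂] {d n : ℕ}

/-- The annihilation operator of the basis loop `γ_{j,κ}`. -/
abbrev ann (j : Fin d) (κ : ℤ) (F : Chaos 𝕂 d) : Chaos 𝕂 d := annih (basisLoop j κ) F

lemma single_eq_smul (j : Fin d) (c : ℝ) :
    EuclideanSpace.single j c = c • EuclideanSpace.single j (1 : ℝ) := by
  ext l
  simp [PiLp.single_apply]

lemma deriv_basisLoop (j : Fin d) (κ : ℤ) (t : ℝ) :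
    deriv (basisLoop j κ) t = EuclideanSpace.single j (deriv (trig κ) t) := by
  have h : basisLoop j κ = fun t => trig κ t • EuclideanSpace.single j (1 : ℝ) :=
    funext fun t => single_eq_smul j (trig κ t)
  rw [h, ((hasDerivAt_trig κ t).smul_const _).deriv, ← single_eq_smul]

/-- Inserting in slot `i` and inserting in the first slot differ by a cycle, which the symmetry of
`F` absorbs. -/
lemma apply_insertNth {F : Chaos 𝕂 d} (hF : F ∈ CO 𝕂 d) (i : Fin (n + 1)) (t : ℝ)
    (s : Fin n → ℝ) (j : Fin d) (I : Fin n → Fin d) :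
    F (n + 1) (i.insertNth t s) (i.insertNth j I) =
      F (n + 1) (Fin.cons t s : Fin (n + 1) → ℝ) (Fin.cons j I : Fin (n + 1) → Fin d) := by
  rw [← Fin.cons_comp_cycleRange t s i, ← Fin.cons_comp_cycleRange j I i]
  exact hF.2.2.1 (n + 1) i.cycleRange _ _

/-- The `n + 1` slots contribute equally by symmetry, and in each one `integral_trig_smul_add`
produces the weight. -/
lemma ann_apply {F : Chaos 𝕂 d} (hF : F ∈ CO 𝕂 d) (j : Fin d) (κ : ℤ) (n : ℕ) :
    ann j κ F n = ((((n : ℝ) + 1) * weight κ : ℝ) : 𝕂) •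
      slotInt (trig κ) (contract j) (F (n + 1)) := by
  funext s
  ext I
  rw [Pi.smul_apply, PiLp.smul_apply, slotInt_apply (continuous_trig κ) j (hF.1 _).continuous]
  simp only [annih, apply_insertNth hF]
  rw [Finset.sum_const, Finset.card_univ, Fintype.card_fin]
  have hu : ∀ t, HasDerivAt (fun t => F (n + 1) (Fin.cons t s : Fin (n + 1) → ℝ)
      (Fin.cons j I : Fin (n + 1) → Fin d)) (pderiv 0 (F (n + 1))
        (Fin.cons t s : Fin (n + 1) → ℝ) (Fin.cons j I : Fin (n + 1) → Fin d)) t := fun t =>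
    (coordProj (𝕂 := 𝕂) (Fin.cons j I : Fin (n + 1) → Fin d)).hasFDerivAt.comp_hasDerivAt t
      (hasDerivAt_comp_cons (hF.1 (n + 1)) t s)
  have h := integral_trig_smul_add κ hu
    ((coordProj (𝕂 := 𝕂) (Fin.cons j I : Fin (n + 1) → Fin d)).continuous.comp
      ((pderiv_contDiff 0 (hF.1 (n + 1))).continuous.comp (continuous_cons s)))
    (by simp only [cons_one_eq, hF.2.1 (n + 1) 0 _])
  have h2 : (∫ t in (0 : ℝ)..1, ∑ j' : Fin d,
      (F (n + 1) (Fin.cons t s : Fin (n + 1) → ℝ) (Fin.cons j' I : Fin (n + 1) → Fin d) *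
        ((basisLoop j κ t j' : ℝ) : 𝕂) +
      deriv (fun u : ℝ => F (n + 1) (Fin.cons u s : Fin (n + 1) → ℝ)
        (Fin.cons j' I : Fin (n + 1) → Fin d)) t * ((deriv (basisLoop j κ) t j' : ℝ) : 𝕂))) =
      weight κ • ∫ t in (0 : ℝ)..1, trig κ t • F (n + 1) (Fin.cons t s : Fin (n + 1) → ℝ)
        (Fin.cons j I : Fin (n + 1) → Fin d) := by
    rw [← h]
    refine intervalIntegral.integral_congr fun t _ => ?_
    simp only
    rw [Finset.sum_eq_single j]
    · rw [deriv_basisLoop, basisLoop, (hu t).deriv, PiLp.single_apply,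
        PiLp.single_apply, if_pos rfl, if_pos rfl, RCLike.real_smul_eq_coe_mul,
        RCLike.real_smul_eq_coe_mul]
      ring
    · intro j' _ hj'
      rw [deriv_basisLoop, basisLoop, PiLp.single_apply,
        PiLp.single_apply, if_neg hj', if_neg hj']
      simp
    · simp
  rw [h2, nsmul_eq_mul, RCLike.real_smul_eq_coe_mul, smul_eq_mul]
  push_cast
  ring

lemma cons_comp_perm {X : Type*} (x : X) (w : Fin n → X) (σ : Equiv.Perm (Fin n)) :
    (Fin.cons x (w ∘ σ) : Fin (n + 1) → X) =
      (Fin.cons x w : Fin (n + 1) → X) ∘ Equiv.Perm.decomposeFin.symm (0, σ) := by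
  funext l
  cases l using Fin.cases with
  | zero => simp
  | succ l => simp

/-- The number `n + 1` of slots is absorbed by `2^(n+1)`; the factor `C⁻¹` pays for the shift of
degree from `n` to `n + 1`. -/
lemma natCast_succ_mul_pow_le {C : ℝ} (hC : 0 < C) (n : ℕ) :
    ((n : ℝ) + 1) * C ^ n ≤ C⁻¹ * (2 * C) ^ (n + 1) := by
  have h : ((n : ℝ) + 1) ≤ 2 ^ (n + 1) := by
    have := (Nat.lt_two_pow_self (n := n + 1)).le
    exact_mod_cast this
  calc ((n : ℝ) + 1) * C ^ n ≤ 2 ^ (n + 1) * C ^ n :=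
        mul_le_mul_of_nonneg_right h (pow_nonneg hC.le _)
    _ = C⁻¹ * (2 * C) ^ (n + 1) := by
        rw [mul_pow, pow_succ C n]
        field_simp

lemma supNorm_ann_le {F : Chaos 𝕂 d} (hF : F ∈ CO 𝕂 d) (j : Fin d) (κ : ℤ) (k n : ℕ) :
    supNorm k (ann j κ F n) ≤ ENNReal.ofReal ((n : ℝ) + 1) *
      (ENNReal.ofReal (weight κ)⁻¹ * (8 * supNorm (k + 4) (F (n + 1)))) := by
  have hw := weight_pos κ
  have hn : 0 ≤ (n : ℝ) + 1 := by positivity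
  have hb := boundedSmooth_of_mem hF (n + 1)
  rw [ann_apply hF]
  refine (supNorm_smul_le k _ (hb.contDiff_slotInt (continuous_trig κ) (abs_trig_le κ) _)).trans ?_
  refine (mul_le_mul_right (supNorm_slotInt_le κ j hb (hF.2.1 _ 0) k) _).trans (le_of_eq ?_)
  have h1 : ‖((((n : ℝ) + 1) * weight κ : ℝ) : 𝕂)‖ₑ =
      ENNReal.ofReal ((n : ℝ) + 1) * ENNReal.ofReal (weight κ) := by
    rw [← ofReal_norm, RCLike.norm_ofReal, abs_of_nonneg (mul_nonneg hn hw.le),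
      ENNReal.ofReal_mul hn]
  rw [h1, mul_assoc, ← mul_assoc (ENNReal.ofReal (weight κ)), ← ENNReal.ofReal_mul hw.le,
    show weight κ * ((weight κ)⁻¹ * (weight κ)⁻¹) = (weight κ)⁻¹ by field_simp]

/-- The weight in `ann_apply` against the decay `weight⁻²` of the Fourier coefficient leaves one
power `weight⁻¹`. -/
lemma coNorm_ann_le {F : Chaos 𝕂 d} (hF : F ∈ CO 𝕂 d) (j : Fin d) (κ : ℤ) (k : ℕ) {C : ℝ}
    (hC : 0 < C) : coNorm k C (ann j κ F) ≤
      ENNReal.ofReal (weight κ)⁻¹ * (8 * ENNReal.ofReal C⁻¹ * coNorm (k + 4) (2 * C) F) := by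
  have h1 : ∑' n, ENNReal.ofReal ((2 * C) ^ (n + 1)) * supNorm (k + 4) (F (n + 1)) ≤
      coNorm (k + 4) (2 * C) F :=
    ENNReal.tsum_comp_le_tsum_of_injective Nat.succ_injective
      fun n => ENNReal.ofReal ((2 * C) ^ n) * supNorm (k + 4) (F n)
  refine le_trans ?_ (mul_le_mul_right (mul_le_mul_right h1 _) _)
  rw [← ENNReal.tsum_mul_left, ← ENNReal.tsum_mul_left]
  refine ENNReal.tsum_le_tsum fun n => ?_
  refine (mul_le_mul_right (supNorm_ann_le hF j κ k n) _).trans ?_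
  have h2 : ENNReal.ofReal (C ^ n) * ENNReal.ofReal ((n : ℝ) + 1) ≤
      ENNReal.ofReal C⁻¹ * ENNReal.ofReal ((2 * C) ^ (n + 1)) := by
    rw [← ENNReal.ofReal_mul (pow_nonneg hC.le _), ← ENNReal.ofReal_mul (inv_nonneg.2 hC.le)]
    refine ENNReal.ofReal_le_ofReal ?_
    rw [mul_comm]
    exact natCast_succ_mul_pow_le hC n
  calc ENNReal.ofReal (C ^ n) * (ENNReal.ofReal ((n : ℝ) + 1) *
        (ENNReal.ofReal (weight κ)⁻¹ * (8 * supNorm (k + 4) (F (n + 1)))))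
      = (ENNReal.ofReal (C ^ n) * ENNReal.ofReal ((n : ℝ) + 1)) *
        (ENNReal.ofReal (weight κ)⁻¹ * (8 * supNorm (k + 4) (F (n + 1)))) := by ring
    _ ≤ (ENNReal.ofReal C⁻¹ * ENNReal.ofReal ((2 * C) ^ (n + 1))) *
        (ENNReal.ofReal (weight κ)⁻¹ * (8 * supNorm (k + 4) (F (n + 1)))) := by gcongr
    _ = _ := by ring

lemma ann_mem {F : Chaos 𝕂 d} (hF : F ∈ CO 𝕂 d) (j : Fin d) (κ : ℤ) : ann j κ F ∈ CO 𝕂 d := by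
  refine ⟨fun n => ?_, fun n l s => ?_, fun n σ s I => ?_, fun k C hC => ?_⟩
  · have h := (boundedSmooth_of_mem hF (n + 1)).contDiff_slotInt (continuous_trig κ)
      (abs_trig_le κ) (contract (𝕂 := 𝕂) j)
    rw [ann_apply hF]
    exact h.const_smul ((((n : ℝ) + 1) * weight κ : ℝ) : 𝕂)
  · rw [ann_apply hF]
    simp only [Pi.smul_apply, slotInt, cons_add_single_succ, hF.2.1 (n + 1) l.succ _]
  · rw [ann_apply hF]
    simp only [Pi.smul_apply, PiLp.smul_apply]
    rw [slotInt_apply (continuous_trig κ) j (hF.1 _).continuous,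
      slotInt_apply (continuous_trig κ) j (hF.1 _).continuous]
    simp only [cons_comp_perm, hF.2.2.1 (n + 1)]
  · refine (coNorm_ann_le hF j κ k hC).trans_lt (ENNReal.mul_lt_top ENNReal.ofReal_lt_top
      (ENNReal.mul_lt_top (ENNReal.mul_lt_top (by norm_num) ENNReal.ofReal_lt_top)
        (coNorm_lt_top hF _ (by positivity))))

lemma ann_add {F G : Chaos 𝕂 d} (hF : F ∈ CO 𝕂 d) (hG : G ∈ CO 𝕂 d) (j : Fin d) (κ : ℤ) :
    ann j κ (F + G) = ann j κ F + ann j κ G := by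
  funext n
  rw [Pi.add_apply, ann_apply (add_mem hF hG), ann_apply hF, ann_apply hG, ← smul_add]
  congr 1
  funext s
  simp only [slotInt, Pi.add_apply, map_add, smul_add]
  exact intervalIntegral.integral_add
    ((continuous_slot (continuous_trig κ) _ (hF.1 _).continuous s).intervalIntegrable _ _)
    ((continuous_slot (continuous_trig κ) _ (hG.1 _).continuous s).intervalIntegrable _ _)

lemma ann_smul (c : 𝕂) {F : Chaos 𝕂 d} (hF : F ∈ CO 𝕂 d) (j : Fin d) (κ : ℤ) :
    ann j κ (c • F) = c • ann j κ F := by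
  funext n
  rw [Pi.smul_apply, ann_apply (Submodule.smul_mem _ c hF), ann_apply hF, smul_comm]
  congr 1
  funext s
  ext I
  change slotInt (trig κ) (contract j) ((c • F) (n + 1)) s I =
    c • slotInt (trig κ) (contract j) (F (n + 1)) s I
  rw [slotInt_apply (continuous_trig κ) j (hF.1 _).continuous,
    slotInt_apply (continuous_trig κ) j ((Submodule.smul_mem _ c hF).1 _).continuous,
    ← intervalIntegral.integral_smul]
  refine intervalIntegral.integral_congr fun t _ => ?_
  simp only [Pi.smul_apply, PiLp.smul_apply]
  rw [smul_comm]

lemma isBoundedLinear_ann (j : Fin d) (κ : ℤ) : IsBoundedLinear (𝕂 := 𝕂) (ann j κ) where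
  mem _ hF := ann_mem hF j κ
  add _ hF _ hG := ann_add hF hG j κ
  smul c _ hF := ann_smul c hF j κ
  bound k C hC := ⟨ENNReal.ofReal (weight κ)⁻¹ * (8 * ENNReal.ofReal C⁻¹), k + 4, 2 * C,
    ENNReal.mul_ne_top ENNReal.ofReal_ne_top (ENNReal.mul_ne_top (by norm_num)
      ENNReal.ofReal_ne_top), by positivity, fun F hF => by
      rw [mul_assoc]
      exact coNorm_ann_le hF j κ k hC⟩

end Annihilation

/-! ### Annihilation operators are commuting derivations of the Wick product -/

section Algebra

variable {𝕂 : Type*} [RCLike 𝕂] {d : ℕ}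

lemma exists_map_univ_eq {X : Type*} (m : Multiset X) : ∃ (n : ℕ) (w : Fin n → X),
    m = (Finset.univ : Finset (Fin n)).val.map w := by
  refine ⟨m.toList.length, m.toList.get, ?_⟩
  rw [Fin.univ_val_map, List.ofFn_get, Multiset.coe_toList]

lemma cons_map_univ {X : Type*} {n : ℕ} (x : X) (w : Fin n → X) :
    x ::ₘ (Finset.univ : Finset (Fin n)).val.map w =
      (Finset.univ : Finset (Fin (n + 1))).val.map (Fin.cons x w : Fin (n + 1) → X) := by
  rw [Fin.univ_val_map, Fin.univ_val_map, List.ofFn_succ]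
  simp

lemma comp_cons {X Y : Type*} {n : ℕ} (u : X → Y) (x : X) (w : Fin n → X) :
    (fun l => u ((Fin.cons x w : Fin (n + 1) → X) l)) =
      (Fin.cons (u x) fun l => u (w l) : Fin (n + 1) → Y) := by
  funext l
  cases l using Fin.cases <;> rfl

lemma wordEval_cons (F : Chaos 𝕂 d) {n : ℕ} (t : ℝ) (j : Fin d) (w : Fin n → ℝ × Fin d) :
    wordEval F (n + 1) (Fin.cons (t, j) w : Fin (n + 1) → ℝ × Fin d) =
      F (n + 1) (Fin.cons t fun l => (w l).1 : Fin (n + 1) → ℝ)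
        (Fin.cons j fun l => (w l).2 : Fin (n + 1) → Fin d) := by
  rw [wordEval, comp_cons Prod.fst, comp_cons Prod.snd]

lemma genFn_cons_map {F : Chaos 𝕂 d} (hF : F ∈ CO 𝕂 d) {n : ℕ} (t : ℝ) (j : Fin d)
    (w : Fin n → ℝ × Fin d) :
    genFn F ((t, j) ::ₘ (Finset.univ : Finset (Fin n)).val.map w) =
      ((n + 1) ! : 𝕂) * F (n + 1) (Fin.cons t fun l => (w l).1 : Fin (n + 1) → ℝ)
        (Fin.cons j fun l => (w l).2 : Fin (n + 1) → Fin d) := by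
  rw [cons_map_univ, genFn_map hF, wordEval_cons]

lemma continuous_genFn_cons {F : Chaos 𝕂 d} (hF : F ∈ CO 𝕂 d) (j : Fin d)
    (m : Multiset (ℝ × Fin d)) : Continuous fun t => genFn F ((t, j) ::ₘ m) := by
  obtain ⟨n, w, rfl⟩ := exists_map_univ_eq m
  simp only [genFn_cons_map hF]
  exact continuous_const.mul ((coordProj (𝕂 := 𝕂) _).continuous.comp
    ((hF.1 (n + 1)).continuous.comp (continuous_cons _)))

lemma continuous_genFn_cons_cons {F : Chaos 𝕂 d} (hF : F ∈ CO 𝕂 d) (j j' : Fin d)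
    (m : Multiset (ℝ × Fin d)) :
    Continuous fun x : ℝ × ℝ => genFn F ((x.1, j) ::ₘ (x.2, j') ::ₘ m) := by
  obtain ⟨n, w, rfl⟩ := exists_map_univ_eq m
  have h : ∀ x : ℝ × ℝ, genFn F ((x.1, j) ::ₘ (x.2, j') ::ₘ
      (Finset.univ : Finset (Fin n)).val.map w) = ((n + 2) ! : 𝕂) * F (n + 2)
        (Fin.cons x.1 (Fin.cons x.2 fun l => (w l).1 : Fin (n + 1) → ℝ) : Fin (n + 2) → ℝ)
        (Fin.cons j (Fin.cons j' fun l => (w l).2 : Fin (n + 1) → Fin d) :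
          Fin (n + 2) → Fin d) := by
    intro x
    rw [cons_map_univ (x.2, j') w, genFn_cons_map hF]
    rw [comp_cons Prod.fst, comp_cons Prod.snd]
  simp only [h]
  refine continuous_const.mul ((coordProj (𝕂 := 𝕂) _).continuous.comp
    ((hF.1 (n + 2)).continuous.comp ?_))
  exact Continuous.finCons continuous_fst (Continuous.finCons continuous_snd continuous_const)

/-- The factor `n + 1` of `ann_apply` disappears into `(n + 1)! = (n + 1) n!`. What remains is to
insert a letter and integrate it, the form in which Leibniz and Fubini apply. -/
lemma genFn_ann {F : Chaos 𝕂 d} (hF : F ∈ CO 𝕂 d) (j : Fin d) (κ : ℤ)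
    (m : Multiset (ℝ × Fin d)) : genFn (ann j κ F) m =
      (weight κ : 𝕂) * ∫ t in (0 : ℝ)..1, trig κ t • genFn F ((t, j) ::ₘ m) := by
  obtain ⟨n, w, rfl⟩ := exists_map_univ_eq m
  rw [genFn_map (ann_mem hF j κ), wordEval, ann_apply hF, Pi.smul_apply, PiLp.smul_apply,
    slotInt_apply (continuous_trig κ) j (hF.1 _).continuous]
  simp only [genFn_cons_map hF, ← mul_smul_comm]
  rw [intervalIntegral.integral_const_mul, smul_eq_mul, Nat.factorial_succ]
  push_cast
  ring

lemma integral_multiset_sum {Y : Type*} (M : Multiset Y) (u : Y → ℝ → 𝕂)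
    (hu : ∀ y, Continuous (u y)) : ∫ t in (0 : ℝ)..1, (M.map fun y => u y t).sum =
      (M.map fun y => ∫ t in (0 : ℝ)..1, u y t).sum := by
  have hc : ∀ M : Multiset Y, Continuous fun t => (M.map fun y => u y t).sum := fun M => by
    induction M using Multiset.induction_on with
    | empty => simpa using continuous_const
    | cons y M ih =>
      simp only [Multiset.map_cons, Multiset.sum_cons]
      exact (hu y).add ih
  induction M using Multiset.induction_on with
  | empty => simp
  | cons y M ih =>
    simp only [Multiset.map_cons, Multiset.sum_cons]
    rw [intervalIntegral.integral_add ((hu y).intervalIntegrable _ _)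
      ((hc M).intervalIntegrable _ _), ih]

lemma conv_genFn_ann_left {F G : Chaos 𝕂 d} (hF : F ∈ CO 𝕂 d) (j : Fin d) (κ : ℤ)
    (m : Multiset (ℝ × Fin d)) : conv (genFn (ann j κ F)) (genFn G) m = (weight κ : 𝕂) *
      ∫ t in (0 : ℝ)..1, trig κ t • conv (fun m => genFn F ((t, j) ::ₘ m)) (genFn G) m := by
  have h : ∀ t, trig κ t • conv (fun m => genFn F ((t, j) ::ₘ m)) (genFn G) m =
      (m.antidiagonal.map fun ab =>
        trig κ t • (genFn F ((t, j) ::ₘ ab.1) * genFn G ab.2)).sum := fun t => by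
    rw [conv, Multiset.smul_sum, Multiset.map_map]
    rfl
  simp only [h]
  rw [integral_multiset_sum m.antidiagonal (fun ab t =>
    trig κ t • (genFn F ((t, j) ::ₘ ab.1) * genFn G ab.2))
    fun ab => (continuous_trig κ).smul ((continuous_genFn_cons hF j ab.1).mul continuous_const),
    conv, ← Multiset.sum_map_mul_left]
  refine congrArg Multiset.sum (Multiset.map_congr rfl fun ab _ => ?_)
  simp only [genFn_ann hF, ← smul_mul_assoc]
  rw [intervalIntegral.integral_mul_const, mul_assoc]

lemma conv_genFn_ann_right {F G : Chaos 𝕂 d} (hG : G ∈ CO 𝕂 d) (j : Fin d) (κ : ℤ)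
    (m : Multiset (ℝ × Fin d)) : conv (genFn F) (genFn (ann j κ G)) m = (weight κ : 𝕂) *
      ∫ t in (0 : ℝ)..1, trig κ t • conv (genFn F) (fun m => genFn G ((t, j) ::ₘ m)) m := by
  rw [conv_comm, conv_genFn_ann_left hG]
  simp only [conv_comm (genFn F)]

lemma continuous_conv_cons {F : Chaos 𝕂 d} (hF : F ∈ CO 𝕂 d) (g : Multiset (ℝ × Fin d) → 𝕂)
    (j : Fin d) (m : Multiset (ℝ × Fin d)) :
    Continuous fun t => conv (fun m => genFn F ((t, j) ::ₘ m)) g m := by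
  unfold conv
  induction m.antidiagonal using Multiset.induction_on with
  | empty => simpa using continuous_const
  | cons y M ih =>
    simp only [Multiset.map_cons, Multiset.sum_cons]
    exact ((continuous_genFn_cons hF j y.1).mul continuous_const).add ih

/-- The Leibniz rule `conv_cons` for the inserted letter, integrated against `trig κ`. -/
lemma ann_wick {F G : Chaos 𝕂 d} (hF : F ∈ CO 𝕂 d) (hG : G ∈ CO 𝕂 d) (j : Fin d) (κ : ℤ) :
    ann j κ (wick F G) = wick (ann j κ F) G + wick F (ann j κ G) := by
  have h1 := wick_mem (ann_mem hF j κ) hG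
  have h2 := wick_mem hF (ann_mem hG j κ)
  refine eq_of_genFn_eq (ann_mem (wick_mem hF hG) j κ) (add_mem h1 h2) fun m => ?_
  rw [genFn_ann (wick_mem hF hG), genFn_add, genFn_wick (ann_mem hF j κ) hG,
    genFn_wick hF (ann_mem hG j κ), conv_genFn_ann_left hF, conv_genFn_ann_right hG, ← mul_add]
  congr 1
  rw [← intervalIntegral.integral_add
    (f := fun t => trig κ t • conv (fun m => genFn F ((t, j) ::ₘ m)) (genFn G) m)
    (g := fun t => trig κ t • conv (genFn F) (fun m => genFn G ((t, j) ::ₘ m)) m)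
    (((continuous_trig κ).smul (continuous_conv_cons hF _ j m)).intervalIntegrable _ _)]
  · refine intervalIntegral.integral_congr fun t _ => ?_
    simp only [genFn_wick hF hG, conv_cons, smul_add]
    exact add_comm _ _
  · simp only [conv_comm (genFn F)]
    exact ((continuous_trig κ).smul (continuous_conv_cons hG _ j m)).intervalIntegrable _ _

/-- Both sides integrate over two inserted letters; a multiset ignores their order and Fubini
exchanges the integrals. -/
lemma ann_comm {F : Chaos 𝕂 d} (hF : F ∈ CO 𝕂 d) (j j' : Fin d) (κ κ' : ℤ) :
    ann j κ (ann j' κ' F) = ann j' κ' (ann j κ F) := by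
  refine eq_of_genFn_eq (ann_mem (ann_mem hF j' κ') j κ) (ann_mem (ann_mem hF j κ) j' κ')
    fun m => ?_
  rw [genFn_ann (ann_mem hF j' κ'), genFn_ann (ann_mem hF j κ)]
  simp only [genFn_ann hF, ← mul_smul_comm]
  simp only [← intervalIntegral.integral_smul]
  rw [intervalIntegral.integral_const_mul, intervalIntegral.integral_const_mul,
    MeasureTheory.intervalIntegral_intervalIntegral_swap]
  · rw [mul_left_comm]
    congr 2
    refine intervalIntegral.integral_congr fun t _ => ?_
    refine intervalIntegral.integral_congr fun t' _ => ?_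
    rw [Multiset.cons_swap, smul_comm]
  · refine ContinuousOn.integrableOn_compact (isCompact_uIcc.prod isCompact_uIcc) ?_ |>.mono_set
      (Set.prod_mono Set.uIoc_subset_uIcc Set.uIoc_subset_uIcc)
    refine Continuous.continuousOn ?_
    have h := (continuous_genFn_cons_cons hF j' j m).comp continuous_swap
    exact ((continuous_trig κ).comp continuous_fst).smul
      (((continuous_trig κ').comp continuous_snd).smul h)

end Algebra

/-! ### The powers `P^r`: absolute convergence, continuity and recursion -/

section Moyal

variable {𝕂 : Type*} [RCLike 𝕂] {d : ℕ} (ω : Matrix (Fin d) (Fin d) ℝ)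

/-- The coefficients of the bracket at the frequency `κ`. -/
def bracketCoeff (𝕂 : Type*) [RCLike 𝕂] {d : ℕ} (ω : Matrix (Fin d) (Fin d) ℝ) (κ : ℤ)
    (i j : Fin d) : 𝕂 := ((weight κ * ω⁻¹ i j : ℝ) : 𝕂)

lemma moyalTerm_zero (k : Fin 0 → ℤ) (F G : Chaos 𝕂 d) : moyalTerm ω 0 k F G = wick F G := by
  simp [moyalTerm, iterAnnih]

/-- The operator with the last index is the innermost one, so it is the last frequency that can be
peeled off and applied directly to `F`. -/
lemma iterAnnih_snoc {r : ℕ} (i : Fin r → Fin d) (i₀ : Fin d) (k : Fin r → ℤ) (κ : ℤ)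
    (F : Chaos 𝕂 d) : iterAnnih (Fin.snoc i i₀ : Fin (r + 1) → Fin d)
      (Fin.snoc k κ : Fin (r + 1) → ℤ) F = iterAnnih i k (ann i₀ κ F) := by
  simp only [iterAnnih, List.finRange_succ_last, List.foldr_append, List.foldr_map,
    List.foldr_cons, List.foldr_nil, Fin.snoc_castSucc, Fin.snoc_last]

lemma sum_snoc {M : Type*} [AddCommMonoid M] {r : ℕ} (u : (Fin (r + 1) → Fin d) → M) :
    ∑ i, u i = ∑ i₀, ∑ i : Fin r → Fin d, u (Fin.snoc i i₀ : Fin (r + 1) → Fin d) := by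
  rw [← Fintype.sum_prod_type' (fun i₀ (i : Fin r → Fin d) =>
    u (Fin.snoc i i₀ : Fin (r + 1) → Fin d))]
  exact (Fintype.sum_equiv (Fin.snocEquiv fun _ : Fin (r + 1) => Fin d) _ _ fun _ => rfl).symm

lemma moyalTerm_snoc {r : ℕ} (k : Fin r → ℤ) (κ : ℤ) (F G : Chaos 𝕂 d) :
    moyalTerm ω (r + 1) (Fin.snoc k κ : Fin (r + 1) → ℤ) F G =
      ∑ i, ∑ j, bracketCoeff 𝕂 ω κ i j • moyalTerm ω r k (ann i κ F) (ann j κ G) := by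
  simp only [moyalTerm]
  rw [sum_snoc]
  refine Finset.sum_congr rfl fun i₀ _ => ?_
  -- The rest is a reordering of finite sums, the second tuple being split into `j` and `j₀` as the
  -- first was; the coefficients agree by splitting off the last factor of each product.
  simp only [Finset.smul_sum]
  rw [Finset.sum_comm]
  conv_rhs => rw [Finset.sum_comm]; arg 2; ext; rw [Finset.sum_comm]
  rw [Finset.sum_comm]
  refine Finset.sum_congr rfl fun i _ => ?_
  rw [sum_snoc, Finset.sum_comm]
  refine Finset.sum_congr rfl fun j _ => Finset.sum_congr rfl fun j₀ _ => ?_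
  rw [iterAnnih_snoc, iterAnnih_snoc, smul_smul]
  congr 1
  simp only [Fin.prod_univ_castSucc, Fin.snoc_castSucc, Fin.snoc_last, bracketCoeff, weight]
  push_cast
  ring

/-- Frequencies `k_1, …, k_{r+1}` are split into `k_{r+1}` and the others. -/
def freqEquiv (r : ℕ) : ℤ × (Fin r → ℤ) ≃ (Fin (r + 1) → ℤ) :=
  Fin.snocEquiv fun _ : Fin (r + 1) => ℤ

lemma moyalTerm_freqEquiv {r : ℕ} (x : ℤ × (Fin r → ℤ)) (F G : Chaos 𝕂 d) :
    moyalTerm ω (r + 1) (freqEquiv r x) F G =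
      ∑ i, ∑ j, bracketCoeff 𝕂 ω x.1 i j • moyalTerm ω r x.2 (ann i x.1 F) (ann j x.1 G) :=
  moyalTerm_snoc ω x.2 x.1 F G

lemma sum_sum_smul_mem {c : Fin d → Fin d → 𝕂} {H : Fin d → Fin d → Chaos 𝕂 d}
    (hH : ∀ i j, H i j ∈ CO 𝕂 d) : ∑ i, ∑ j, c i j • H i j ∈ CO 𝕂 d :=
  sum_mem fun i _ => sum_mem fun j _ => Submodule.smul_mem _ _ (hH i j)

lemma moyalTerm_mem {r : ℕ} (k : Fin r → ℤ) {F G : Chaos 𝕂 d} (hF : F ∈ CO 𝕂 d)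
    (hG : G ∈ CO 𝕂 d) : moyalTerm ω r k F G ∈ CO 𝕂 d := by
  induction r generalizing F G with
  | zero => rw [moyalTerm_zero]; exact wick_mem hF hG
  | succ r ih =>
    obtain ⟨x, rfl⟩ := (freqEquiv r).surjective k
    rw [moyalTerm_freqEquiv]
    exact sum_sum_smul_mem fun i j => ih _ (ann_mem hF _ _) (ann_mem hG _ _)

lemma moyalTerm_add_left {r : ℕ} (k : Fin r → ℤ) {F F' G : Chaos 𝕂 d} (hF : F ∈ CO 𝕂 d)
    (hF' : F' ∈ CO 𝕂 d) (hG : G ∈ CO 𝕂 d) :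
    moyalTerm ω r k (F + F') G = moyalTerm ω r k F G + moyalTerm ω r k F' G := by
  induction r generalizing F F' G with
  | zero => simp only [moyalTerm_zero, wick_add_left]
  | succ r ih =>
    obtain ⟨x, rfl⟩ := (freqEquiv r).surjective k
    simp only [moyalTerm_freqEquiv, ann_add hF hF',
      ih _ (ann_mem hF _ _) (ann_mem hF' _ _) (ann_mem hG _ _), smul_add, Finset.sum_add_distrib]

lemma moyalTerm_add_right {r : ℕ} (k : Fin r → ℤ) {F G G' : Chaos 𝕂 d} (hF : F ∈ CO 𝕂 d)
    (hG : G ∈ CO 𝕂 d) (hG' : G' ∈ CO 𝕂 d) :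
    moyalTerm ω r k F (G + G') = moyalTerm ω r k F G + moyalTerm ω r k F G' := by
  induction r generalizing F G G' with
  | zero => simp only [moyalTerm_zero, wick_add_right]
  | succ r ih =>
    obtain ⟨x, rfl⟩ := (freqEquiv r).surjective k
    simp only [moyalTerm_freqEquiv, ann_add hG hG',
      ih _ (ann_mem hF _ _) (ann_mem hG _ _) (ann_mem hG' _ _), smul_add, Finset.sum_add_distrib]

lemma moyalTerm_smul_left {r : ℕ} (k : Fin r → ℤ) (c : 𝕂) {F G : Chaos 𝕂 d} (hF : F ∈ CO 𝕂 d)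
    (hG : G ∈ CO 𝕂 d) : moyalTerm ω r k (c • F) G = c • moyalTerm ω r k F G := by
  induction r generalizing F G with
  | zero => simp only [moyalTerm_zero, wick_smul_left]
  | succ r ih =>
    obtain ⟨x, rfl⟩ := (freqEquiv r).surjective k
    simp only [moyalTerm_freqEquiv, ann_smul c hF, ih _ (ann_mem hF _ _) (ann_mem hG _ _),
      Finset.smul_sum, smul_comm c]

lemma moyalTerm_smul_right {r : ℕ} (k : Fin r → ℤ) (c : 𝕂) {F G : Chaos 𝕂 d} (hF : F ∈ CO 𝕂 d)
    (hG : G ∈ CO 𝕂 d) : moyalTerm ω r k F (c • G) = c • moyalTerm ω r k F G := by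
  induction r generalizing F G with
  | zero => simp only [moyalTerm_zero, wick_smul_right]
  | succ r ih =>
    obtain ⟨x, rfl⟩ := (freqEquiv r).surjective k
    simp only [moyalTerm_freqEquiv, ann_smul c hG, ih _ (ann_mem hF _ _) (ann_mem hG _ _),
      Finset.smul_sum, smul_comm c]

lemma tsum_inv_weight_ne_top : ∑' κ, ENNReal.ofReal (weight κ)⁻¹ ≠ ∞ := by
  -- At `κ = 0` the term `1 / κ²` is `0` by convention while the inverse weight is `1`; the
  -- `Pi.single` covers it.
  have h1 : Summable fun κ : ℤ => 1 / (κ : ℝ) ^ 2 + (Pi.single 0 1 : ℤ → ℝ) κ :=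
    (Real.summable_one_div_int_pow.2 one_lt_two).add (hasSum_pi_single 0 1).summable
  have h2 : Summable fun κ => (weight κ)⁻¹ := by
    refine Summable.of_nonneg_of_le (fun κ => inv_nonneg.2 (weight_pos κ).le) (fun κ => ?_) h1
    by_cases h : κ = 0
    · subst h
      simp [weight]
    · rw [Pi.single_eq_of_ne h, add_zero, ← one_div]
      have hκ : (0 : ℝ) < (κ : ℝ) ^ 2 := by positivity
      refine one_div_le_one_div_of_le hκ ?_
      have hpi : 1 ≤ Real.pi ^ 2 := by nlinarith [Real.pi_gt_three]
      unfold weight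
      nlinarith [mul_le_mul_of_nonneg_right hpi hκ.le]
  rw [← ENNReal.ofReal_tsum_of_nonneg (fun κ => inv_nonneg.2 (weight_pos κ).le) h2]
  exact ENNReal.ofReal_ne_top

lemma enorm_bracketCoeff (κ : ℤ) (i j : Fin d) :
    ‖bracketCoeff 𝕂 ω κ i j‖ₑ = ENNReal.ofReal (weight κ) * ‖ω⁻¹ i j‖ₑ := by
  rw [bracketCoeff, ← ofReal_norm, RCLike.norm_ofReal, abs_mul, ENNReal.ofReal_mul (abs_nonneg _),
    abs_of_pos (weight_pos κ), Real.enorm_eq_ofReal_abs]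

lemma coNorm_sum_sum_smul_le (k : ℕ) (C : ℝ) (c : Fin d → Fin d → 𝕂)
    {H : Fin d → Fin d → Chaos 𝕂 d} (hH : ∀ i j, H i j ∈ CO 𝕂 d) :
    coNorm k C (∑ i, ∑ j, c i j • H i j) ≤ ∑ i, ∑ j, ‖c i j‖ₑ * coNorm k C (H i j) := by
  refine (coNorm_sum_le k C _ fun i _ => sum_mem fun j _ =>
    Submodule.smul_mem _ _ (hH i j)).trans (Finset.sum_le_sum fun i _ => ?_)
  refine (coNorm_sum_le k C _ fun j _ => Submodule.smul_mem _ _ (hH i j)).trans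
    (Finset.sum_le_sum fun j _ => ?_)
  exact coNorm_smul_le k C _ (hH i j).1

/-- Induction on `r` by peeling off one frequency: its coefficient has size `weight` and each of the
two annihilations brings `weight⁻¹`, leaving a summable series. Each step adds `4` to `k₁`; only for
`r = 0`, where `k₁ = k`, may it vanish, hence the conditional positivity. -/
lemma tsum_coNorm_moyalTerm_le (r k : ℕ) {C : ℝ} (hC : 0 < C) :
    ∃ (K : ℝ≥0∞) (k₁ : ℕ) (C₁ : ℝ), K ≠ ∞ ∧ (0 < r → 0 < k₁) ∧ 0 < C₁ ∧
      ∀ F ∈ CO 𝕂 d, ∀ G ∈ CO 𝕂 d,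
      ∑' κ, coNorm k C (moyalTerm ω r κ F G) ≤ K * coNorm k₁ C₁ F * coNorm k₁ C₁ G := by
  induction r with
  | zero =>
    refine ⟨1, k, C, ENNReal.one_ne_top, fun h => absurd h (lt_irrefl 0), hC, fun F hF G hG => ?_⟩
    rw [tsum_eq_single (default : Fin 0 → ℤ) fun b hb => absurd (Subsingleton.elim _ _) hb,
      moyalTerm_zero, one_mul]
    exact coNorm_wick_le hF.1 hG.1 k hC
  | succ r ih =>
    obtain ⟨K, k₁, C₁, hK, -, hC₁, hb⟩ := ih
    set A : ℝ≥0∞ := 8 * ENNReal.ofReal C₁⁻¹ with hA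
    have hAt : A ≠ ∞ := ENNReal.mul_ne_top (by norm_num) ENNReal.ofReal_ne_top
    refine ⟨(∑' κ, ENNReal.ofReal (weight κ)⁻¹) * ((∑ i, ∑ j, ‖ω⁻¹ i j‖ₑ) * (K * A * A)),
      k₁ + 4, 2 * C₁, ENNReal.mul_ne_top tsum_inv_weight_ne_top (ENNReal.mul_ne_top
        (ENNReal.sum_ne_top.2 fun i _ => ENNReal.sum_ne_top.2 fun j _ => enorm_ne_top)
        (ENNReal.mul_ne_top (ENNReal.mul_ne_top hK hAt) hAt)), fun _ => by positivity,
      by positivity,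
      fun F hF G hG => ?_⟩
    rw [← (freqEquiv r).tsum_eq, ENNReal.tsum_prod', mul_assoc, mul_assoc,
      ← ENNReal.tsum_mul_right]
    refine ENNReal.tsum_le_tsum fun κ => ?_
    have hw : ENNReal.ofReal (weight κ) * ENNReal.ofReal (weight κ)⁻¹ = 1 := by
      rw [← ENNReal.ofReal_mul (weight_pos κ).le, mul_inv_cancel₀ (weight_pos κ).ne',
        ENNReal.ofReal_one]
    simp only [moyalTerm_freqEquiv]
    refine (ENNReal.tsum_le_tsum fun x => coNorm_sum_sum_smul_le k C _ fun i j =>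
      moyalTerm_mem ω x (ann_mem hF i κ) (ann_mem hG j κ)).trans ?_
    rw [Summable.tsum_finsetSum fun _ _ => ENNReal.summable]
    simp only [Summable.tsum_finsetSum fun _ _ => ENNReal.summable, ENNReal.tsum_mul_left]
    simp only [Finset.sum_mul, Finset.mul_sum]
    refine Finset.sum_le_sum fun i _ => Finset.sum_le_sum fun j _ => ?_
    have h1 := coNorm_ann_le hF i κ k₁ hC₁
    have h2 := coNorm_ann_le hG j κ k₁ hC₁
    rw [enorm_bracketCoeff]
    calc ENNReal.ofReal (weight κ) * ‖ω⁻¹ i j‖ₑ *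
          ∑' x, coNorm k C (moyalTerm ω r x (ann i κ F) (ann j κ G))
        ≤ ENNReal.ofReal (weight κ) * ‖ω⁻¹ i j‖ₑ *
          (K * (ENNReal.ofReal (weight κ)⁻¹ * (A * coNorm (k₁ + 4) (2 * C₁) F)) *
            (ENNReal.ofReal (weight κ)⁻¹ * (A * coNorm (k₁ + 4) (2 * C₁) G))) := by
          refine mul_le_mul_right ((hb _ (ann_mem hF i κ) _ (ann_mem hG j κ)).trans ?_) _
          gcongr
      _ = ENNReal.ofReal (weight κ) * ENNReal.ofReal (weight κ)⁻¹ *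
          (ENNReal.ofReal (weight κ)⁻¹ * (‖ω⁻¹ i j‖ₑ * (K * A * A) *
            (coNorm (k₁ + 4) (2 * C₁) F * coNorm (k₁ + 4) (2 * C₁) G))) := by ring
      _ = _ := by rw [hw, one_mul]

variable {ω}

lemma absSumCO_moyalTerm (r : ℕ) {F G : Chaos 𝕂 d} (hF : F ∈ CO 𝕂 d) (hG : G ∈ CO 𝕂 d) :
    AbsSumCO fun k => moyalTerm ω r k F G where
  mem k := moyalTerm_mem ω k hF hG
  summable k C hC := by
    obtain ⟨K, k₁, C₁, hK, -, hC₁, hb⟩ := tsum_coNorm_moyalTerm_le (𝕂 := 𝕂) ω r k hC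
    exact ne_top_of_le_ne_top (ENNReal.mul_ne_top (ENNReal.mul_ne_top hK
      (coNorm_lt_top hF _ hC₁).ne) (coNorm_lt_top hG _ hC₁).ne) (hb F hF G hG)

lemma hasSumCO_moyalPow (r : ℕ) {F G : Chaos 𝕂 d} (hF : F ∈ CO 𝕂 d) (hG : G ∈ CO 𝕂 d) :
    HasSumCO (fun k => moyalTerm ω r k F G) (moyalPow ω r F G) :=
  (absSumCO_moyalTerm r hF hG).hasSum

lemma moyalPow_mem (r : ℕ) {F G : Chaos 𝕂 d} (hF : F ∈ CO 𝕂 d) (hG : G ∈ CO 𝕂 d) :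
    moyalPow ω r F G ∈ CO 𝕂 d := (hasSumCO_moyalPow r hF hG).2.1

lemma coNorm_moyalPow_le (r k : ℕ) {C : ℝ} (hC : 0 < C) :
    ∃ (K : ℝ≥0∞) (k₁ : ℕ) (C₁ : ℝ), K ≠ ∞ ∧ (0 < r → 0 < k₁) ∧ 0 < C₁ ∧
      ∀ F ∈ CO 𝕂 d, ∀ G ∈ CO 𝕂 d,
      coNorm k C (moyalPow ω r F G) ≤ K * coNorm k₁ C₁ F * coNorm k₁ C₁ G := by
  obtain ⟨K, k₁, C₁, hK, hk₁, hC₁, hb⟩ := tsum_coNorm_moyalTerm_le (𝕂 := 𝕂) ω r k hC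
  exact ⟨K, k₁, C₁, hK, hk₁, hC₁, fun F hF G hG =>
    ((absSumCO_moyalTerm r hF hG).coNorm_tsum_le k C).trans (hb F hF G hG)⟩

lemma moyalPow_add_left (r : ℕ) {F F' G : Chaos 𝕂 d} (hF : F ∈ CO 𝕂 d)
    (hF' : F' ∈ CO 𝕂 d) (hG : G ∈ CO 𝕂 d) :
    moyalPow ω r (F + F') G = moyalPow ω r F G + moyalPow ω r F' G :=
  (hasSumCO_moyalPow r (add_mem hF hF') hG).unique
    (((hasSumCO_moyalPow r hF hG).add (hasSumCO_moyalPow r hF' hG)).congr_terms fun k =>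
      moyalTerm_add_left ω k hF hF' hG)

lemma moyalPow_add_right (r : ℕ) {F G G' : Chaos 𝕂 d} (hF : F ∈ CO 𝕂 d)
    (hG : G ∈ CO 𝕂 d) (hG' : G' ∈ CO 𝕂 d) :
    moyalPow ω r F (G + G') = moyalPow ω r F G + moyalPow ω r F G' :=
  (hasSumCO_moyalPow r hF (add_mem hG hG')).unique
    (((hasSumCO_moyalPow r hF hG).add (hasSumCO_moyalPow r hF hG')).congr_terms fun k =>
      moyalTerm_add_right ω k hF hG hG')

lemma moyalPow_smul_left (r : ℕ) (c : 𝕂) {F G : Chaos 𝕂 d} (hF : F ∈ CO 𝕂 d)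
    (hG : G ∈ CO 𝕂 d) : moyalPow ω r (c • F) G = c • moyalPow ω r F G :=
  (hasSumCO_moyalPow r (Submodule.smul_mem _ c hF) hG).unique
    (((hasSumCO_moyalPow r hF hG).map (isBoundedLinear_smul c)).congr_terms fun k =>
      moyalTerm_smul_left ω k c hF hG)

lemma moyalPow_smul_right (r : ℕ) (c : 𝕂) {F G : Chaos 𝕂 d} (hF : F ∈ CO 𝕂 d)
    (hG : G ∈ CO 𝕂 d) : moyalPow ω r F (c • G) = c • moyalPow ω r F G :=
  (hasSumCO_moyalPow r hF (Submodule.smul_mem _ c hG)).unique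
    (((hasSumCO_moyalPow r hF hG).map (isBoundedLinear_smul c)).congr_terms fun k =>
      moyalTerm_smul_right ω k c hF hG)

lemma isBoundedLinear_moyalPow_right (r : ℕ) {F : Chaos 𝕂 d} (hF : F ∈ CO 𝕂 d) :
    IsBoundedLinear fun G => moyalPow ω r F G where
  mem _ hG := moyalPow_mem r hF hG
  add _ hG _ hG' := moyalPow_add_right r hF hG hG'
  smul c _ hG := moyalPow_smul_right r c hF hG
  bound k C hC := by
    obtain ⟨K, k₁, C₁, hK, -, hC₁, hb⟩ := coNorm_moyalPow_le (𝕂 := 𝕂) (ω := ω) r k hC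
    exact ⟨K * coNorm k₁ C₁ F, k₁, C₁, ENNReal.mul_ne_top hK (coNorm_lt_top hF _ hC₁).ne, hC₁,
      fun G hG => hb F hF G hG⟩

lemma isBoundedLinear_moyalPow_left (r : ℕ) {G : Chaos 𝕂 d} (hG : G ∈ CO 𝕂 d) :
    IsBoundedLinear fun F => moyalPow ω r F G where
  mem _ hF := moyalPow_mem r hF hG
  add _ hF _ hF' := moyalPow_add_left r hF hF' hG
  smul c _ hF := moyalPow_smul_left r c hF hG
  bound k C hC := by
    obtain ⟨K, k₁, C₁, hK, -, hC₁, hb⟩ := coNorm_moyalPow_le (𝕂 := 𝕂) (ω := ω) r k hC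
    exact ⟨K * coNorm k₁ C₁ G, k₁, C₁, ENNReal.mul_ne_top hK (coNorm_lt_top hG _ hC₁).ne, hC₁,
      fun F hF => (hb F hF G hG).trans (le_of_eq (by ring))⟩

lemma moyalPow_zero (F G : Chaos 𝕂 d) : moyalPow ω 0 F G = wick F G := by
  funext n s
  unfold moyalPow
  rw [tsum_eq_single (default : Fin 0 → ℤ) fun b hb => absurd (Subsingleton.elim _ _) hb,
    moyalTerm_zero]

lemma HasSumCO.sum_sum_smul {ι : Type*} (c : Fin d → Fin d → 𝕂)
    {f : Fin d → Fin d → ι → Chaos 𝕂 d} {F : Fin d → Fin d → Chaos 𝕂 d}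
    (h : ∀ i j, HasSumCO (f i j) (F i j)) :
    HasSumCO (fun x => ∑ i, ∑ j, c i j • f i j x) (∑ i, ∑ j, c i j • F i j) :=
  HasSumCO.sum fun i _ => HasSumCO.sum fun j _ => (h i j).map (isBoundedLinear_smul (c i j))

/-- The absolutely convergent multiple series is grouped by its last frequency. All later inductions
on `r` go through this recursion. -/
lemma hasSumCO_moyalPow_succ (r : ℕ) {F G : Chaos 𝕂 d} (hF : F ∈ CO 𝕂 d) (hG : G ∈ CO 𝕂 d) :
    HasSumCO (fun κ => ∑ i, ∑ j, bracketCoeff 𝕂 ω κ i j • moyalPow ω r (ann i κ F) (ann j κ G))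
      (moyalPow ω (r + 1) F G) := by
  have h := ((absSumCO_moyalTerm (ω := ω) (r + 1) hF hG).comp_injective
    (freqEquiv r).injective).prod
  have h1 : tsumCO ((fun k => moyalTerm ω (r + 1) k F G) ∘ freqEquiv r) =
      moyalPow ω (r + 1) F G := by
    funext n s
    exact (freqEquiv r).tsum_eq fun k => moyalTerm ω (r + 1) k F G n s
  rw [← h1, ← h.2]
  refine h.1.hasSum.congr_terms fun κ => ?_
  have h2 := HasSumCO.sum_sum_smul (bracketCoeff 𝕂 ω κ) fun i j =>
    hasSumCO_moyalPow (ω := ω) r (ann_mem hF i κ) (ann_mem hG j κ)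
  rw [← h2.tsum_eq]
  simp only [Function.comp_apply, moyalTerm_freqEquiv]

lemma IsBoundedLinear.sum_sum_smul {T : Chaos 𝕂 d → Chaos 𝕂 d} (hT : IsBoundedLinear T)
    (c : Fin d → Fin d → 𝕂) {H : Fin d → Fin d → Chaos 𝕂 d} (hH : ∀ i j, H i j ∈ CO 𝕂 d) :
    T (∑ i, ∑ j, c i j • H i j) = ∑ i, ∑ j, c i j • T (H i j) := by
  rw [hT.sum _ fun i _ => sum_mem fun j _ => Submodule.smul_mem _ _ (hH i j)]
  refine Finset.sum_congr rfl fun i _ => ?_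
  rw [hT.sum _ fun j _ => Submodule.smul_mem _ _ (hH i j)]
  exact Finset.sum_congr rfl fun j _ => hT.smul _ _ (hH i j)

/-- Induction on `r` from the Leibniz rule for the Wick product: a continuous operator passes
through the series, and annihilation operators commute with those inside `P^r`. -/
lemma ann_moyalPow (r : ℕ) {F G : Chaos 𝕂 d} (hF : F ∈ CO 𝕂 d) (hG : G ∈ CO 𝕂 d) (l : Fin d)
    (μ : ℤ) : ann l μ (moyalPow ω r F G) =
      moyalPow ω r (ann l μ F) G + moyalPow ω r F (ann l μ G) := by
  induction r generalizing F G with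
  | zero => simp only [moyalPow_zero, ann_wick hF hG]
  | succ r ih =>
    refine ((hasSumCO_moyalPow_succ r hF hG).map (isBoundedLinear_ann l μ)).unique
      (((hasSumCO_moyalPow_succ r (ann_mem hF l μ) hG).add
        (hasSumCO_moyalPow_succ r hF (ann_mem hG l μ))).congr_terms fun κ => ?_)
    rw [(isBoundedLinear_ann l μ).sum_sum_smul _ fun i j =>
      moyalPow_mem r (ann_mem hF i κ) (ann_mem hG j κ)]
    simp only [ih (ann_mem hF _ _) (ann_mem hG _ _), smul_add, Finset.sum_add_distrib,
      ann_comm hF l _ μ κ, ann_comm hG l _ μ κ]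

end Moyal

/-! ### Associativity by a common recursion for both bracketings -/

section Associativity

variable {𝕂 : Type*} [RCLike 𝕂] {d : ℕ} {ω : Matrix (Fin d) (Fin d) ℝ}

/-- The sum of `u r q / (r! q!)` over `r + q = m`. -/
def expSum {V : Type*} [AddCommMonoid V] [Module 𝕂 V] (m : ℕ) (u : ℕ → ℕ → V) : V :=
  ∑ rq ∈ Finset.HasAntidiagonal.antidiagonal m, ((rq.1 ! : 𝕂)⁻¹ * (rq.2 ! : 𝕂)⁻¹) • u rq.1 rq.2

/-- Each term has `m + 1 = r + q`, and `r / r!` is `1 / (r - 1)!`; this is the derivative of a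
product of two exponential series. -/
lemma succ_smul_expSum {V : Type*} [AddCommMonoid V] [Module 𝕂 V] (m : ℕ) (u : ℕ → ℕ → V) :
    ((m : 𝕂) + 1) • expSum (𝕂 := 𝕂) (m + 1) u =
      expSum (𝕂 := 𝕂) m (fun r q => u (r + 1) q) + expSum (𝕂 := 𝕂) m (fun r q => u r (q + 1)) := by
  have hfac : ∀ n : ℕ, ((n : 𝕂) + 1) * ((n + 1) ! : 𝕂)⁻¹ = (n ! : 𝕂)⁻¹ := fun n => by
    have h1 : (n : 𝕂) + 1 ≠ 0 := by exact_mod_cast Nat.succ_ne_zero n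
    rw [Nat.factorial_succ]
    push_cast
    rw [mul_inv, ← mul_assoc, mul_inv_cancel₀ h1, one_mul]
  have h : ((m : 𝕂) + 1) • expSum (𝕂 := 𝕂) (m + 1) u =
      (∑ rq ∈ Finset.HasAntidiagonal.antidiagonal (m + 1),
        ((rq.1 : 𝕂) * ((rq.1 ! : 𝕂)⁻¹ * (rq.2 ! : 𝕂)⁻¹)) • u rq.1 rq.2) +
      ∑ rq ∈ Finset.HasAntidiagonal.antidiagonal (m + 1),
        ((rq.2 : 𝕂) * ((rq.1 ! : 𝕂)⁻¹ * (rq.2 ! : 𝕂)⁻¹)) • u rq.1 rq.2 := by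
    rw [expSum, Finset.smul_sum, ← Finset.sum_add_distrib]
    refine Finset.sum_congr rfl fun rq hrq => ?_
    rw [smul_smul, ← add_smul, ← add_mul]
    congr 2
    exact_mod_cast (Finset.HasAntidiagonal.mem_antidiagonal.1 hrq).symm
  rw [h, Finset.Nat.sum_antidiagonal_succ, Finset.Nat.sum_antidiagonal_succ']
  simp only [Nat.cast_zero, zero_mul, zero_smul, zero_add, expSum]
  congr 1
  · refine Finset.sum_congr rfl fun rq _ => ?_
    rw [← mul_assoc, Nat.cast_succ, hfac]
  · refine Finset.sum_congr rfl fun rq _ => ?_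
    rw [mul_left_comm, Nat.cast_succ, hfac]

lemma HasSumCO.expSum {ι : Type*} (m : ℕ) {f : ℕ → ℕ → ι → Chaos 𝕂 d} {F : ℕ → ℕ → Chaos 𝕂 d}
    (h : ∀ r q, HasSumCO (f r q) (F r q)) :
    HasSumCO (fun x => expSum (𝕂 := 𝕂) m fun r q => f r q x) (expSum (𝕂 := 𝕂) m F) :=
  HasSumCO.sum fun rq _ => (h rq.1 rq.2).map (isBoundedLinear_smul _)

lemma expSum_add {V : Type*} [AddCommMonoid V] [Module 𝕂 V] (m : ℕ) (u v : ℕ → ℕ → V) :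
    expSum (𝕂 := 𝕂) m (fun r q => u r q + v r q) =
      expSum (𝕂 := 𝕂) m u + expSum (𝕂 := 𝕂) m v := by
  simp only [expSum, smul_add, Finset.sum_add_distrib]

lemma expSum_sum_sum_smul {V : Type*} [AddCommMonoid V] [Module 𝕂 V] (m : ℕ)
    (c : Fin d → Fin d → 𝕂) (u : Fin d → Fin d → ℕ → ℕ → V) :
    expSum (𝕂 := 𝕂) m (fun r q => ∑ i, ∑ j, c i j • u i j r q) =
      ∑ i, ∑ j, c i j • expSum (𝕂 := 𝕂) m (u i j) := by
  simp only [expSum, Finset.smul_sum]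
  rw [Finset.sum_comm]
  refine Finset.sum_congr rfl fun i _ => ?_
  rw [Finset.sum_comm]
  exact Finset.sum_congr rfl fun j _ => Finset.sum_congr rfl fun rq _ => smul_comm _ _ _

variable (ω) in
/-- The coefficient of `ħ^m` in `F₁ ⋆ (F₂ ⋆ F₃)`. -/
def assocRight (m : ℕ) (F₁ F₂ F₃ : Chaos 𝕂 d) : Chaos 𝕂 d :=
  expSum (𝕂 := 𝕂) m fun r q => moyalPow ω r F₁ (moyalPow ω q F₂ F₃)

variable (ω) in
/-- The coefficient of `ħ^m` in `(F₁ ⋆ F₂) ⋆ F₃`. -/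
def assocLeft (m : ℕ) (F₁ F₂ F₃ : Chaos 𝕂 d) : Chaos 𝕂 d :=
  expSum (𝕂 := 𝕂) m fun r q => moyalPow ω r (moyalPow ω q F₁ F₂) F₃

variable {F₁ F₂ F₃ : Chaos 𝕂 d}

/-- A bracket taken from the outer `P^r` acts on factor 1 and, by the derivation property, on factor
2 or 3; one taken from the inner `P^q` acts on factors 2 and 3. -/
lemma hasSumCO_assocRight (m : ℕ) (h₁ : F₁ ∈ CO 𝕂 d) (h₂ : F₂ ∈ CO 𝕂 d) (h₃ : F₃ ∈ CO 𝕂 d) :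
    HasSumCO (fun κ => ∑ i, ∑ j, bracketCoeff 𝕂 ω κ i j •
      (assocRight ω m (ann i κ F₁) (ann j κ F₂) F₃ + assocRight ω m (ann i κ F₁) F₂ (ann j κ F₃) +
        assocRight ω m F₁ (ann i κ F₂) (ann j κ F₃)))
      (((m : 𝕂) + 1) • assocRight ω (m + 1) F₁ F₂ F₃) := by
  have hA := HasSumCO.expSum m fun r q =>
    hasSumCO_moyalPow_succ (ω := ω) r h₁ (moyalPow_mem (ω := ω) q h₂ h₃)
  have hB := HasSumCO.expSum m fun r q =>
    (hasSumCO_moyalPow_succ (ω := ω) q h₂ h₃).map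
      (isBoundedLinear_moyalPow_right (ω := ω) r h₁)
  have h := hA.add hB
  rw [← succ_smul_expSum m fun r q => moyalPow ω r F₁ (moyalPow ω q F₂ F₃)] at h
  refine h.congr_terms fun κ => ?_
  have e1 : ∀ r q i j, moyalPow ω r (ann i κ F₁) (ann j κ (moyalPow ω q F₂ F₃)) =
      moyalPow ω r (ann i κ F₁) (moyalPow ω q (ann j κ F₂) F₃) +
        moyalPow ω r (ann i κ F₁) (moyalPow ω q F₂ (ann j κ F₃)) := fun r q i j => by
    rw [ann_moyalPow q h₂ h₃, moyalPow_add_right r (ann_mem h₁ _ _)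
      (moyalPow_mem q (ann_mem h₂ _ _) h₃) (moyalPow_mem q h₂ (ann_mem h₃ _ _))]
  have e2 : ∀ r q, moyalPow ω r F₁ (∑ i, ∑ j, bracketCoeff 𝕂 ω κ i j •
      moyalPow ω q (ann i κ F₂) (ann j κ F₃)) = ∑ i, ∑ j, bracketCoeff 𝕂 ω κ i j •
        moyalPow ω r F₁ (moyalPow ω q (ann i κ F₂) (ann j κ F₃)) := fun r q =>
    (isBoundedLinear_moyalPow_right (ω := ω) r h₁).sum_sum_smul _ fun i j =>
      moyalPow_mem q (ann_mem h₂ _ _) (ann_mem h₃ _ _)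
  simp only [e1, e2]
  rw [expSum_sum_sum_smul m (bracketCoeff 𝕂 ω κ), expSum_sum_sum_smul m (bracketCoeff 𝕂 ω κ),
    ← Finset.sum_add_distrib]
  simp only [← Finset.sum_add_distrib, ← smul_add, expSum_add]
  rfl

/-- Now the outer bracket yields the pairs (1,3) and (2,3), and the inner one yields (1,2). The
series obtained has the same shape as for the other bracketing. -/
lemma hasSumCO_assocLeft (m : ℕ) (h₁ : F₁ ∈ CO 𝕂 d) (h₂ : F₂ ∈ CO 𝕂 d) (h₃ : F₃ ∈ CO 𝕂 d) :
    HasSumCO (fun κ => ∑ i, ∑ j, bracketCoeff 𝕂 ω κ i j •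
      (assocLeft ω m (ann i κ F₁) (ann j κ F₂) F₃ + assocLeft ω m (ann i κ F₁) F₂ (ann j κ F₃) +
        assocLeft ω m F₁ (ann i κ F₂) (ann j κ F₃)))
      (((m : 𝕂) + 1) • assocLeft ω (m + 1) F₁ F₂ F₃) := by
  have hA := HasSumCO.expSum m fun r q =>
    hasSumCO_moyalPow_succ (ω := ω) r (moyalPow_mem (ω := ω) q h₁ h₂) h₃
  have hB := HasSumCO.expSum m fun r q =>
    (hasSumCO_moyalPow_succ (ω := ω) q h₁ h₂).map
      (isBoundedLinear_moyalPow_left (ω := ω) r h₃)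
  have h := hA.add hB
  rw [← succ_smul_expSum m fun r q => moyalPow ω r (moyalPow ω q F₁ F₂) F₃] at h
  refine h.congr_terms fun κ => ?_
  have e1 : ∀ r q i j, moyalPow ω r (ann i κ (moyalPow ω q F₁ F₂)) (ann j κ F₃) =
      moyalPow ω r (moyalPow ω q (ann i κ F₁) F₂) (ann j κ F₃) +
        moyalPow ω r (moyalPow ω q F₁ (ann i κ F₂)) (ann j κ F₃) := fun r q i j => by
    rw [ann_moyalPow q h₁ h₂, moyalPow_add_left r (moyalPow_mem q (ann_mem h₁ _ _) h₂)
      (moyalPow_mem q h₁ (ann_mem h₂ _ _)) (ann_mem h₃ _ _)]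
  have e2 : ∀ r q, moyalPow ω r (∑ i, ∑ j, bracketCoeff 𝕂 ω κ i j •
      moyalPow ω q (ann i κ F₁) (ann j κ F₂)) F₃ = ∑ i, ∑ j, bracketCoeff 𝕂 ω κ i j •
        moyalPow ω r (moyalPow ω q (ann i κ F₁) (ann j κ F₂)) F₃ := fun r q =>
    (isBoundedLinear_moyalPow_left (ω := ω) r h₃).sum_sum_smul _ fun i j =>
      moyalPow_mem q (ann_mem h₁ _ _) (ann_mem h₂ _ _)
  simp only [e1, e2]
  rw [expSum_sum_sum_smul m (bracketCoeff 𝕂 ω κ), expSum_sum_sum_smul m (bracketCoeff 𝕂 ω κ),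
    ← Finset.sum_add_distrib]
  simp only [← Finset.sum_add_distrib, ← smul_add, expSum_add]
  refine Finset.sum_congr rfl fun i _ => Finset.sum_congr rfl fun j _ => ?_
  -- The pair (1,2) arises last here and is moved to the front to match `hasSumCO_assocRight`.
  rw [add_assoc, add_comm (assocLeft ω m (ann i κ F₁) (ann j κ F₂) F₃)]
  rfl

/-- The two recursions coincide, so induction on `m`, for all triples at once, reduces the claim to
associativity of the Wick product. -/
lemma assocRight_eq_assocLeft (m : ℕ) (h₁ : F₁ ∈ CO 𝕂 d) (h₂ : F₂ ∈ CO 𝕂 d)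
    (h₃ : F₃ ∈ CO 𝕂 d) : assocRight ω m F₁ F₂ F₃ = assocLeft ω m F₁ F₂ F₃ := by
  induction m generalizing F₁ F₂ F₃ with
  | zero =>
    simp [assocRight, assocLeft, expSum, moyalPow_zero, wick_assoc h₁ h₂ h₃]
  | succ m ih =>
    have hR := hasSumCO_assocRight (ω := ω) m h₁ h₂ h₃
    have hL := hasSumCO_assocLeft (ω := ω) m h₁ h₂ h₃
    have h := hR.unique (hL.congr_terms fun κ => by
      simp only [ih (ann_mem h₁ _ _) (ann_mem h₂ _ _) h₃, ih (ann_mem h₁ _ _) h₂ (ann_mem h₃ _ _),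
        ih h₁ (ann_mem h₂ _ _) (ann_mem h₃ _ _)])
    -- In characteristic zero the factor `m + 1` can be cancelled.
    have hm : (m : 𝕂) + 1 ≠ 0 := by exact_mod_cast Nat.succ_ne_zero m
    exact smul_right_injective _ hm h

end Associativity

/-! ### The bracket as `P^1` and its antisymmetry -/

section Poisson

variable {𝕂 : Type*} [RCLike 𝕂] {d : ℕ} {ω : Matrix (Fin d) (Fin d) ℝ} {F G : Chaos 𝕂 d}

lemma hasSumCO_poissonTerm (hF : F ∈ CO 𝕂 d) (hG : G ∈ CO 𝕂 d) :
    HasSumCO (fun κ => poissonTerm ω κ F G) (moyalPow ω 1 F G) := by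
  refine (hasSumCO_moyalPow_succ 0 hF hG).congr_terms fun κ => ?_
  simp only [moyalPow_zero]
  rfl

lemma poisson_eq_moyalPow_one (hF : F ∈ CO 𝕂 d) (hG : G ∈ CO 𝕂 d) :
    poisson ω F G = moyalPow ω 1 F G := (hasSumCO_poissonTerm hF hG).tsum_eq

lemma inv_apply_swap (hω : ω.transpose = -ω) (i j : Fin d) : ω⁻¹ j i = -ω⁻¹ i j := by
  by_cases hdet : IsUnit ω.det
  · have h : (ω⁻¹).transpose = -ω⁻¹ := by
      rw [Matrix.transpose_nonsing_inv, hω]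
      exact Matrix.inv_eq_right_inv (by rw [neg_mul_neg, Matrix.mul_nonsing_inv _ hdet])
    exact congrFun (congrFun h i) j
  -- A singular matrix has inverse `0` by convention, which is antisymmetric as well.
  · rw [Matrix.nonsing_inv_apply_not_isUnit _ hdet]
    simp

/-- Commutativity of the Wick product exchanges the roles of `i` and `j`, and antisymmetry of `ω⁻¹`
gives the sign. -/
lemma poissonTerm_swap (hω : ω.transpose = -ω) (κ : ℤ) (hF : F ∈ CO 𝕂 d) (hG : G ∈ CO 𝕂 d) :
    poissonTerm ω κ G F = (-1 : 𝕂) • poissonTerm ω κ F G := by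
  unfold poissonTerm
  rw [Finset.sum_comm]
  simp only [Finset.smul_sum]
  refine Finset.sum_congr rfl fun i _ => Finset.sum_congr rfl fun j _ => ?_
  rw [wick_comm (ann_mem hG j κ) (ann_mem hF i κ), inv_apply_swap hω i j, smul_smul]
  congr 1
  push_cast
  ring

lemma moyalPow_one_swap (hω : ω.transpose = -ω) (hF : F ∈ CO 𝕂 d) (hG : G ∈ CO 𝕂 d) :
    moyalPow ω 1 G F = (-1 : 𝕂) • moyalPow ω 1 F G :=
  (hasSumCO_poissonTerm hG hF).unique
    (((hasSumCO_poissonTerm hF hG).map (isBoundedLinear_smul (-1 : 𝕂))).congr_terms fun κ =>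
      poissonTerm_swap hω κ hF hG)

end Poisson

/-! ### The star-product on formal series -/

section Star

variable {𝕂 : Type*} [RCLike 𝕂] {d : ℕ} {ω : Matrix (Fin d) (Fin d) ℝ}

lemma sum_antidiagonal_assoc {M : Type*} [AddCommMonoid M] (m : ℕ) (u : ℕ → ℕ → ℕ → M) :
    ∑ x ∈ Finset.HasAntidiagonal.antidiagonal m, ∑ y ∈ Finset.HasAntidiagonal.antidiagonal x.1,
      u y.1 y.2 x.2 =
    ∑ x ∈ Finset.HasAntidiagonal.antidiagonal m, ∑ y ∈ Finset.HasAntidiagonal.antidiagonal x.2,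
      u x.1 y.1 y.2 := by
  rw [Finset.sum_sigma', Finset.sum_sigma']
  refine Finset.sum_nbij' (fun z => ⟨(z.2.1, z.2.2 + z.1.2), (z.2.2, z.1.2)⟩)
    (fun z => ⟨(z.1.1 + z.2.1, z.2.2), (z.1.1, z.2.1)⟩) ?_ ?_ ?_ ?_ fun _ _ => rfl
  all_goals
    rintro ⟨⟨a, b⟩, ⟨c, e⟩⟩ h
    rw [Finset.mem_sigma, Finset.HasAntidiagonal.mem_antidiagonal,
      Finset.HasAntidiagonal.mem_antidiagonal] at h
    obtain ⟨h1, h2⟩ := h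
    dsimp only at h1 h2
  · subst h1 h2
    simp only [Finset.mem_sigma, Finset.HasAntidiagonal.mem_antidiagonal]
    exact ⟨(add_assoc _ _ _).symm, trivial⟩
  · subst h1 h2
    simp only [Finset.mem_sigma, Finset.HasAntidiagonal.mem_antidiagonal]
    exact ⟨add_assoc _ _ _, trivial⟩
  · subst h2; rfl
  · subst h2; rfl

/-- Both sides run over triples with sum `m`; with `sum_antidiagonal_assoc` this moves the index of
a scalar power series past those of the star-product. -/
lemma sum_antidiagonal_left_comm {M : Type*} [AddCommMonoid M] (m : ℕ) (u : ℕ → ℕ → ℕ → M) :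
    ∑ x ∈ Finset.HasAntidiagonal.antidiagonal m, ∑ y ∈ Finset.HasAntidiagonal.antidiagonal x.2,
      u x.1 y.1 y.2 =
    ∑ x ∈ Finset.HasAntidiagonal.antidiagonal m, ∑ y ∈ Finset.HasAntidiagonal.antidiagonal x.2,
      u y.1 x.1 y.2 := by
  rw [← sum_antidiagonal_assoc, ← sum_antidiagonal_assoc m fun a b c => u b a c]
  refine Finset.sum_congr rfl fun x _ => ?_
  exact Finset.Nat.sum_antidiagonal_swap (n := x.1) (f := fun y : ℕ × ℕ => u y.2 y.1 x.2)

lemma moyalPow_hsmul_left (r a : ℕ) (c : PowerSeries 𝕂) {f : ℕ → Chaos 𝕂 d} {G : Chaos 𝕂 d}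
    (hf : ∀ m, f m ∈ CO 𝕂 d) (hG : G ∈ CO 𝕂 d) : moyalPow ω r (hsmul c f a) G =
      ∑ uv ∈ Finset.HasAntidiagonal.antidiagonal a,
        PowerSeries.coeff uv.1 c • moyalPow ω r (f uv.2) G := by
  have hT := isBoundedLinear_moyalPow_left (ω := ω) r hG
  refine (hT.sum _ fun uv _ => Submodule.smul_mem _ _ (hf uv.2)).trans
    (Finset.sum_congr rfl fun uv _ => hT.smul _ _ (hf uv.2))

lemma moyalPow_hsmul_right (r a : ℕ) (c : PowerSeries 𝕂) {f : ℕ → Chaos 𝕂 d} {F : Chaos 𝕂 d}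
    (hF : F ∈ CO 𝕂 d) (hf : ∀ m, f m ∈ CO 𝕂 d) : moyalPow ω r F (hsmul c f a) =
      ∑ uv ∈ Finset.HasAntidiagonal.antidiagonal a,
        PowerSeries.coeff uv.1 c • moyalPow ω r F (f uv.2) := by
  have hT := isBoundedLinear_moyalPow_right (ω := ω) r hF
  refine (hT.sum _ fun uv _ => Submodule.smul_mem _ _ (hf uv.2)).trans
    (Finset.sum_congr rfl fun uv _ => hT.smul _ _ (hf uv.2))

lemma moyalStar_hsmul_left (c : PowerSeries 𝕂) {f g : ℕ → Chaos 𝕂 d} (hf : ∀ m, f m ∈ CO 𝕂 d)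
    (hg : ∀ m, g m ∈ CO 𝕂 d) : moyalStar ω (hsmul c f) g = hsmul c (moyalStar ω f g) := by
  funext m
  change _ = ∑ ab ∈ Finset.HasAntidiagonal.antidiagonal m,
    PowerSeries.coeff ab.1 c • moyalStar ω f g ab.2
  simp only [moyalStar, moyalPow_hsmul_left _ _ c hf (hg _)]
  simp only [Finset.smul_sum]
  rw [← sum_antidiagonal_left_comm m fun r u t => ∑ vb ∈ Finset.HasAntidiagonal.antidiagonal t,
    PowerSeries.coeff u c • (r ! : 𝕂)⁻¹ • moyalPow ω r (f vb.1) (g vb.2)]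
  refine Finset.sum_congr rfl fun rq _ => ?_
  rw [← sum_antidiagonal_assoc rq.2 fun u v b =>
    PowerSeries.coeff u c • (rq.1 ! : 𝕂)⁻¹ • moyalPow ω rq.1 (f v) (g b)]
  refine Finset.sum_congr rfl fun ab _ => Finset.sum_congr rfl fun uv _ => smul_comm _ _ _

lemma moyalStar_hsmul_right (c : PowerSeries 𝕂) {f g : ℕ → Chaos 𝕂 d} (hf : ∀ m, f m ∈ CO 𝕂 d)
    (hg : ∀ m, g m ∈ CO 𝕂 d) : moyalStar ω f (hsmul c g) = hsmul c (moyalStar ω f g) := by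
  funext m
  change _ = ∑ ab ∈ Finset.HasAntidiagonal.antidiagonal m,
    PowerSeries.coeff ab.1 c • moyalStar ω f g ab.2
  simp only [moyalStar, moyalPow_hsmul_right _ _ c (hf _) hg]
  simp only [Finset.smul_sum]
  rw [← sum_antidiagonal_left_comm m fun r u t => ∑ vb ∈ Finset.HasAntidiagonal.antidiagonal t,
    PowerSeries.coeff u c • (r ! : 𝕂)⁻¹ • moyalPow ω r (f vb.1) (g vb.2)]
  refine Finset.sum_congr rfl fun rq _ => ?_
  rw [← sum_antidiagonal_left_comm rq.2 fun v u b =>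
    PowerSeries.coeff u c • (rq.1 ! : 𝕂)⁻¹ • moyalPow ω rq.1 (f v) (g b)]
  refine Finset.sum_congr rfl fun ab _ => Finset.sum_congr rfl fun uv _ => smul_comm _ _ _

lemma const_mem {F : Chaos 𝕂 d} (hF : F ∈ CO 𝕂 d) (m : ℕ) : const F m ∈ CO 𝕂 d := by
  cases m with
  | zero => exact hF
  | succ m => exact zero_mem _

lemma moyalStar_const_left {F : Chaos 𝕂 d} {g : ℕ → Chaos 𝕂 d} (hg : ∀ m, g m ∈ CO 𝕂 d) (m : ℕ) :
    moyalStar ω (const F) g m = ∑ rq ∈ Finset.HasAntidiagonal.antidiagonal m,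
      (rq.1 ! : 𝕂)⁻¹ • moyalPow ω rq.1 F (g rq.2) := by
  refine Finset.sum_congr rfl fun rq _ => ?_
  rw [Finset.sum_eq_single (0, rq.2)]
  · rfl
  · rintro ⟨a, b⟩ hab hne
    rw [Finset.HasAntidiagonal.mem_antidiagonal] at hab
    have ha : a ≠ 0 := fun h => hne (by simp only at hab; rw [h, ← hab, h, zero_add])
    have h0 : const F a = 0 := Pi.single_eq_of_ne ha _
    rw [h0, (isBoundedLinear_moyalPow_left (ω := ω) rq.1 (hg b)).zero, smul_zero]
  · intro h
    exact absurd (Finset.HasAntidiagonal.mem_antidiagonal.2 (zero_add _)) h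

lemma moyalStar_const_right {f : ℕ → Chaos 𝕂 d} {G : Chaos 𝕂 d} (hf : ∀ m, f m ∈ CO 𝕂 d) (m : ℕ) :
    moyalStar ω f (const G) m = ∑ rq ∈ Finset.HasAntidiagonal.antidiagonal m,
      (rq.1 ! : 𝕂)⁻¹ • moyalPow ω rq.1 (f rq.2) G := by
  refine Finset.sum_congr rfl fun rq _ => ?_
  rw [Finset.sum_eq_single (rq.2, 0)]
  · rfl
  · rintro ⟨a, b⟩ hab hne
    rw [Finset.HasAntidiagonal.mem_antidiagonal] at hab
    have hb : b ≠ 0 := fun h => hne (by simp only at hab; rw [h, ← hab, h, add_zero])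
    have h0 : const G b = 0 := Pi.single_eq_of_ne hb _
    rw [h0, (isBoundedLinear_moyalPow_right (ω := ω) rq.1 (hf a)).zero, smul_zero]
  · intro h
    exact absurd (Finset.HasAntidiagonal.mem_antidiagonal.2 (add_zero _)) h

lemma moyalStar_const_const {F G : Chaos 𝕂 d} (hF : F ∈ CO 𝕂 d) (hG : G ∈ CO 𝕂 d) :
    moyalStar ω (const F) (const G) = fun r => (r ! : 𝕂)⁻¹ • moyalPow ω r F G := by
  funext m
  rw [moyalStar_const_left (const_mem hG), Finset.sum_eq_single (m, 0)]
  · rfl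
  · rintro ⟨r, q⟩ hrq hne
    rw [Finset.HasAntidiagonal.mem_antidiagonal] at hrq
    have hq : q ≠ 0 := fun h => hne (by simp only at hrq; rw [h, ← hrq, h, add_zero])
    have h0 : const G q = 0 := Pi.single_eq_of_ne hq _
    rw [h0, (isBoundedLinear_moyalPow_right (ω := ω) r hF).zero, smul_zero]
  · intro h
    exact absurd (Finset.HasAntidiagonal.mem_antidiagonal.2 (add_zero _)) h

/-- For constant series the inner factorials come out of `P^r` by bilinearity, and the coefficients
become exactly `assocRight` and `assocLeft`. -/
lemma moyalStar_assoc {F₁ F₂ F₃ : Chaos 𝕂 d} (h₁ : F₁ ∈ CO 𝕂 d) (h₂ : F₂ ∈ CO 𝕂 d)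
    (h₃ : F₃ ∈ CO 𝕂 d) : moyalStar ω (const F₁) (moyalStar ω (const F₂) (const F₃)) =
      moyalStar ω (moyalStar ω (const F₁) (const F₂)) (const F₃) := by
  funext m
  rw [moyalStar_const_const h₂ h₃, moyalStar_const_const h₁ h₂,
    moyalStar_const_left fun q => Submodule.smul_mem _ _ (moyalPow_mem q h₂ h₃),
    moyalStar_const_right fun q => Submodule.smul_mem _ _ (moyalPow_mem q h₁ h₂)]
  simp only [moyalPow_smul_right _ _ h₁ (moyalPow_mem _ h₂ h₃),
    moyalPow_smul_left _ _ (moyalPow_mem _ h₁ h₂) h₃, smul_smul]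
  exact assocRight_eq_assocLeft m h₁ h₂ h₃

lemma moyalStar_mem {f g : ℕ → Chaos 𝕂 d} (hf : ∀ m, f m ∈ CO 𝕂 d) (hg : ∀ m, g m ∈ CO 𝕂 d)
    (m : ℕ) : moyalStar ω f g m ∈ CO 𝕂 d :=
  sum_mem fun rq _ => sum_mem fun ab _ =>
    Submodule.smul_mem _ _ (moyalPow_mem rq.1 (hf ab.1) (hg ab.2))

lemma isDeformationQuantization_moyalStar (hω : ω.transpose = -ω) :
    IsDeformationQuantization (𝕂 := 𝕂) (poisson ω) (moyalPow ω) (moyalStar ω) where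
  star_mem _ _ hf hg m := moyalStar_mem hf hg m
  star_add_left f f' g hf hf' hg := by
    funext m
    simp only [moyalStar, Pi.add_apply, moyalPow_add_left _ (hf _) (hf' _) (hg _), smul_add,
      Finset.sum_add_distrib]
  star_add_right f g g' hf hg hg' := by
    funext m
    simp only [moyalStar, Pi.add_apply, moyalPow_add_right _ (hf _) (hg _) (hg' _), smul_add,
      Finset.sum_add_distrib]
  star_hsmul_left c _ _ hf hg := moyalStar_hsmul_left c hf hg
  star_hsmul_right c _ _ hf hg := moyalStar_hsmul_right c hf hg
  star_const _ hF _ hG := moyalStar_const_const hF hG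
  P_mem r _ hF _ hG := moyalPow_mem r hF hG
  P_add_left r _ hF _ hF' _ hG := moyalPow_add_left r hF hF' hG
  P_add_right r _ hF _ hG _ hG' := moyalPow_add_right r hF hG hG'
  P_smul_left r c _ hF _ hG := moyalPow_smul_left r c hF hG
  P_smul_right r c _ hF _ hG := moyalPow_smul_right r c hF hG
  P_zero F _ G _ := moyalPow_zero F G
  P_one F hF G hG := by
    rw [poisson_eq_moyalPow_one hF hG, moyalPow_one_swap hω hF hG, neg_one_smul, sub_neg_eq_add,
      two_smul]
  P_bound r hr k C hC := by
    obtain ⟨K, k₁, C₁, hK, hk₁, hC₁, hb⟩ := coNorm_moyalPow_le (𝕂 := 𝕂) (ω := ω) r k hC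
    -- Adding `1` makes the constant positive even when `K = 0`.
    refine ⟨K.toReal + 1, k₁, C₁, by positivity, hk₁ hr, hC₁, fun F hF G hG =>
      (hb F hF G hG).trans ?_⟩
    have h : K ≤ ENNReal.ofReal (K.toReal + 1) := by
      rw [← ENNReal.ofReal_toReal hK]
      refine ENNReal.ofReal_le_ofReal ?_
      rw [ENNReal.ofReal_toReal hK]
      linarith
    gcongr
  star_assoc _ h₁ _ h₂ _ h₃ := moyalStar_assoc h₁ h₂ h₃

end Star

end Connes

end

theorem theorem3 {𝕂 : Type*} [RCLike 𝕂] (d : ℕ) (ω : Matrix (Fin d) (Fin d) ℝ)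
    (hω : ω.transpose = -ω) (hdet : IsUnit ω.det) :
    (∀ F ∈ Connes.CO 𝕂 d, ∀ G ∈ Connes.CO 𝕂 d,
      Connes.HasSumCO (fun k : ℤ => Connes.poissonTerm ω k F G) (Connes.poisson ω F G)) ∧
    (∀ r : ℕ, ∀ F ∈ Connes.CO 𝕂 d, ∀ G ∈ Connes.CO 𝕂 d,
      Connes.HasSumCO (fun k : Fin r → ℤ => Connes.moyalTerm ω r k F G)
        (Connes.moyalPow ω r F G)) ∧
    Connes.IsDeformationQuantization (𝕂 := 𝕂) (Connes.poisson ω) (Connes.moyalPow ω)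
      (Connes.moyalStar ω) :=
  ⟨fun F hF G hG => by
      rw [Connes.poisson_eq_moyalPow_one hF hG]
      exact Connes.hasSumCO_poissonTerm hF hG,
    fun r F hF G hG => Connes.hasSumCO_moyalPow r hF hG,
    Connes.isDeformationQuantization_moyalStar hω⟩
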